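/- Let $n\ge 19$ be an integer and $\tau\in\mathbb R$. Let $W=(W_{ijkl})$ be a multilinear form on $\mathbb R^n$ with the algebraic symmetries of a Weyl tensor (antisymmetric in $i,j$ and in $k,l$, symmetric under exchange of the pairs $ij$ and $kl$, first Bianchi identity, all traces zero), and suppose $\sum_{i,j,k,l}(W_{ijkl}+W_{ilkj})^2>0$. Put $$f(s)=\tau+5s-s^2+\tfrac1{20}s^3,\qquad \overline H_{ik}(x)=f(|x|^2)\sum_{p,q=1}^n W_{ipkq}\,x_px_q .$$ For $\xi\in\mathbb R^n$, $\varepsilon>0$ let $u_{(\xi,\varepsilon)}(x)=\big(\frac{\varepsilon}{\varepsilon^2+|x-\xi|^2}\big)^{\frac{n-2}2}$ and $$\varphi_{(\xi,\varepsilon,0)}(x)=\Big(\tfrac{\varepsilon}{\varepsilon^2+|x-\xi|^2}\Big)^{\frac{n+2}2}\,\tfrac{\varepsilon^2-|x-\xi|^2}{\varepsilon^2+|x-\xi|^2},\qquad \varphi_{(\xi,\varepsilon,k)}(x)=\Big(\tfrac{\varepsilon}{\varepsilon^2+|x-\xi|^2}\Big)^{\frac{n+2}2}\,\tfrac{2\varepsilon(x_k-\xi_k)}{\varepsilon^2+|x-\xi|^2}\quad(1\le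 k\le n).$$ Let $\mathcal E_{(\xi,\varepsilon)}$ be the space of all $w\in L^{\frac{2n}{n-2}}(\mathbb R^n)\cap W^{1,2}_{loc}(\mathbb R^n)$ with $\int_{\mathbb R^n}|dw|^2<\infty$ and $\int_{\mathbb R^n}\varphi_{(\xi,\varepsilon,k)}\,w=0$ for $k=0,1,\dots,n$. Let $z_{(\xi,\varepsilon)}\in\mathcal E_{(\xi,\varepsilon)}$ be the solution of $$\int_{\mathbb R^n}\Big(\langle dz_{(\xi,\varepsilon)},d\psi\rangle-n(n+2)\,u_{(\xi,\varepsilon)}^{\frac4{n-2}}\,z_{(\xi,\varepsilon)}\,\psi\Big)=-\int_{\mathbb R^n}\sum_{i,k=1}^n\overline H_{ik}\,\partial_i\partial_ku_{(\xi,\varepsilon)}\,\psi\qquad\text{for all }\psi\in\mathcal E_{(\xi,\varepsilon)},$$ and define $F:\mathbb R^n\times(0,\infty)\to\mathbb R$ by $$F(\xi,\varepsilon)=\int_{\mathbb R^n}\tfrac12\sum_{i,k,l=1}^n\overline H_{il}\overline H_{kl}\,\partial_iu_{(\xi,\varepsilon)}\,\partial_ku_{(\xi,\varepsilon)}-\int_{\mathbb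 R^n}\tfrac{n-2}{16(n-1)}\sum_{i,k,l=1}^n(\partial_l\overline H_{ik})^2\,u_{(\xi,\varepsilon)}^2+\int_{\mathbb R^n}\sum_{i,k=1}^n\overline H_{ik}\,\partial_i\partial_ku_{(\xi,\varepsilon)}\,z_{(\xi,\varepsilon)} .$$ Let $I$ and $J$ be the polynomials $$\begin{aligned}I(s)={}&\tfrac{n-12}{n+6}\tfrac{n-10}{n+4}(n-8)\tau^2s^2+10\,\tfrac{n-12}{n+6}(n-10)\tau s^3+\Big(25\,\tfrac{n-12}{n+6}(n+8)-2(n-12)\tau\Big)s^4\\&+\Big(\tfrac{n+8}{10}\tau-10(n+12)\Big)s^5+\tfrac{n+8}{n-14}\tfrac{3n+52}{2}s^6-\tfrac{n+8}{n-14}\tfrac{n+10}{n-16}\tfrac{n+24}{10}s^7\\&+\tfrac{n+8}{n-14}\tfrac{n+10}{n-16}\tfrac{n+12}{n-18}\tfrac{n+32}{400}s^8,\\ J(s)={}&10\,\tfrac{n-10}{n+8}\tfrac{n-8}{n+6}\tau s^2+\tfrac{n-10}{n+8}(75-4\tau)s^3+\Big(\tfrac3{10}\tau-50\Big)s^4+\tfrac{23}2\tfrac{n+10}{n-12}s^5\\&-\tfrac{11}{10}\tfrac{n+10}{n-12}\tfrac{n+12}{n-14}s^6+\tfrac3{80}\tfrac{n+10}{n-12}\tfrac{n+12}{n-14}\tfrac{n+14}{n-16}s^7.\end{aligned}$$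 If $I'(1)=0$, $I''(1)<0$ and $J(1)<0$, then $F$ has a strict local minimum at $(0,1)$; that is, $F(0,1)<F(\xi,\varepsilon)$ for all $(\xi,\varepsilon)\neq(0,1)$ in some neighbourhood of $(0,1)$. -/

import Mathlib

open MeasureTheory Filter Topology
open scoped ContDiff

namespace YamabeBlowup

noncomputable section

/-- The Euclidean space `ℝⁿ`. -/
abbrev Eucl (n : ℕ) : Type := EuclideanSpace ℝ (Fin n)

/-- The classical partial derivative `∂ᵢ φ`. -/
def pd {n : ℕ} (i : Fin n) (φ : Eucl n → ℝ) (x : Eucl n) : ℝ :=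
  fderiv ℝ φ x (EuclideanSpace.single i 1)

/-- `G` is the weak (distributional) gradient of `w` on `ℝⁿ`. -/
structure IsWeakGradient {n : ℕ} (w : Eucl n → ℝ) (G : Eucl n → Eucl n) : Prop where
  locallyIntegrable : LocallyIntegrable w
  locallyIntegrable_grad : LocallyIntegrable G
  integral_eq : ∀ φ : Eucl n → ℝ, ContDiff ℝ ∞ φ → HasCompactSupport φ →
    ∀ i : Fin n, ∫ x, w x * pd i φ x = - ∫ x, G x i * φ x

/-- `w` belongs to the space `𝓔` of functions in `L^{2n/(n-2)} ∩ W^{1,2}_loc` with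
`∫ |dw|² < ∞`, and `G` is its weak gradient. -/
structure MemEnergy {n : ℕ} (w : Eucl n → ℝ) (G : Eucl n → Eucl n) : Prop where
  memLp : MemLp w (ENNReal.ofReal (2 * (n : ℝ) / ((n : ℝ) - 2)))
  /-- `w` is locally square integrable. -/
  memLp_loc : ∀ K : Set (Eucl n), IsCompact K → MemLp w 2 (volume.restrict K)
  weakGradient : IsWeakGradient w G
  memLp_grad : MemLp G 2

/-- The bubble `u_{(ξ,ε)}`. -/
def bubble {n : ℕ} (ξ : Eucl n) (ε : ℝ) (x : Eucl n) : ℝ :=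
  (ε / (ε ^ 2 + ‖x - ξ‖ ^ 2)) ^ (((n : ℝ) - 2) / 2)

/-- The function `φ_{(ξ,ε,0)}`. -/
def phiZero {n : ℕ} (ξ : Eucl n) (ε : ℝ) (x : Eucl n) : ℝ :=
  (ε / (ε ^ 2 + ‖x - ξ‖ ^ 2)) ^ (((n : ℝ) + 2) / 2) *
    ((ε ^ 2 - ‖x - ξ‖ ^ 2) / (ε ^ 2 + ‖x - ξ‖ ^ 2))

/-- The functions `φ_{(ξ,ε,k)}`, `k = 1, …, n`. -/
def phi {n : ℕ} (ξ : Eucl n) (ε : ℝ) (k : Fin n) (x : Eucl n) : ℝ :=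
  (ε / (ε ^ 2 + ‖x - ξ‖ ^ 2)) ^ (((n : ℝ) + 2) / 2) *
    (2 * ε * (x k - ξ k) / (ε ^ 2 + ‖x - ξ‖ ^ 2))

/-- `w`, with weak gradient `G`, belongs to the subspace `𝓔_{(ξ,ε)}` of `𝓔`. -/
structure MemEnergyPerp {n : ℕ} (ξ : Eucl n) (ε : ℝ) (w : Eucl n → ℝ)
    (G : Eucl n → Eucl n) : Prop where
  memEnergy : MemEnergy w G
  integral_phiZero : ∫ x, phiZero ξ ε x * w x = 0
  integral_phi : ∀ k : Fin n, ∫ x, phi ξ ε k x * w x = 0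

/-- The array of components `W i j k l` has the algebraic properties of a Weyl tensor:
the symmetries of a curvature tensor, the first Bianchi identity, and vanishing trace. -/
structure IsWeylTensor {n : ℕ} (W : Fin n → Fin n → Fin n → Fin n → ℝ) : Prop where
  antisymm_left : ∀ i j k l, W i j k l = - W j i k l
  antisymm_right : ∀ i j k l, W i j k l = - W i j l k
  pair_symm : ∀ i j k l, W i j k l = W k l i j
  bianchi : ∀ i j k l, W i j k l + W j k i l + W k i j l = 0
  trace_free : ∀ j l, ∑ i, W i j i l = 0

/-- The polynomial `f(s) = τ + 5s - s² + s³/20`. -/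
def profile (τ s : ℝ) : ℝ := τ + 5 * s - s ^ 2 + 1 / 20 * s ^ 3

/-- `H_{ik}(x) = ∑_{p,q} W_{ipkq} x_p x_q`. -/
def tensorH {n : ℕ} (W : Fin n → Fin n → Fin n → Fin n → ℝ) (i k : Fin n) (x : Eucl n) : ℝ :=
  ∑ p, ∑ q, W i p k q * x p * x q

/-- `H̄_{ik}(x) = f(|x|²) H_{ik}(x)`. -/
def tensorHBar {n : ℕ} (τ : ℝ) (W : Fin n → Fin n → Fin n → Fin n → ℝ) (i k : Fin n)
    (x : Eucl n) : ℝ :=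
  profile τ (‖x‖ ^ 2) * tensorH W i k x

/-- The function `∑_{i,k} H̄_{ik} ∂ᵢ∂ₖ u_{(ξ,ε)}`. -/
def source {n : ℕ} (τ : ℝ) (W : Fin n → Fin n → Fin n → Fin n → ℝ) (ξ : Eucl n) (ε : ℝ)
    (x : Eucl n) : ℝ :=
  ∑ i, ∑ k, tensorHBar τ W i k x * pd i (pd k (bubble ξ ε)) x

/-- `z ∈ 𝓔_{(ξ,ε)}` solves the linearized equation
`∫ (⟨dz,dψ⟩ - n(n+2) u^{4/(n-2)} z ψ) = - ∫ ∑ H̄_{ik} ∂ᵢ∂ₖ u ψ` for all `ψ ∈ 𝓔_{(ξ,ε)}`. -/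
def IsCorrection {n : ℕ} (τ : ℝ) (W : Fin n → Fin n → Fin n → Fin n → ℝ) (ξ : Eucl n) (ε : ℝ)
    (z : Eucl n → ℝ) : Prop :=
  ∃ Z : Eucl n → Eucl n, MemEnergyPerp ξ ε z Z ∧
    ∀ (ψ : Eucl n → ℝ) (Ψ : Eucl n → Eucl n), MemEnergyPerp ξ ε ψ Ψ →
      ∫ x, (inner ℝ (Z x) (Ψ x)
          - (n : ℝ) * ((n : ℝ) + 2) * bubble ξ ε x ^ (4 / ((n : ℝ) - 2)) * z x * ψ x)
        = - ∫ x, source τ W ξ ε x * ψ x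

open Classical in
/-- The function `z_{(ξ,ε)}`. The linearized equation determines it up to a null set; which
representative is chosen does not affect the integrals in which it is used. -/
def correction {n : ℕ} (τ : ℝ) (W : Fin n → Fin n → Fin n → Fin n → ℝ) (ξ : Eucl n) (ε : ℝ) :
    Eucl n → ℝ :=
  if h : ∃ z, IsCorrection τ W ξ ε z then h.choose else 0

/-- The auxiliary function `F(ξ,ε)`; it is meant for `ε > 0`. -/
def auxF {n : ℕ} (τ : ℝ) (W : Fin n → Fin n → Fin n → Fin n → ℝ) (ξ : Eucl n) (ε : ℝ) : ℝ :=
  (∫ x, 1 / 2 * ∑ i, ∑ k, ∑ l, tensorHBar τ W i l x * tensorHBar τ W k l x *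
      pd i (bubble ξ ε) x * pd k (bubble ξ ε) x)
  - (∫ x, ((n : ℝ) - 2) / (16 * ((n : ℝ) - 1)) *
      (∑ i, ∑ k, ∑ l, (pd l (tensorHBar τ W i k) x) ^ 2) * bubble ξ ε x ^ 2)
  + ∫ x, source τ W ξ ε x * correction τ W ξ ε x

/-- The polynomial `I(s)`. -/
def polyI (n τ s : ℝ) : ℝ :=
  (n - 12) / (n + 6) * ((n - 10) / (n + 4)) * (n - 8) * τ ^ 2 * s ^ 2
  + 10 * ((n - 12) / (n + 6)) * (n - 10) * τ * s ^ 3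
  + (25 * ((n - 12) / (n + 6)) * (n + 8) - 2 * (n - 12) * τ) * s ^ 4
  + ((n + 8) / 10 * τ - 10 * (n + 12)) * s ^ 5
  + (n + 8) / (n - 14) * ((3 * n + 52) / 2) * s ^ 6
  - (n + 8) / (n - 14) * ((n + 10) / (n - 16)) * ((n + 24) / 10) * s ^ 7
  + (n + 8) / (n - 14) * ((n + 10) / (n - 16)) * ((n + 12) / (n - 18)) * ((n + 32) / 400) * s ^ 8

/-- The polynomial `J(s)`. -/
def polyJ (n τ s : ℝ) : ℝ :=
  10 * ((n - 10) / (n + 8)) * ((n - 8) / (n + 6)) * τ * s ^ 2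
  + (n - 10) / (n + 8) * (75 - 4 * τ) * s ^ 3
  + (3 / 10 * τ - 50) * s ^ 4
  + 23 / 2 * ((n + 10) / (n - 12)) * s ^ 5
  - 11 / 10 * ((n + 10) / (n - 12)) * ((n + 12) / (n - 14)) * s ^ 6
  + 3 / 80 * ((n + 10) / (n - 12)) * ((n + 12) / (n - 14)) * ((n + 14) / (n - 16)) * s ^ 7

end

end YamabeBlowup

open MeasureTheory Filter Topology
open scoped ContDiff
namespace YamabeBlowup
noncomputable section

open MvPolynomial (X C pderiv)

/-! Write y = x - ξ and D = ε² + |y|². The proof shows that the term containing z is of order |ξ|⁴,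
and computes the other two integrals to second order in ξ as explicit moments.

The correction. The symmetries of W turn the source ∑ H̄_ik ∂_i∂_k u into n(n-2) ε^((n-2)/2) f(|x|²)
B(y,y) D^(-(n/2+1)), where B_pq = ∑ W_ipkq ξ_i ξ_k is symmetric, trace-free, annihilates ξ and is
quadratic in ξ (`IsWeylTensor.source_eq`). Since |x|² = D + 2⟨ξ,y⟩ + |ξ|² - ε² and f is a cubic, the
source is a combination of functions B(y,y) ⟨ξ,y⟩^a D^(-M). On these the operator Δ + n(n+2) ε²/D²
is triangular and is inverted by hand, with bounds of order |ξ|² uniform near (0,1)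
(`uniformlySolvable_pw`). Orthogonality to the φ_k is automatic because B is trace-free and
annihilates ξ. Testing the equations of z and of the explicit solution against each other shows that
both give the same last integral in F; uniqueness of z is not needed. Source and solution are both
O(|ξ|²), so this integral is O(|ξ|⁴) (`IsWeylTensor.abs_correction_energy_le`).

The other two integrals. As H(x)x = 0 and the gradient of u is parallel to y, the first integrand is
exactly quadratic in ξ up to its weight. In the second, only the weight D^(-(n-2)) depends on ξ; it
is expanded to second order, and the linear term vanishes by parity. Spherical averages of
polynomials are obtained by applying the Laplacian until a constant is left (`HasAverage.of_lap`);
only |W|²|ξ|² and |∂H(ξ)|² survive, where |W|² is `weylSq W`.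

The result (`IsWeylTensor.exists_le_auxF` with `IsWeylTensor.exists_energyZero_eq`) is a bound
F(ξ,ε) ≥ -κ I(ε²) + |ξ|² (|W|² a(ε) - K|ξ|) + |∂H(ξ)|² (b₊(ε)(1 - 8n|ξ|) - b₋(ε)), κ > 0, and F(0,1)
= -κ I(1). All radial moments of a given weight are explicit multiples of one positive number. This
makes b₊(1) - b₋(1) a positive multiple of -J(1), and makes a(1) affine in τ with a sign that J(1) <
0 forces to be positive. Since I has a strict local maximum at 1, F has a strict local minimum at
(0,1). -/

/-- Real polynomials in `n` variables. -/
abbrev Poly (n : ℕ) : Type := MvPolynomial (Fin n) ℝ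

/-- Evaluation of a polynomial at a point of `ℝⁿ`. -/
abbrev ev {n : ℕ} (x : Eucl n) : Poly n →+* ℝ := MvPolynomial.eval x.ofLp

/-- The function `P(x) (ε² + |x - ξ|²)^{-m}`. -/
def pw {n : ℕ} (ξ : Eucl n) (ε : ℝ) (P : Poly n) (m : ℝ) (x : Eucl n) : ℝ :=
  ev x P * (ε ^ 2 + ‖x - ξ‖ ^ 2) ^ (-m)

/-! ### Differentiation of polynomials times powers of the weight. -/

section calculus
variable {n : ℕ}

lemma coord_contDiff (i : Fin n) : ContDiff ℝ ∞ (fun x : Eucl n => x i) :=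
  (EuclideanSpace.proj (𝕜 := ℝ) i).contDiff

lemma ev_contDiff (P : Poly n) : ContDiff ℝ ∞ (fun x : Eucl n => ev x P) := by
  induction P using MvPolynomial.induction_on with
  | C a => simpa using contDiff_const
  | add p q hp hq => simpa using hp.add hq
  | mul_X p i hp => simpa using hp.mul (coord_contDiff i)

lemma ev_continuous (P : Poly n) : Continuous (fun x : Eucl n => ev x P) :=
  (ev_contDiff P).continuous

lemma pd_const (i : Fin n) (c : ℝ) (x : Eucl n) : pd i (fun _ => c) x = 0 := by
  simp [pd]

lemma pd_add (i : Fin n) {f g : Eucl n → ℝ} {x : Eucl n} (hf : DifferentiableAt ℝ f x)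
    (hg : DifferentiableAt ℝ g x) : pd i (fun y => f y + g y) x = pd i f x + pd i g x := by
  simp [pd, fderiv_fun_add hf hg]

lemma pd_mul (i : Fin n) {f g : Eucl n → ℝ} {x : Eucl n} (hf : DifferentiableAt ℝ f x)
    (hg : DifferentiableAt ℝ g x) :
    pd i (fun y => f y * g y) x = f x * pd i g x + pd i f x * g x := by
  simp [pd, fderiv_fun_mul hf hg, mul_comm]

lemma pd_const_mul (i : Fin n) (c : ℝ) {f : Eucl n → ℝ} {x : Eucl n}
    (hf : DifferentiableAt ℝ f x) : pd i (fun y => c * f y) x = c * pd i f x := by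
  simp [pd, fderiv_const_mul hf]

lemma pd_coord (i j : Fin n) (x : Eucl n) :
    pd i (fun y : Eucl n => y j) x = if j = i then 1 else 0 := by
  have h : fderiv ℝ (fun y : Eucl n => y j) x = EuclideanSpace.proj (𝕜 := ℝ) j :=
    (EuclideanSpace.proj (𝕜 := ℝ) (ι := Fin n) j).hasFDerivAt.fderiv
  rw [pd, h]
  simp

lemma pd_contDiff (i : Fin n) {f : Eucl n → ℝ} (hf : ContDiff ℝ ∞ f) :
    ContDiff ℝ ∞ (pd i f) := by
  have : ContDiff ℝ ∞ (fderiv ℝ f) := hf.fderiv_right (by norm_cast)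
  exact this.clm_apply contDiff_const

lemma pd_ev (i : Fin n) (P : Poly n) (x : Eucl n) :
    pd i (fun y => ev y P) x = ev x (pderiv i P) := by
  induction P using MvPolynomial.induction_on with
  | C a => simpa using pd_const i a x
  | add p q hp hq =>
    have := pd_add i ((ev_contDiff p).contDiffAt.differentiableAt (x := x) (by simp))
      ((ev_contDiff q).contDiffAt.differentiableAt (x := x) (by simp))
    simpa [hp, hq] using this
  | mul_X p j hp =>
    have := pd_mul i ((ev_contDiff p).contDiffAt.differentiableAt (x := x) (by simp))
      ((coord_contDiff j).contDiffAt.differentiableAt (x := x) (by simp))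
    rw [hp, pd_coord] at this
    simp only [map_mul, MvPolynomial.eval_X]
    rw [this]
    by_cases h : j = i
    · subst h; simp; ring
    · simp [h, MvPolynomial.pderiv_X_of_ne h, mul_comm]

lemma weight_pos {ε : ℝ} (hε : 0 < ε) (ξ x : Eucl n) : 0 < ε ^ 2 + ‖x - ξ‖ ^ 2 := by
  positivity

lemma weight_contDiff (ξ : Eucl n) {ε : ℝ} (hε : 0 < ε) (m : ℝ) :
    ContDiff ℝ ∞ (fun x : Eucl n => (ε ^ 2 + ‖x - ξ‖ ^ 2) ^ (-m)) := by
  refine ContDiff.rpow_const_of_ne ?_ (fun x => (weight_pos hε ξ x).ne')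
  exact contDiff_const.add ((contDiff_id.sub contDiff_const).norm_sq ℝ)

lemma pw_contDiff (ξ : Eucl n) {ε : ℝ} (hε : 0 < ε) (P : Poly n) (m : ℝ) :
    ContDiff ℝ ∞ (pw ξ ε P m) :=
  (ev_contDiff P).mul (weight_contDiff ξ hε m)

lemma pd_weight (i : Fin n) (ξ : Eucl n) {ε : ℝ} (hε : 0 < ε) (m : ℝ) (x : Eucl n) :
    pd i (fun x : Eucl n => (ε ^ 2 + ‖x - ξ‖ ^ 2) ^ (-m)) x
      = -2 * m * (x i - ξ i) * (ε ^ 2 + ‖x - ξ‖ ^ 2) ^ (-(m + 1)) := by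
  have h1 : HasFDerivAt (fun x : Eucl n => ε ^ 2 + ‖x - ξ‖ ^ 2)
      (2 • (innerSL ℝ (x - ξ))) x := by
    have := ((hasFDerivAt_id x).sub_const ξ).norm_sq
    simpa using this.const_add (ε ^ 2)
  have h2 := h1.rpow_const (p := -m) (Or.inl (weight_pos hε ξ x).ne')
  rw [pd, h2.fderiv]
  simp [EuclideanSpace.inner_single_right]
  rw [show -m - 1 = -(m + 1) by ring, show (-1 : ℝ) + -m = -(m+1) by ring]
  ring

/-- The polynomial `xᵢ - ξᵢ`. -/
def shiftX (ξ : Eucl n) (i : Fin n) : Poly n := X i - C (ξ i)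

@[simp] lemma ev_shiftX (ξ x : Eucl n) (i : Fin n) : ev x (shiftX ξ i) = x i - ξ i := by
  simp [shiftX]

/-- The span of the functions `pw` is closed under differentiation. Bubbles, sources and correctors
can all be expressed through them, so the calculus reduces to algebra in the polynomial and the
exponent. -/
lemma pd_pw (i : Fin n) (ξ : Eucl n) {ε : ℝ} (hε : 0 < ε) (P : Poly n) (m : ℝ) :
    pd i (pw ξ ε P m) = fun x => pw ξ ε (pderiv i P) m x
      - 2 * m * pw ξ ε (shiftX ξ i * P) (m + 1) x := by
  ext x
  have := pd_mul i ((ev_contDiff P).contDiffAt.differentiableAt (x := x) (by simp))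
    ((weight_contDiff ξ hε m).contDiffAt.differentiableAt (x := x) (by simp))
  rw [pd_ev, pd_weight i ξ hε] at this
  unfold pw
  rw [this]
  simp
  ring

end calculus

/-! ### Polynomial decay at infinity and integrability. -/

section decay
variable {n : ℕ}

/-- `g` is continuous and `O((1 + |x|)^{-r})`. -/
def Decay (r : ℝ) (g : Eucl n → ℝ) : Prop :=
  Continuous g ∧ ∃ K : ℝ, ∀ x, |g x| ≤ K * (1 + ‖x‖) ^ (-r)

lemma one_add_norm_pos (x : Eucl n) : 0 < 1 + ‖x‖ := by positivity

lemma Decay.mono {r s : ℝ} {g : Eucl n → ℝ} (h : Decay r g) (hs : s ≤ r) : Decay s g := by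
  obtain ⟨hc, K, hK⟩ := h
  refine ⟨hc, |K|, fun x => (hK x).trans ?_⟩
  have h1 : (1 + ‖x‖) ^ (-r) ≤ (1 + ‖x‖) ^ (-s) :=
    Real.rpow_le_rpow_of_exponent_le (by linarith [norm_nonneg x]) (by linarith)
  have h0 : 0 ≤ (1 + ‖x‖) ^ (-r) := by positivity
  calc K * (1 + ‖x‖) ^ (-r) ≤ |K| * (1 + ‖x‖) ^ (-r) := by gcongr; exact le_abs_self K
    _ ≤ _ := by gcongr

lemma Decay.congr {r : ℝ} {g h : Eucl n → ℝ} (hg : Decay r g) (e : ∀ x, h x = g x) : Decay r h := by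
  rwa [show h = g from funext e]

lemma Decay.add {r : ℝ} {g h : Eucl n → ℝ} (hg : Decay r g) (hh : Decay r h) :
    Decay r (fun x => g x + h x) := by
  obtain ⟨hc, K, hK⟩ := hg
  obtain ⟨hc', K', hK'⟩ := hh
  refine ⟨hc.add hc', K + K', fun x => (abs_add_le _ _).trans ?_⟩
  rw [add_mul]
  exact add_le_add (hK x) (hK' x)

lemma Decay.const_mul {r : ℝ} {g : Eucl n → ℝ} (c : ℝ) (hg : Decay r g) :
    Decay r (fun x => c * g x) := by
  obtain ⟨hc, K, hK⟩ := hg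
  refine ⟨continuous_const.mul hc, |c| * K, fun x => ?_⟩
  rw [abs_mul, mul_assoc]
  gcongr
  exact hK x

lemma Decay.mul {r s : ℝ} {g h : Eucl n → ℝ} (hg : Decay r g) (hh : Decay s h) :
    Decay (r + s) (fun x => g x * h x) := by
  obtain ⟨hc, K, hK⟩ := hg
  obtain ⟨hc', K', hK'⟩ := hh
  refine ⟨hc.mul hc', K * K', fun x => ?_⟩
  rw [abs_mul, neg_add, Real.rpow_add (one_add_norm_pos x)]
  calc |g x| * |h x| ≤ (K * (1 + ‖x‖) ^ (-r)) * (K' * (1 + ‖x‖) ^ (-s)) :=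
        mul_le_mul (hK x) (hK' x) (abs_nonneg _) ((abs_nonneg _).trans (hK x))
    _ = _ := by ring

lemma Decay.sub {r : ℝ} {g h : Eucl n → ℝ} (hg : Decay r g) (hh : Decay r h) :
    Decay r (fun x => g x - h x) := by
  have := hg.add (hh.const_mul (-1))
  simpa [sub_eq_add_neg] using this

lemma Decay.integrable {r : ℝ} {g : Eucl n → ℝ} (hg : Decay r g) (hr : (n : ℝ) < r) :
    Integrable g := by
  obtain ⟨hc, K, hK⟩ := hg
  have h : Integrable (fun x : Eucl n => (1 + ‖x‖) ^ (-r)) :=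
    integrable_one_add_norm (by simpa using hr)
  exact (h.const_mul K).mono' hc.aestronglyMeasurable (Eventually.of_forall hK)

lemma Decay.memLp {r q : ℝ} {g : Eucl n → ℝ} (hg : Decay r g) (hq : 0 < q)
    (hr : (n : ℝ) < r * q) : MemLp g (ENNReal.ofReal q) := by
  obtain ⟨hc, K, hK⟩ := hg
  have hK0 : 0 ≤ K := by
    have := (abs_nonneg _).trans (hK 0)
    simpa using this
  have h : Integrable (fun x : Eucl n => (1 + ‖x‖) ^ (-(r * q))) :=
    integrable_one_add_norm (by simpa using hr)
  have h2 : Integrable (fun x => ‖g x‖ ^ (ENNReal.ofReal q).toReal) := by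
    rw [ENNReal.toReal_ofReal hq.le]
    refine (h.const_mul (K ^ q)).mono' ?_ (Eventually.of_forall fun x => ?_)
    · exact (hc.norm.rpow_const fun x => Or.inr hq.le).aestronglyMeasurable
    · rw [Real.norm_of_nonneg (by positivity)]
      calc ‖g x‖ ^ q ≤ (K * (1 + ‖x‖) ^ (-r)) ^ q :=
            Real.rpow_le_rpow (norm_nonneg _) (hK x) hq.le
        _ = K ^ q * (1 + ‖x‖) ^ (-(r * q)) := by
          rw [Real.mul_rpow hK0 (by positivity), ← Real.rpow_mul (by positivity), neg_mul]
  exact (integrable_norm_rpow_iff hc.aestronglyMeasurable (by simpa using hq)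
    ENNReal.ofReal_ne_top).1 h2

lemma abs_coord_le (x : Eucl n) (i : Fin n) : |x i| ≤ ‖x‖ := by
  simpa using PiLp.norm_apply_le x i

lemma ev_bound (P : Poly n) :
    ∃ K : ℝ, ∀ x : Eucl n, |ev x P| ≤ K * (1 + ‖x‖) ^ P.totalDegree := by
  refine ⟨∑ d ∈ P.support, |P.coeff d|, fun x => ?_⟩
  rw [MvPolynomial.eval_eq, Finset.sum_mul]
  refine (Finset.abs_sum_le_sum_abs _ _).trans (Finset.sum_le_sum fun d hd => ?_)
  rw [abs_mul, Finset.abs_prod]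
  gcongr
  have h1 : ∏ i ∈ d.support, |x i ^ d i| ≤ ∏ i ∈ d.support, (1 + ‖x‖) ^ d i := by
    refine Finset.prod_le_prod (fun i _ => abs_nonneg _) fun i _ => ?_
    rw [abs_pow]
    gcongr
    linarith [abs_coord_le x i]
  refine h1.trans ?_
  rw [Finset.prod_pow_eq_pow_sum]
  refine pow_le_pow_right₀ (by linarith [norm_nonneg x]) ?_
  exact MvPolynomial.le_totalDegree hd

lemma weight_bound (ξ : Eucl n) {ε : ℝ} (hε : 0 < ε) :
    ∃ K : ℝ, 0 < K ∧ ∀ x, (1 + ‖x‖) ^ 2 ≤ K * (ε ^ 2 + ‖x - ξ‖ ^ 2) := by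
  -- From 1 + |x| ≤ (1 + |ξ|) + |x - ξ|, the square is at most 2(1 + |ξ|)² + 2|x - ξ|²; the two
  -- summands of the constant absorb these terms into ε² and |x - ξ|².
  refine ⟨2 * ((1 + ‖ξ‖) / ε) ^ 2 + 2, by positivity, fun x => ?_⟩
  have h1 : 1 + ‖x‖ ≤ (1 + ‖ξ‖) + ‖x - ξ‖ := by
    have := norm_add_le (x - ξ) ξ
    simp only [sub_add_cancel] at this
    linarith
  have h2 : (1 + ‖x‖) ^ 2 ≤ ((1 + ‖ξ‖) + ‖x - ξ‖) ^ 2 := by gcongr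
  have h3 : 2 * ((1 + ‖ξ‖) / ε) ^ 2 * ε ^ 2 = 2 * (1 + ‖ξ‖) ^ 2 := by field_simp
  nlinarith [sq_nonneg ((1 + ‖ξ‖) - ‖x - ξ‖), sq_nonneg (((1 + ‖ξ‖) / ε) * ‖x - ξ‖),
    sq_nonneg ε]

lemma weight_decay (ξ : Eucl n) {ε : ℝ} (hε : 0 < ε) {m : ℝ} (hm : 0 ≤ m) :
    Decay (2 * m) (fun x : Eucl n => (ε ^ 2 + ‖x - ξ‖ ^ 2) ^ (-m)) := by
  refine ⟨(weight_contDiff ξ hε m).continuous, ?_⟩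
  obtain ⟨K, hK0, hK⟩ := weight_bound ξ hε
  refine ⟨K ^ m, fun x => ?_⟩
  have hw := weight_pos hε ξ x
  have h1 := one_add_norm_pos x
  show |(ε ^ 2 + ‖x - ξ‖ ^ 2) ^ (-m)| ≤ _
  rw [abs_of_nonneg (by positivity), Real.rpow_neg hw.le, Real.rpow_neg h1.le,
    ← div_eq_mul_inv, inv_eq_one_div, div_le_div_iff₀ (by positivity) (by positivity), one_mul,
    Real.rpow_mul h1.le, ← Real.mul_rpow hK0.le hw.le]
  exact Real.rpow_le_rpow (by positivity) (by simpa using hK x) hm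

lemma pw_decay (ξ : Eucl n) {ε : ℝ} (hε : 0 < ε) {P : Poly n} {d : ℕ} (hd : P.totalDegree ≤ d)
    {m : ℝ} (hm : 0 ≤ m) : Decay (2 * m - d) (pw ξ ε P m) := by
  have h1 : Decay (-(d : ℝ)) (fun x : Eucl n => ev x P) := by
    refine ⟨ev_continuous P, ?_⟩
    obtain ⟨K, hK⟩ := ev_bound P
    refine ⟨|K|, fun x => (hK x).trans ?_⟩
    rw [neg_neg, Real.rpow_natCast]
    have : (1 + ‖x‖) ^ P.totalDegree ≤ (1 + ‖x‖) ^ d :=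
      pow_le_pow_right₀ (by linarith [norm_nonneg x]) hd
    calc K * (1 + ‖x‖) ^ P.totalDegree ≤ |K| * (1 + ‖x‖) ^ P.totalDegree := by
          gcongr; exact le_abs_self K
      _ ≤ _ := by gcongr
  have := h1.mul (weight_decay ξ hε hm)
  rwa [neg_add_eq_sub] at this

lemma pw_integrable (ξ : Eucl n) {ε : ℝ} (hε : 0 < ε) {P : Poly n} {d : ℕ}
    (hd : P.totalDegree ≤ d) {m : ℝ} (hm : 0 ≤ m) (h : (d : ℝ) + n < 2 * m) :
    Integrable (pw ξ ε P m) :=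
  (pw_decay ξ hε hd hm).integrable (by linarith)

end decay

/-! ### Integration by parts without compact support. -/

section ibp
variable {n : ℕ}

/-- A fixed smooth cut-off function: `1` on the unit ball, `0` outside the ball of radius `2`. -/
def cutoff : ContDiffBump (0 : Eucl n) := ⟨1, 2, by norm_num, by norm_num⟩

/-- The cut-off function at scale `k + 1`. -/
def cutoffAt (k : ℕ) (x : Eucl n) : ℝ := cutoff (n := n) (((k : ℝ) + 1)⁻¹ • x)

lemma cutoffAt_contDiff (k : ℕ) : ContDiff ℝ ∞ (cutoffAt (n := n) k) :=
  (cutoff (n := n)).contDiff.comp (contDiff_const_smul _)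

lemma cutoffAt_abs_le (k : ℕ) (x : Eucl n) : |cutoffAt k x| ≤ 1 := by
  rw [cutoffAt, abs_of_nonneg (cutoff (n := n)).nonneg]
  exact (cutoff (n := n)).le_one

lemma cutoffAt_eq_zero {k : ℕ} {x : Eucl n} (h : 2 * ((k : ℝ) + 1) ≤ ‖x‖) : cutoffAt k x = 0 := by
  refine (cutoff (n := n)).zero_of_le_dist ?_
  have hk : (0 : ℝ) < k + 1 := by positivity
  rw [dist_zero_right, norm_smul, norm_inv, Real.norm_of_nonneg hk.le]
  show (2 : ℝ) ≤ _
  rw [← div_eq_inv_mul, le_div_iff₀ hk]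
  exact h

lemma cutoffAt_hasCompactSupport (k : ℕ) : HasCompactSupport (cutoffAt (n := n) k) :=
  HasCompactSupport.intro (isCompact_closedBall 0 (2 * ((k : ℝ) + 1))) fun x hx => by
    refine cutoffAt_eq_zero ?_
    simp only [Metric.mem_closedBall, dist_zero_right, not_le] at hx
    exact hx.le

lemma cutoffAt_tendsto (x : Eucl n) : Tendsto (fun k => cutoffAt k x) atTop (𝓝 1) := by
  obtain ⟨k₀, hk₀⟩ := exists_nat_ge ‖x‖
  refine tendsto_const_nhds.congr' ?_
  filter_upwards [eventually_ge_atTop k₀] with k hk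
  refine ((cutoff (n := n)).one_of_mem_closedBall ?_).symm
  have hk' : (0 : ℝ) < k + 1 := by positivity
  have : (k₀ : ℝ) ≤ k := by exact_mod_cast hk
  show _ ∈ Metric.closedBall _ (1 : ℝ)
  rw [mem_closedBall_zero_iff, norm_smul, norm_inv, Real.norm_of_nonneg hk'.le,
    ← div_eq_inv_mul, div_le_one hk']
  linarith

/-- The first bound makes the cut-off error tend to zero pointwise. The second, uniform in k,
dominates it, so that integrability of ψV/(1 + |x|) suffices in the limit. -/
lemma pd_cutoffAt_bound (i : Fin n) : ∃ K : ℝ, 0 ≤ K ∧ ∀ (k : ℕ) (x : Eucl n),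
    |pd i (cutoffAt k) x| ≤ K / (k + 1) ∧ |pd i (cutoffAt k) x| ≤ K / (1 + ‖x‖) := by
  have hc : Continuous (pd i (cutoff (n := n))) :=
    (pd_contDiff i (cutoff (n := n)).contDiff).continuous
  have hs : HasCompactSupport (pd i (cutoff (n := n))) := by
    have := (cutoff (n := n)).hasCompactSupport.fderiv_apply (𝕜 := ℝ) (EuclideanSpace.single i 1)
    exact this
  obtain ⟨K, hK⟩ := hs.exists_bound_of_continuous hc
  have hK0 : 0 ≤ K := (norm_nonneg _).trans (hK 0)
  have key : ∀ (k : ℕ) (x : Eucl n), pd i (cutoffAt k) x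
      = ((k : ℝ) + 1)⁻¹ * pd i (cutoff (n := n)) (((k : ℝ) + 1)⁻¹ • x) := by
    intro k x
    have h1 : HasFDerivAt (cutoff (n := n)) (fderiv ℝ (cutoff (n := n)) (((k : ℝ) + 1)⁻¹ • x))
        (((k : ℝ) + 1)⁻¹ • x) :=
      ((cutoff (n := n)).contDiff (n := 1)).contDiffAt.differentiableAt (by simp) |>.hasFDerivAt
    have h2 := h1.comp x ((hasFDerivAt_id x).const_smul ((k : ℝ) + 1)⁻¹)
    have h3 : fderiv ℝ (cutoffAt (n := n) k) x = _ := h2.fderiv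
    rw [pd, h3]
    simp [pd]
  have h1 : ∀ (k : ℕ) (x : Eucl n), |pd i (cutoffAt k) x| ≤ K / (k + 1) := by
    intro k x
    have hk' : (0 : ℝ) < k + 1 := by positivity
    rw [key, abs_mul, abs_of_pos (inv_pos.2 hk'), ← div_eq_inv_mul]
    gcongr
    exact hK _
  -- Where the cut-off is not locally zero, |x| ≤ 2(k + 1), hence 1 + |x| ≤ 3(k + 1).
  refine ⟨3 * K, by positivity, fun k x => ⟨(h1 k x).trans ?_, ?_⟩⟩
  · gcongr; linarith
  · rcases le_or_gt ‖x‖ (2 * ((k : ℝ) + 1)) with h | h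
    · refine (h1 k x).trans ?_
      rw [div_le_div_iff₀ (by positivity) (by positivity)]
      have : (0 : ℝ) ≤ k := by positivity
      nlinarith
    · have : cutoffAt (n := n) k =ᶠ[𝓝 x] fun _ => 0 := by
        filter_upwards [(isOpen_lt continuous_const continuous_norm).mem_nhds h] with y hy
        exact cutoffAt_eq_zero (le_of_lt hy)
      rw [pd, this.fderiv_eq]
      simp
      positivity

/-- Integration by parts of a weakly differentiable function against a smooth function whose
support is not compact. -/
lemma IsWeakGradient.integral_mul_pd {ψ : Eucl n → ℝ} {Ψ : Eucl n → Eucl n}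
    (h : IsWeakGradient ψ Ψ) {V : Eucl n → ℝ} (hV : ContDiff ℝ ∞ V) (i : Fin n)
    (h1 : Integrable fun x => ψ x * pd i V x) (h2 : Integrable fun x => Ψ x i * V x)
    (h3 : Integrable fun x => ψ x * V x / (1 + ‖x‖)) :
    ∫ x, ψ x * pd i V x = - ∫ x, Ψ x i * V x := by
  obtain ⟨K, hK0, hK⟩ := pd_cutoffAt_bound (n := n) i
  have hψ : AEStronglyMeasurable ψ volume := h.locallyIntegrable.aestronglyMeasurable
  have hΨ : AEStronglyMeasurable (fun x => Ψ x i) volume :=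
    ((EuclideanSpace.proj (𝕜 := ℝ) i).continuous).comp_aestronglyMeasurable
      h.locallyIntegrable_grad.aestronglyMeasurable
  have hVd : ∀ x, DifferentiableAt ℝ V x := fun x => hV.contDiffAt.differentiableAt (by simp)
  have hχd : ∀ k (x : Eucl n), DifferentiableAt ℝ (cutoffAt (n := n) k) x :=
    fun k x => (cutoffAt_contDiff k).contDiffAt.differentiableAt (by simp)
  have e : ∀ k : ℕ, ∫ x, (ψ x * (cutoffAt k x * pd i V x) + ψ x * (pd i (cutoffAt k) x * V x))
      = - ∫ x, Ψ x i * (cutoffAt k x * V x) := by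
    intro k
    rw [← h.integral_eq (fun x => cutoffAt k x * V x) ((cutoffAt_contDiff k).mul hV)
      (cutoffAt_hasCompactSupport k).mul_right i]
    congr 1
    ext x
    rw [pd_mul i (hχd k x) (hVd x)]
    ring
  have l1 : Tendsto (fun k : ℕ => ∫ x, (ψ x * (cutoffAt k x * pd i V x)
      + ψ x * (pd i (cutoffAt k) x * V x))) atTop (𝓝 (∫ x, ψ x * pd i V x)) := by
    refine tendsto_integral_of_dominated_convergence
      (fun x => ‖ψ x * pd i V x‖ + K * ‖ψ x * V x / (1 + ‖x‖)‖) (fun k => ?_)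
      (h1.norm.add (h3.norm.const_mul K)) (fun k => Eventually.of_forall fun x => ?_)
      (Eventually.of_forall fun x => ?_)
    · exact (hψ.mul ((cutoffAt_contDiff k).continuous.mul
        (pd_contDiff i hV).continuous).aestronglyMeasurable).add
        (hψ.mul ((pd_contDiff i (cutoffAt_contDiff k)).continuous.mul
        hV.continuous).aestronglyMeasurable)
    · refine (norm_add_le _ _).trans (add_le_add ?_ ?_)
      · rw [mul_left_comm, norm_mul]
        exact mul_le_of_le_one_left (norm_nonneg _) (cutoffAt_abs_le k x)
      · rw [mul_left_comm, norm_mul, norm_div, Real.norm_of_nonneg (one_add_norm_pos x).le]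
        calc ‖pd i (cutoffAt k) x‖ * ‖ψ x * V x‖ ≤ K / (1 + ‖x‖) * ‖ψ x * V x‖ := by
              gcongr; exact (hK k x).2
          _ = _ := by ring
    · have t1 := (cutoffAt_tendsto x).mul_const (ψ x * pd i V x)
      have t2 : Tendsto (fun k : ℕ => pd i (cutoffAt k) x) atTop (𝓝 0) := by
        refine squeeze_zero_norm (fun k => (hK k x).1) ?_
        exact tendsto_const_nhds.div_atTop
          (tendsto_atTop_add_const_right _ _ tendsto_natCast_atTop_atTop)
      have t3 := t1.add (t2.mul_const (ψ x * V x))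
      simp only [one_mul, zero_mul, add_zero] at t3
      refine t3.congr fun k => ?_
      ring
  have l2 : Tendsto (fun k : ℕ => - ∫ x, Ψ x i * (cutoffAt k x * V x)) atTop
      (𝓝 (- ∫ x, Ψ x i * V x)) := by
    refine (tendsto_integral_of_dominated_convergence (fun x => ‖Ψ x i * V x‖) (fun k => ?_)
      h2.norm (fun k => Eventually.of_forall fun x => ?_) (Eventually.of_forall fun x => ?_)).neg
    · exact hΨ.mul ((cutoffAt_contDiff k).continuous.mul hV.continuous).aestronglyMeasurable
    · rw [mul_left_comm, norm_mul]
      exact mul_le_of_le_one_left (norm_nonneg _) (cutoffAt_abs_le k x)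
    · have := (cutoffAt_tendsto x).mul_const (Ψ x i * V x)
      rw [one_mul] at this
      exact this.congr fun k => by ring
  simp only [e] at l1
  exact tendsto_nhds_unique l1 l2

/-- With the constant 1 in the role of the weakly differentiable function, the integration by parts
above becomes the divergence theorem `integral_pd_eq_zero`. -/
lemma isWeakGradient_one : IsWeakGradient (fun _ : Eucl n => (1 : ℝ)) (fun _ => 0) where
  locallyIntegrable := continuous_const.locallyIntegrable
  locallyIntegrable_grad := continuous_const.locallyIntegrable
  integral_eq φ hφ hc i := by
    have := integral_mul_fderiv_eq_neg_fderiv_mul_of_integrable (μ := (volume : Measure (Eucl n)))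
      (f := fun _ => (1 : ℝ)) (g := φ) (v := EuclideanSpace.single i 1) ?_ ?_ ?_
      (fun x _ => differentiableAt_const _)
      (fun x _ => hφ.contDiffAt.differentiableAt (by simp))
    · simpa [pd] using this
    · simp
    · have : Continuous (pd i φ) := (pd_contDiff i hφ).continuous
      simp only [one_mul]
      exact this.integrable_of_hasCompactSupport
        (hc.fderiv_apply (𝕜 := ℝ) (EuclideanSpace.single i 1))
    · simpa using hφ.continuous.integrable_of_hasCompactSupport hc

lemma integral_pd_eq_zero {V : Eucl n → ℝ} (hV : ContDiff ℝ ∞ V) (i : Fin n)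
    (h1 : Integrable (pd i V)) (h3 : Integrable fun x => V x / (1 + ‖x‖)) :
    ∫ x, pd i V x = 0 := by
  have := isWeakGradient_one.integral_mul_pd hV i (by simpa using h1) (by simp) (by simpa using h3)
  simpa using this

lemma isWeakGradient_of_contDiff {w : Eucl n → ℝ} (hw : ContDiff ℝ ∞ w) :
    IsWeakGradient w (fun x => WithLp.toLp 2 fun i => pd i w x) where
  locallyIntegrable := hw.continuous.locallyIntegrable
  locallyIntegrable_grad := by
    refine Continuous.locallyIntegrable ?_
    exact (PiLp.continuous_toLp 2 _).comp
      (continuous_pi fun i => (pd_contDiff i hw).continuous)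
  integral_eq φ hφ hc i := by
    have hd : Continuous (pd i φ) := (pd_contDiff i hφ).continuous
    have hcd : HasCompactSupport (pd i φ) := hc.fderiv_apply (𝕜 := ℝ) (EuclideanSpace.single i 1)
    have hdw : Continuous (pd i w) := (pd_contDiff i hw).continuous
    exact integral_mul_fderiv_eq_neg_fderiv_mul_of_integrable
      (μ := (volume : Measure (Eucl n)))
      (f := w) (g := φ) (v := EuclideanSpace.single i 1)
      ((hdw.mul hφ.continuous).integrable_of_hasCompactSupport hc.mul_left)
      ((hw.continuous.mul hd).integrable_of_hasCompactSupport hcd.mul_left)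
      ((hw.continuous.mul hφ.continuous).integrable_of_hasCompactSupport hc.mul_left)
      (fun x _ => hw.contDiffAt.differentiableAt (by simp))
      (fun x _ => hφ.contDiffAt.differentiableAt (by simp))

end ibp

/-! ### Degree bounds for polynomials. -/

section degrees
variable {n : ℕ}

lemma totalDegree_pderiv_le (i : Fin n) {P : Poly n} {d : ℕ} (h : P.totalDegree ≤ d + 1) :
    (pderiv i P).totalDegree ≤ d := by
  refine Finset.sup_le fun s hs => ?_
  have hc : P.coeff (s + Finsupp.single i 1) ≠ 0 := by
    rw [MvPolynomial.mem_support_iff, MvPolynomial.coeff_pderiv] at hs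
    exact left_ne_zero_of_mul hs
  have h1 := (MvPolynomial.le_totalDegree (MvPolynomial.mem_support_iff.2 hc)).trans h
  rw [Finsupp.sum_add_index' (by simp) (by simp), Finsupp.sum_single_index rfl] at h1
  omega

lemma totalDegree_mul_le {P Q : Poly n} {a b : ℕ} (hP : P.totalDegree ≤ a)
    (hQ : Q.totalDegree ≤ b) : (P * Q).totalDegree ≤ a + b :=
  (MvPolynomial.totalDegree_mul P Q).trans (add_le_add hP hQ)

lemma totalDegree_pow_le {P : Poly n} {a : ℕ} (hP : P.totalDegree ≤ a) (k : ℕ) :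
    (P ^ k).totalDegree ≤ k * a :=
  (MvPolynomial.totalDegree_pow P k).trans (Nat.mul_le_mul_left k hP)

lemma totalDegree_shiftX_le (ξ : Eucl n) (i : Fin n) : (shiftX ξ i).totalDegree ≤ 1 := by
  refine (MvPolynomial.totalDegree_sub _ _).trans ?_
  simp

lemma totalDegree_C_mul_le (c : ℝ) {P : Poly n} {a : ℕ} (hP : P.totalDegree ≤ a) :
    (C c * P).totalDegree ≤ a := by
  simpa using totalDegree_mul_le (P := C c) (MvPolynomial.totalDegree_C c).le hP

end degrees

/-! ### The Laplacian of a homogeneous polynomial times a power of the weight. -/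

section laplacian
variable {n : ℕ}

@[simp] lemma pderiv_shiftX (ξ : Eucl n) (i j : Fin n) :
    pderiv i (shiftX ξ j) = if j = i then 1 else 0 := by
  simp [shiftX, MvPolynomial.pderiv_X, Pi.single_apply]

lemma pd_pd_pw (i : Fin n) (ξ : Eucl n) {ε : ℝ} (hε : 0 < ε) (P : Poly n) (m : ℝ) :
    pd i (pd i (pw ξ ε P m)) = fun x => pw ξ ε (pderiv i (pderiv i P)) m x
      - 2 * m * pw ξ ε (shiftX ξ i * pderiv i P) (m + 1) x
      - 2 * m * (pw ξ ε (pderiv i (shiftX ξ i * P)) (m + 1) x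
        - 2 * (m + 1) * pw ξ ε (shiftX ξ i * (shiftX ξ i * P)) (m + 1 + 1) x) := by
  have hd : ∀ (Q : Poly n) (k : ℝ) (x : Eucl n), DifferentiableAt ℝ (pw ξ ε Q k) x :=
    fun Q k x => (pw_contDiff ξ hε Q k).contDiffAt.differentiableAt (by simp)
  rw [pd_pw i ξ hε]
  ext x
  have h1 : (fun x => pw ξ ε (pderiv i P) m x - 2 * m * pw ξ ε (shiftX ξ i * P) (m + 1) x)
      = fun x => pw ξ ε (pderiv i P) m x + (-(2 * m)) * pw ξ ε (shiftX ξ i * P) (m + 1) x := by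
    ext x; ring
  rw [h1, pd_add i (hd _ _ _) ((hd _ _ _).const_mul _), pd_const_mul i _ (hd _ _ _),
    pd_pw i ξ hε, pd_pw i ξ hε]
  ring

lemma weight_split (ξ : Eucl n) {ε : ℝ} (hε : 0 < ε) (m : ℝ) (x : Eucl n) :
    (ε ^ 2 + ‖x - ξ‖ ^ 2) ^ (-m)
      = (ε ^ 2 + ‖x - ξ‖ ^ 2) * (ε ^ 2 + ‖x - ξ‖ ^ 2) ^ (-(m + 1)) := by
  have h := weight_pos hε ξ x
  rw [show -m = 1 + -(m + 1) by ring, Real.rpow_add h, Real.rpow_one]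

lemma norm_sq_sub_eq_sum (ξ x : Eucl n) : ‖x - ξ‖ ^ 2 = ∑ i, (x i - ξ i) ^ 2 := by
  simp [EuclideanSpace.norm_sq_eq]

/-- The hypothesis `hP` is Euler's identity for degree d in x - ξ. The factor |x - ξ|² coming from
two derivatives of the weight is replaced by (ε² + |x - ξ|²) - ε², which leaves P itself with the
exponents m + 1 and m + 2. -/
lemma laplacian_pw (ξ : Eucl n) {ε : ℝ} (hε : 0 < ε) {P Q : Poly n} {d : ℝ}
    (hP : ∑ j, shiftX ξ j * pderiv j P = C d * P) (hQ : ∑ j, pderiv j (pderiv j P) = Q)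
    (m : ℝ) (x : Eucl n) :
    ∑ i, pd i (pd i (pw ξ ε P m)) x = pw ξ ε Q m x
      + (4 * m * (m + 1) - 4 * m * d - 2 * m * n) * pw ξ ε P (m + 1) x
      - 4 * m * (m + 1) * ε ^ 2 * pw ξ ε P (m + 2) x := by
  have hP' : ∑ j, (x j - ξ j) * ev x (pderiv j P) = d * ev x P := by
    have := congrArg (ev x) hP
    simpa [-MvPolynomial.eval_X] using this
  have hQ' : ∑ j, ev x (pderiv j (pderiv j P)) = ev x Q := by
    have := congrArg (ev x) hQ
    simpa using this
  have e : ∀ i, pd i (pd i (pw ξ ε P m)) x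
      = ev x (pderiv i (pderiv i P)) * (ε ^ 2 + ‖x - ξ‖ ^ 2) ^ (-m)
      - 4 * m * ((x i - ξ i) * ev x (pderiv i P)) * (ε ^ 2 + ‖x - ξ‖ ^ 2) ^ (-(m + 1))
      - 2 * m * ev x P * (ε ^ 2 + ‖x - ξ‖ ^ 2) ^ (-(m + 1))
      + (x i - ξ i) ^ 2 * (4 * m * (m + 1) * ev x P *
        (ε ^ 2 + ‖x - ξ‖ ^ 2) ^ (-(m + 1 + 1))) := by
    intro i
    rw [pd_pd_pw i ξ hε]
    simp [pw]
    ring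
  simp only [e, Finset.sum_add_distrib, Finset.sum_sub_distrib, ← Finset.sum_mul,
    ← Finset.mul_sum, hP', hQ', ← norm_sq_sub_eq_sum, Finset.sum_const, Finset.card_univ,
    Fintype.card_fin, nsmul_eq_mul]
  unfold pw
  rw [weight_split ξ hε (m + 1), show m + 1 + 1 = m + 2 by ring]
  ring

end laplacian

/-! ### Forms B(y,y) ⟨ξ,y⟩^a built from a transverse matrix. -/

section form
variable {n : ℕ} (ξ : Eucl n) (B : Fin n → Fin n → ℝ)

/-- The linear form `∑_q B_{pq} (x_q - ξ_q)`. -/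
def linForm (p : Fin n) : Poly n := ∑ q, C (B p q) * shiftX ξ q

/-- The quadratic form `∑_{p,q} B_{pq} (x_p - ξ_p) (x_q - ξ_q)`. -/
def quadForm : Poly n := ∑ p, shiftX ξ p * linForm ξ B p

/-- The linear form `⟨ξ, x - ξ⟩`. -/
def dirForm : Poly n := ∑ p, C (ξ p) * shiftX ξ p

/-- The polynomial `B(x - ξ, x - ξ) ⟨ξ, x - ξ⟩^a`. -/
def formPow (a : ℕ) : Poly n := quadForm ξ B * dirForm ξ ^ a

/-- `B` is a symmetric trace-free matrix that annihilates `ξ`. -/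
structure IsTransverse : Prop where
  symm : ∀ p q, B p q = B q p
  trace : ∑ p, B p p = 0
  apply_self : ∀ p, ∑ q, B p q * ξ q = 0

@[simp] lemma pderiv_linForm (j p : Fin n) : pderiv j (linForm ξ B p) = C (B p j) := by
  simp [linForm]

@[simp] lemma pderiv_dirForm (j : Fin n) : pderiv j (dirForm ξ) = C (ξ j) := by
  simp [dirForm]

variable {ξ B}

lemma IsTransverse.pderiv_quadForm (h : IsTransverse ξ B) (j : Fin n) :
    pderiv j (quadForm ξ B) = 2 * linForm ξ B j := by
  simp only [quadForm, map_sum, MvPolynomial.pderiv_mul, pderiv_linForm, pderiv_shiftX,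
    Finset.sum_add_distrib, ite_mul, one_mul, zero_mul, Finset.sum_ite_eq', Finset.mem_univ, if_true]
  rw [two_mul]
  congr 1
  rw [linForm]
  exact Finset.sum_congr rfl fun p _ => by rw [h.symm p j, mul_comm]

lemma IsTransverse.sum_linForm (h : IsTransverse ξ B) : ∑ j, C (ξ j) * linForm ξ B j = 0 := by
  simp only [linForm, Finset.mul_sum]
  rw [Finset.sum_comm]
  refine Finset.sum_eq_zero fun q _ => ?_
  have : ∑ p, C (ξ p) * (C (B p q) * shiftX ξ q) = C (∑ p, B q p * ξ p) * shiftX ξ q := by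
    simp only [map_sum, map_mul, Finset.sum_mul]
    exact Finset.sum_congr rfl fun p _ => by rw [h.symm p q]; ring
  rw [this, h.apply_self]
  simp

lemma IsTransverse.pderiv_formPow (h : IsTransverse ξ B) (a : ℕ) (j : Fin n) :
    pderiv j (formPow ξ B a) = 2 * (linForm ξ B j * dirForm ξ ^ a)
      + (a : Poly n) * (C (ξ j) * (quadForm ξ B * dirForm ξ ^ (a - 1))) := by
  simp only [formPow, MvPolynomial.pderiv_mul, MvPolynomial.pderiv_pow, h.pderiv_quadForm,
    pderiv_dirForm]
  ring

lemma IsTransverse.euler_formPow (h : IsTransverse ξ B) (a : ℕ) :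
    ∑ j, shiftX ξ j * pderiv j (formPow ξ B a) = C ((a : ℝ) + 2) * formPow ξ B a := by
  have e : ∀ j, shiftX ξ j * pderiv j (formPow ξ B a)
      = (shiftX ξ j * linForm ξ B j) * (2 * dirForm ξ ^ a)
        + (C (ξ j) * shiftX ξ j) * ((a : Poly n) * quadForm ξ B * dirForm ξ ^ (a - 1)) := by
    intro j; rw [h.pderiv_formPow]; ring
  simp only [e, Finset.sum_add_distrib, ← Finset.sum_mul]
  rw [← quadForm, ← dirForm, formPow]
  have h2 : (C 2 : Poly n) = 2 := map_ofNat C 2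
  rcases a with _ | a
  · simp [h2]; ring
  · simp [h2]; ring

/-- The trace of B removes ΔB(y,y), and Bξ = 0 removes the mixed term, so both derivatives must fall
on the power of ⟨ξ,y⟩. For a < 2 the factor a(a - 1) vanishes and the truncated exponent a - 2 is
harmless. -/
lemma IsTransverse.laplacian_formPow (h : IsTransverse ξ B) (a : ℕ) :
    ∑ j, pderiv j (pderiv j (formPow ξ B a))
      = C ((a : ℝ) * ((a : ℝ) - 1) * ‖ξ‖ ^ 2) * formPow ξ B (a - 2) := by
  have hξ : ‖ξ‖ ^ 2 = ∑ i, ξ i ^ 2 := by simp [EuclideanSpace.norm_sq_eq]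
  have e : ∀ j, pderiv j (pderiv j (formPow ξ B a))
      = C (B j j) * (2 * dirForm ξ ^ a)
        + (C (ξ j) * linForm ξ B j) * (4 * (a : Poly n) * dirForm ξ ^ (a - 1))
        + C (ξ j ^ 2) * ((a : Poly n) * ((a - 1 : ℕ) : Poly n) * (quadForm ξ B * dirForm ξ ^ (a - 2))) := by
    intro j
    rw [h.pderiv_formPow]
    have h2 : pderiv j (2 : Poly n) = 0 := by
      rw [show (2 : Poly n) = C 2 from (map_ofNat C 2).symm, MvPolynomial.pderiv_C]
    have ha : pderiv j (a : Poly n) = 0 := by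
      simp
    simp only [map_add, MvPolynomial.pderiv_mul, MvPolynomial.pderiv_pow, h.pderiv_quadForm,
      pderiv_dirForm, pderiv_linForm, h2, ha, MvPolynomial.pderiv_C, Nat.sub_sub, map_pow]
    ring
  simp only [e, Finset.sum_add_distrib, ← Finset.sum_mul, h.sum_linForm, ← map_sum, h.trace,
    ← hξ]
  rcases a with _ | a
  · simp
  · simp [formPow]; ring

lemma totalDegree_linForm_le (p : Fin n) : (linForm ξ B p).totalDegree ≤ 1 :=
  MvPolynomial.totalDegree_finsetSum_le fun q _ =>
    totalDegree_C_mul_le _ (totalDegree_shiftX_le ξ q)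

lemma totalDegree_dirForm_le : (dirForm ξ).totalDegree ≤ 1 :=
  MvPolynomial.totalDegree_finsetSum_le fun q _ =>
    totalDegree_C_mul_le _ (totalDegree_shiftX_le ξ q)

lemma totalDegree_quadForm_le : (quadForm ξ B).totalDegree ≤ 2 :=
  MvPolynomial.totalDegree_finsetSum_le fun q _ =>
    totalDegree_mul_le (a := 1) (b := 1) (totalDegree_shiftX_le ξ q) (totalDegree_linForm_le q)

lemma totalDegree_dirForm_pow_le (a : ℕ) : (dirForm ξ ^ a).totalDegree ≤ a := by
  simpa using totalDegree_pow_le (totalDegree_dirForm_le (ξ := ξ)) a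

lemma totalDegree_formPow_le (a : ℕ) : (formPow ξ B a).totalDegree ≤ a + 2 := by
  rw [add_comm]
  exact totalDegree_mul_le totalDegree_quadForm_le (totalDegree_dirForm_pow_le a)

end form

/-! ### Vanishing moments of transverse forms. -/

section orthogonality
variable {n : ℕ}

lemma Decay.div_one_add_norm {r : ℝ} {g : Eucl n → ℝ} (hg : Decay r g) :
    Decay (r + 1) (fun x => g x / (1 + ‖x‖)) := by
  have h : Decay 1 (fun x : Eucl n => (1 + ‖x‖)⁻¹) := by
    refine ⟨(continuous_const.add continuous_norm).inv₀ fun x => (one_add_norm_pos x).ne', 1,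
      fun x => ?_⟩
    rw [Real.rpow_neg_one, one_mul, abs_of_pos (inv_pos.2 (one_add_norm_pos x))]
  simpa [div_eq_mul_inv] using hg.mul h

/-- Integration by parts for the moments of the weights `(ε² + |x - ξ|²)^{-m}`. -/
lemma integral_pw_pderiv (ξ : Eucl n) {ε : ℝ} (hε : 0 < ε) {P : Poly n} {d : ℕ}
    (hd : P.totalDegree ≤ d + 1) {m : ℝ} (hm : (d : ℝ) + n < 2 * m) (i : Fin n) :
    ∫ x, pw ξ ε (pderiv i P) m x = 2 * m * ∫ x, pw ξ ε (shiftX ξ i * P) (m + 1) x := by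
  have hm0 : 0 ≤ m := by
    have : (0 : ℝ) ≤ d + n := by positivity
    linarith
  have i1 : Integrable (pw ξ ε (pderiv i P) m) :=
    pw_integrable ξ hε (totalDegree_pderiv_le i hd) hm0 hm
  have i2 : Integrable (pw ξ ε (shiftX ξ i * P) (m + 1)) := by
    refine pw_integrable ξ hε (totalDegree_mul_le (totalDegree_shiftX_le ξ i) hd) (by linarith) ?_
    push_cast; linarith
  have key := integral_pd_eq_zero (pw_contDiff ξ hε P m) i
    (by rw [pd_pw i ξ hε]; exact i1.sub (i2.const_mul _))
    ((pw_decay ξ hε hd hm0).div_one_add_norm.integrable (by push_cast; linarith))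
  rw [pd_pw i ξ hε, integral_sub i1 (i2.const_mul _), integral_const_mul] at key
  linarith

lemma integral_pw_sum {ι : Type*} (s : Finset ι) (ξ : Eucl n) {ε : ℝ} (hε : 0 < ε)
    {P : ι → Poly n} {d : ℕ} (hd : ∀ i ∈ s, (P i).totalDegree ≤ d) {m : ℝ}
    (hm : (d : ℝ) + n < 2 * m) :
    ∫ x, pw ξ ε (∑ i ∈ s, P i) m x = ∑ i ∈ s, ∫ x, pw ξ ε (P i) m x := by
  have hm0 : 0 ≤ m := by
    have : (0 : ℝ) ≤ d + n := by positivity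
    linarith
  rw [← integral_finsetSum s fun i hi => pw_integrable ξ hε (hd i hi) hm0 hm]
  congr 1
  ext x
  simp [pw, Finset.sum_mul]

/-- Integration by parts for a polynomial vector field. -/
lemma integral_pw_div (ξ : Eucl n) {ε : ℝ} (hε : 0 < ε) {G : Fin n → Poly n} {d : ℕ}
    (hd : ∀ i, (G i).totalDegree ≤ d + 1) {m : ℝ} (hm : (d : ℝ) + n < 2 * m) :
    ∫ x, pw ξ ε (∑ i, pderiv i (G i)) m x
      = 2 * m * ∫ x, pw ξ ε (∑ i, shiftX ξ i * G i) (m + 1) x := by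
  rw [integral_pw_sum _ ξ hε (fun i _ => totalDegree_pderiv_le i (hd i)) hm,
    integral_pw_sum _ ξ hε (d := 1 + (d + 1))
      (fun i _ => totalDegree_mul_le (totalDegree_shiftX_le ξ i) (hd i)) (by push_cast; linarith),
    Finset.mul_sum]
  exact Finset.sum_congr rfl fun i _ => integral_pw_pderiv ξ hε (hd i) hm i

variable {ξ : Eucl n} {B : Fin n → Fin n → ℝ}

/-- The field with components (By)_i ⟨ξ,y⟩^a is divergence free, as tr B = 0 and Bξ = 0, while its
product with y is the form itself. The divergence theorem against the weight leaves only the latter.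
-/
lemma IsTransverse.integral_formPow (h : IsTransverse ξ B) {ε : ℝ} (hε : 0 < ε) (a : ℕ) {m : ℝ}
    (hm : (a : ℝ) + n < 2 * m) : ∫ x, pw ξ ε (formPow ξ B a) (m + 1) x = 0 := by
  have key := integral_pw_div ξ hε (G := fun i => linForm ξ B i * dirForm ξ ^ a) (d := a)
    (fun i => by
      rw [add_comm]
      exact totalDegree_mul_le (totalDegree_linForm_le i) (totalDegree_dirForm_pow_le a)) hm
  have e1 : ∑ i, pderiv i (linForm ξ B i * dirForm ξ ^ a) = 0 := by
    have : ∀ i, pderiv i (linForm ξ B i * dirForm ξ ^ a) = C (B i i) * dirForm ξ ^ a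
        + (C (ξ i) * linForm ξ B i) * ((a : Poly n) * dirForm ξ ^ (a - 1)) := by
      intro i
      simp only [MvPolynomial.pderiv_mul, MvPolynomial.pderiv_pow, pderiv_dirForm, pderiv_linForm]
      ring
    simp only [this, Finset.sum_add_distrib, ← Finset.sum_mul, h.sum_linForm, ← map_sum, h.trace]
    simp
  have e2 : ∑ i, shiftX ξ i * (linForm ξ B i * dirForm ξ ^ a) = formPow ξ B a := by
    simp only [← mul_assoc, ← Finset.sum_mul]
    rfl
  rw [e1, e2] at key
  have hm0 : 0 < m := by
    have : (0 : ℝ) ≤ a + n := by positivity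
    linarith
  have z : ∫ x, pw ξ ε 0 m x = 0 := by simp [pw]
  rw [z] at key
  rcases mul_eq_zero.1 key.symm with h0 | h0
  · linarith
  · exact h0

/-- Multiplying the previous field by y_k leaves the divergence (By)_k ⟨ξ,y⟩^a. The integral of this
vanishes too, by the divergence theorem for the divergence-free field B_ki ⟨ξ,y⟩^a. -/
lemma IsTransverse.integral_shiftX_formPow (h : IsTransverse ξ B) {ε : ℝ} (hε : 0 < ε) (a : ℕ)
    {m : ℝ} (hm : (a : ℝ) + n < 2 * m) (k : Fin n) :
    ∫ x, pw ξ ε (shiftX ξ k * formPow ξ B a) (m + 1 + 1) x = 0 := by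
  have hm0 : 0 < m := by
    have : (0 : ℝ) ≤ a + n := by positivity
    linarith
  have z : ∫ x, pw ξ ε 0 m x = 0 := by simp [pw]
  have k1 := integral_pw_div ξ hε
    (G := fun i => shiftX ξ k * (linForm ξ B i * dirForm ξ ^ a)) (d := a + 1) (m := m + 1)
    (fun i => by
      rw [show a + 1 + 1 = 1 + (1 + a) by ring]
      exact totalDegree_mul_le (totalDegree_shiftX_le ξ k)
        (totalDegree_mul_le (totalDegree_linForm_le i) (totalDegree_dirForm_pow_le a)))
    (by push_cast; linarith)
  have e1 : ∑ i, pderiv i (shiftX ξ k * (linForm ξ B i * dirForm ξ ^ a))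
      = linForm ξ B k * dirForm ξ ^ a := by
    have : ∀ i, pderiv i (shiftX ξ k * (linForm ξ B i * dirForm ξ ^ a))
        = C (B i i) * (shiftX ξ k * dirForm ξ ^ a)
        + (C (ξ i) * linForm ξ B i) * (shiftX ξ k * ((a : Poly n) * dirForm ξ ^ (a - 1)))
        + if k = i then linForm ξ B i * dirForm ξ ^ a else 0 := by
      intro i
      simp only [MvPolynomial.pderiv_mul, MvPolynomial.pderiv_pow, pderiv_dirForm, pderiv_linForm,
        pderiv_shiftX]
      split_ifs <;> ring
    simp only [this, Finset.sum_add_distrib, ← Finset.sum_mul, h.sum_linForm, ← map_sum, h.trace]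
    simp
  have e2 : ∑ i, shiftX ξ i * (shiftX ξ k * (linForm ξ B i * dirForm ξ ^ a))
      = shiftX ξ k * formPow ξ B a := by
    rw [formPow, quadForm, Finset.sum_mul, Finset.mul_sum]
    exact Finset.sum_congr rfl fun i _ => by ring
  have k2 := integral_pw_div ξ hε
    (G := fun i => C (B k i) * dirForm ξ ^ a) (d := a) (m := m)
    (fun i => (totalDegree_C_mul_le _ (totalDegree_dirForm_pow_le a)).trans (by omega)) hm
  have e3 : ∑ i, pderiv i (C (B k i) * dirForm ξ ^ a) = 0 := by
    have : ∀ i, pderiv i (C (B k i) * dirForm ξ ^ a)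
        = C (B k i * ξ i) * ((a : Poly n) * dirForm ξ ^ (a - 1)) := by
      intro i
      simp only [MvPolynomial.pderiv_mul, MvPolynomial.pderiv_pow, pderiv_dirForm,
        MvPolynomial.pderiv_C, map_mul]
      ring
    simp only [this, ← Finset.sum_mul, ← map_sum, h.apply_self]
    simp
  have e4 : ∑ i, shiftX ξ i * (C (B k i) * dirForm ξ ^ a) = linForm ξ B k * dirForm ξ ^ a := by
    rw [linForm, Finset.sum_mul]
    exact Finset.sum_congr rfl fun i _ => by ring
  rw [e3, e4, z] at k2
  rw [e1, e2] at k1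
  have z2 : ∫ x, pw ξ ε (linForm ξ B k * dirForm ξ ^ a) (m + 1) x = 0 := by
    rcases mul_eq_zero.1 k2.symm with h0 | h0
    · linarith
    · exact h0
  rw [z2] at k1
  rcases mul_eq_zero.1 k1.symm with h0 | h0
  · linarith
  · exact h0

end orthogonality

/-! ### The functions φ_k in terms of weights. -/

section kernel
variable {n : ℕ}

lemma bubble_ratio_rpow (ξ : Eucl n) {ε : ℝ} (hε : 0 < ε) (m : ℝ) (x : Eucl n) :
    (ε / (ε ^ 2 + ‖x - ξ‖ ^ 2)) ^ m = ε ^ m * (ε ^ 2 + ‖x - ξ‖ ^ 2) ^ (-m) := by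
  have h := weight_pos hε ξ x
  rw [Real.div_rpow hε.le h.le, Real.rpow_neg h.le, div_eq_mul_inv]

/-- The numerator ε² - |x - ξ|² equals 2ε² minus the weight. -/
lemma phiZero_eq (ξ : Eucl n) {ε : ℝ} (hε : 0 < ε) (x : Eucl n) :
    phiZero ξ ε x = ε ^ (((n : ℝ) + 2) / 2) * (2 * ε ^ 2 * pw ξ ε 1 ((n : ℝ) / 2 + 2) x
      - pw ξ ε 1 ((n : ℝ) / 2 + 1) x) := by
  have h := weight_pos hε ξ x
  rw [phiZero, bubble_ratio_rpow ξ hε]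
  simp only [pw, map_one, one_mul]
  rw [show ((n : ℝ) + 2) / 2 = (n : ℝ) / 2 + 1 by ring, weight_split ξ hε ((n : ℝ) / 2 + 1),
    show (n : ℝ) / 2 + 1 + 1 = (n : ℝ) / 2 + 2 by ring]
  field_simp
  ring

lemma phi_eq (ξ : Eucl n) {ε : ℝ} (hε : 0 < ε) (k : Fin n) (x : Eucl n) :
    phi ξ ε k x = ε ^ (((n : ℝ) + 2) / 2) * (2 * ε) *
      pw ξ ε (shiftX ξ k) ((n : ℝ) / 2 + 2) x := by
  have h := weight_pos hε ξ x
  rw [phi, bubble_ratio_rpow ξ hε]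
  simp only [pw, ev_shiftX]
  rw [show ((n : ℝ) + 2) / 2 = (n : ℝ) / 2 + 1 by ring, weight_split ξ hε ((n : ℝ) / 2 + 1),
    show (n : ℝ) / 2 + 1 + 1 = (n : ℝ) / 2 + 2 by ring]
  field_simp

lemma phiZero_decay (ξ : Eucl n) {ε : ℝ} (hε : 0 < ε) : Decay (n + 2) (phiZero ξ ε) := by
  have h1 := pw_decay ξ hε (P := 1) (d := 0) (by simp) (m := (n : ℝ) / 2 + 2) (by positivity)
  have h2 := pw_decay ξ hε (P := 1) (d := 0) (by simp) (m := (n : ℝ) / 2 + 1) (by positivity)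
  have h3 := ((h1.mono (s := n + 2) (by push_cast; linarith)).const_mul (2 * ε ^ 2)).sub
    (h2.mono (s := n + 2) (by push_cast; linarith))
  rw [show phiZero ξ ε = _ from funext (phiZero_eq ξ hε)]
  exact h3.const_mul _

lemma phi_decay (ξ : Eucl n) {ε : ℝ} (hε : 0 < ε) (k : Fin n) : Decay (n + 2) (phi ξ ε k) := by
  have h1 := pw_decay ξ hε (totalDegree_shiftX_le ξ k) (m := (n : ℝ) / 2 + 2) (by positivity)
  rw [show phi ξ ε k = _ from funext (phi_eq ξ hε k)]
  exact (h1.mono (s := n + 2) (by push_cast; linarith)).const_mul _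

end kernel

/-! ### Explicit solution of the linearized equation. -/

section corrector
variable {n : ℕ}

/-- `ζ` is a smooth decaying solution, orthogonal to the functions `φ_k`, of the linearized
equation with right-hand side `r`, and of size `K |ξ|²`. -/
structure IsCorrector (ξ : Eucl n) (ε K : ℝ) (r ζ : Eucl n → ℝ) : Prop where
  contDiff : ContDiff ℝ ∞ ζ
  bound : ∀ x, |ζ x| ≤ K * ‖ξ‖ ^ 2 * (ε ^ 2 + ‖x - ξ‖ ^ 2) ^ (4 - (n : ℝ) / 2)
  decay : Decay ((n : ℝ) - 8) ζ
  decay_pd : ∀ i, Decay ((n : ℝ) - 7) (pd i ζ)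
  decay_pd_pd : ∀ i, Decay ((n : ℝ) - 6) (pd i (pd i ζ))
  equation : ∀ x, ∑ i, pd i (pd i ζ) x
    + (n : ℝ) * ((n : ℝ) + 2) * (ε ^ 2 / (ε ^ 2 + ‖x - ξ‖ ^ 2) ^ 2) * ζ x = r x
  integral_phiZero : ∫ x, phiZero ξ ε x * ζ x = 0
  integral_phi : ∀ k, ∫ x, phi ξ ε k x * ζ x = 0

variable {ξ : Eucl n} {ε K K' : ℝ} {r r' ζ ζ' : Eucl n → ℝ}

lemma pd_fun_add (i : Fin n) (h : ContDiff ℝ ∞ ζ) (h' : ContDiff ℝ ∞ ζ') :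
    pd i (fun x => ζ x + ζ' x) = fun x => pd i ζ x + pd i ζ' x :=
  funext fun x => pd_add i (h.contDiffAt.differentiableAt (by simp))
    (h'.contDiffAt.differentiableAt (by simp))

lemma pd_fun_const_mul (i : Fin n) (c : ℝ) (h : ContDiff ℝ ∞ ζ) :
    pd i (fun x => c * ζ x) = fun x => c * pd i ζ x :=
  funext fun x => pd_const_mul i c (h.contDiffAt.differentiableAt (by simp))

lemma IsCorrector.add (hn : 19 ≤ n) (hε : 0 < ε) (h : IsCorrector ξ ε K r ζ)
    (h' : IsCorrector ξ ε K' r' ζ') :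
    IsCorrector ξ ε (K + K') (fun x => r x + r' x) (fun x => ζ x + ζ' x) := by
  have hn' : (19 : ℝ) ≤ n := by exact_mod_cast hn
  have e1 := fun i => pd_fun_add i h.contDiff h'.contDiff
  have e2 : ∀ i, pd i (pd i fun x => ζ x + ζ' x) = fun x => pd i (pd i ζ) x + pd i (pd i ζ') x :=
    fun i => by rw [e1, pd_fun_add i (pd_contDiff i h.contDiff) (pd_contDiff i h'.contDiff)]
  refine ⟨h.contDiff.add h'.contDiff, fun x => ?_, h.decay.add h'.decay, fun i => ?_, fun i => ?_,
    fun x => ?_, ?_, fun k => ?_⟩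
  · refine (abs_add_le _ _).trans ?_
    rw [add_mul, add_mul]
    exact add_le_add (h.bound x) (h'.bound x)
  · rw [e1]; exact (h.decay_pd i).add (h'.decay_pd i)
  · rw [e2]; exact (h.decay_pd_pd i).add (h'.decay_pd_pd i)
  · simp only [e2, Finset.sum_add_distrib, ← h.equation x, ← h'.equation x]
    ring
  · simp only [mul_add]
    rw [integral_add (((phiZero_decay ξ hε).mul h.decay).integrable (by linarith))
      (((phiZero_decay ξ hε).mul h'.decay).integrable (by linarith)), h.integral_phiZero,
      h'.integral_phiZero, add_zero]
  · simp only [mul_add]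
    rw [integral_add (((phi_decay ξ hε k).mul h.decay).integrable (by linarith))
      (((phi_decay ξ hε k).mul h'.decay).integrable (by linarith)), h.integral_phi,
      h'.integral_phi, add_zero]

lemma IsCorrector.const_mul (c : ℝ) (h : IsCorrector ξ ε K r ζ) :
    IsCorrector ξ ε (|c| * K) (fun x => c * r x) (fun x => c * ζ x) := by
  have e1 := fun i => pd_fun_const_mul i c h.contDiff
  have e2 : ∀ i, pd i (pd i fun x => c * ζ x) = fun x => c * pd i (pd i ζ) x :=
    fun i => by rw [e1, pd_fun_const_mul i c (pd_contDiff i h.contDiff)]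
  refine ⟨contDiff_const.mul h.contDiff, fun x => ?_, h.decay.const_mul c, fun i => ?_,
    fun i => ?_, fun x => ?_, ?_, fun k => ?_⟩
  · rw [abs_mul, mul_assoc, mul_assoc]
    gcongr
    simpa [mul_assoc] using h.bound x
  · rw [e1]; exact (h.decay_pd i).const_mul c
  · rw [e2]; exact (h.decay_pd_pd i).const_mul c
  · simp only [e2, ← h.equation x, ← Finset.mul_sum]
    ring
  · simp only [mul_left_comm _ c]
    rw [integral_const_mul, h.integral_phiZero, mul_zero]
  · simp only [mul_left_comm _ c]
    rw [integral_const_mul, h.integral_phi, mul_zero]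

lemma IsCorrector.mono (h : IsCorrector ξ ε K r ζ) (hε : 0 < ε) (hK : K ≤ K') :
    IsCorrector ξ ε K' r ζ := by
  refine { h with bound := fun x => (h.bound x).trans ?_ }
  have := weight_pos hε ξ x
  gcongr

variable {B : Fin n → Fin n → ℝ}

lemma ev_quadForm (x : Eucl n) :
    ev x (quadForm ξ B) = ∑ p, ∑ q, B p q * (x p - ξ p) * (x q - ξ q) := by
  simp only [quadForm, linForm, map_sum, map_mul, ev_shiftX, MvPolynomial.eval_C, Finset.mul_sum]
  exact Finset.sum_congr rfl fun p _ => Finset.sum_congr rfl fun q _ => by ring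

lemma ev_dirForm (x : Eucl n) : ev x (dirForm ξ) = inner ℝ ξ (x - ξ) := by
  simp [dirForm, PiLp.inner_apply, mul_comm]

lemma abs_quadForm_le {β : ℝ} (hB : ∀ p q, |B p q| ≤ β) (x : Eucl n) :
    |ev x (quadForm ξ B)| ≤ (n : ℝ) ^ 2 * β * ‖x - ξ‖ ^ 2 := by
  rw [ev_quadForm]
  have h : ∀ p q, |B p q * (x p - ξ p) * (x q - ξ q)| ≤ β * ‖x - ξ‖ ^ 2 := by
    intro p q
    rw [mul_assoc, abs_mul, abs_mul, sq]
    have h1 := abs_coord_le (x - ξ) p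
    have h2 := abs_coord_le (x - ξ) q
    have h0 : 0 ≤ β := (abs_nonneg _).trans (hB p q)
    simp only [PiLp.sub_apply] at h1 h2
    have := hB p q
    gcongr
  calc |∑ p, ∑ q, B p q * (x p - ξ p) * (x q - ξ q)|
      ≤ ∑ p : Fin n, ∑ q : Fin n, β * ‖x - ξ‖ ^ 2 :=
        (Finset.abs_sum_le_sum_abs _ _).trans (Finset.sum_le_sum fun p _ =>
          (Finset.abs_sum_le_sum_abs _ _).trans (Finset.sum_le_sum fun q _ => h p q))
    _ = _ := by simp; ring

/-- For |ξ| ≤ 1 the form is O(|ξ|² |y|^(a+2)), and |y|² is at most the weight. As ε ≥ 1/2 keeps the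
weight above 1/4, its exponent may be raised by up to 3 at the cost of a factor 4³ = 64. -/
lemma pw_formPow_bound (hξ : ‖ξ‖ ≤ 1) (hε : 1 / 2 ≤ ε) {κ : ℝ}
    (hB : ∀ p q, |B p q| ≤ κ * ‖ξ‖ ^ 2) (hκ : 0 ≤ κ) {a : ℕ} {M b : ℝ}
    (h1 : ((a : ℝ) + 2) / 2 - M ≤ b) (h2 : b ≤ ((a : ℝ) + 2) / 2 - M + 3) (x : Eucl n) :
    |pw ξ ε (formPow ξ B a) M x|
      ≤ 64 * ((n : ℝ) ^ 2 * κ) * ‖ξ‖ ^ 2 * (ε ^ 2 + ‖x - ξ‖ ^ 2) ^ b := by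
  have hε0 : 0 < ε := by linarith
  have hD := weight_pos hε0 ξ x
  set D := ε ^ 2 + ‖x - ξ‖ ^ 2 with hDdef
  have hy : ‖x - ξ‖ ≤ D ^ (1 / 2 : ℝ) := by
    rw [← Real.sqrt_eq_rpow]
    exact Real.le_sqrt_of_sq_le (by rw [hDdef]; nlinarith)
  have hdir : |ev x (dirForm ξ)| ≤ ‖x - ξ‖ := by
    rw [ev_dirForm]
    refine (abs_real_inner_le_norm _ _).trans ?_
    exact mul_le_of_le_one_left (norm_nonneg _) hξ
  have hform : |ev x (formPow ξ B a)| ≤ (n : ℝ) ^ 2 * κ * ‖ξ‖ ^ 2 * D ^ (((a : ℝ) + 2) / 2) := by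
    rw [formPow, map_mul, map_pow, abs_mul, abs_pow]
    calc |ev x (quadForm ξ B)| * |ev x (dirForm ξ)| ^ a
        ≤ ((n : ℝ) ^ 2 * (κ * ‖ξ‖ ^ 2) * ‖x - ξ‖ ^ 2) * ‖x - ξ‖ ^ a := by
          gcongr; exact abs_quadForm_le hB x
      _ = (n : ℝ) ^ 2 * κ * ‖ξ‖ ^ 2 * ‖x - ξ‖ ^ (a + 2) := by ring
      _ ≤ (n : ℝ) ^ 2 * κ * ‖ξ‖ ^ 2 * (D ^ (1 / 2 : ℝ)) ^ (a + 2) := by gcongr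
      _ = _ := by
        rw [← Real.rpow_natCast (D ^ (1 / 2 : ℝ)) (a + 2), ← Real.rpow_mul hD.le]
        congr 2
        push_cast
        ring
  have hlow : D ^ (((a : ℝ) + 2) / 2 - M - b) ≤ 64 := by
    have hD4 : (1 / 4 : ℝ) ≤ D := by rw [hDdef]; nlinarith [sq_nonneg ‖x - ξ‖]
    calc D ^ (((a : ℝ) + 2) / 2 - M - b) ≤ (1 / 4 : ℝ) ^ (((a : ℝ) + 2) / 2 - M - b) :=
          Real.rpow_le_rpow_of_nonpos (by norm_num) hD4 (by linarith)
      _ ≤ (1 / 4 : ℝ) ^ (-3 : ℝ) :=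
          Real.rpow_le_rpow_of_exponent_ge (by norm_num) (by norm_num) (by linarith)
      _ = 64 := by
        rw [show (-3 : ℝ) = ((-3 : ℤ) : ℝ) by norm_num, Real.rpow_intCast]; norm_num
  rw [pw, abs_mul, abs_of_pos (Real.rpow_pos_of_pos hD _)]
  calc |ev x (formPow ξ B a)| * D ^ (-M)
      ≤ ((n : ℝ) ^ 2 * κ * ‖ξ‖ ^ 2 * D ^ (((a : ℝ) + 2) / 2)) * D ^ (-M) := by gcongr
    _ = (n : ℝ) ^ 2 * κ * ‖ξ‖ ^ 2 * (D ^ (((a : ℝ) + 2) / 2 - M - b) * D ^ b) := by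
        rw [mul_assoc, ← Real.rpow_add hD, ← Real.rpow_add hD]
        congr 2; ring
    _ ≤ (n : ℝ) ^ 2 * κ * ‖ξ‖ ^ 2 * (64 * D ^ b) := by gcongr
    _ = _ := by ring

/-- The right-hand side is the image of one basis function under the linearized operator. The
condition a + 2i ≤ 6 is what the decay rate 2m - (a + 2) ≥ n - 8 requires, and the slack 3 in
`pw_formPow_bound` covers the extreme case a = i = 0. -/
lemma IsTransverse.isCorrector_pw (hn : 19 ≤ n) (hT : IsTransverse ξ B) (hξ : ‖ξ‖ ≤ 1)
    (hε : 1 / 2 ≤ ε) {κ : ℝ} (hB : ∀ p q, |B p q| ≤ κ * ‖ξ‖ ^ 2) (hκ : 0 ≤ κ) {a i : ℕ}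
    (hai : a + 2 * i ≤ 6) {m : ℝ} (hm : m = (n : ℝ) / 2 - i) :
    IsCorrector ξ ε (64 * ((n : ℝ) ^ 2 * κ)) (fun x =>
      -(4 * m * ((i : ℝ) + a + 1)) * pw ξ ε (formPow ξ B a) (m + 1) x
      + ε ^ 2 * ((n : ℝ) * (n + 2) - 4 * m * (m + 1)) * pw ξ ε (formPow ξ B a) (m + 2) x
      + (a : ℝ) * ((a : ℝ) - 1) * ‖ξ‖ ^ 2 * pw ξ ε (formPow ξ B (a - 2)) m x)
      (pw ξ ε (formPow ξ B a) m) := by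
  have hn' : (19 : ℝ) ≤ n := by exact_mod_cast hn
  have hai' : (a : ℝ) + 2 * i ≤ 6 := by exact_mod_cast hai
  have ha0 : (0 : ℝ) ≤ a := by positivity
  have hi0 : (0 : ℝ) ≤ i := by positivity
  have hε0 : 0 < ε := by linarith
  have hm0 : 0 ≤ m := by linarith
  have hdeg := totalDegree_formPow_le (ξ := ξ) (B := B) a
  have hdeg1 : ∀ j, (pderiv j (formPow ξ B a)).totalDegree ≤ a + 1 :=
    fun j => totalDegree_pderiv_le j hdeg
  refine ⟨pw_contDiff ξ hε0 _ _, fun x => ?_, ?_, fun j => ?_, fun j => ?_, fun x => ?_, ?_,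
    fun k => ?_⟩
  · exact pw_formPow_bound hξ hε hB hκ (by linarith) (by linarith) x
  · exact (pw_decay ξ hε0 hdeg hm0).mono (by push_cast; linarith)
  · rw [pd_pw j ξ hε0]
    refine Decay.sub ?_ (Decay.const_mul _ ?_)
    · exact (pw_decay ξ hε0 (hdeg1 j) hm0).mono (by push_cast; linarith)
    · exact (pw_decay ξ hε0 (totalDegree_mul_le (totalDegree_shiftX_le ξ j) hdeg)
        (by linarith : 0 ≤ m + 1)).mono (by push_cast; linarith)
  · rw [pd_pd_pw j ξ hε0]
    have hY := totalDegree_mul_le (totalDegree_shiftX_le ξ j) hdeg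
    refine Decay.sub (Decay.sub ?_ (Decay.const_mul _ ?_)) (Decay.const_mul _
      (Decay.sub ?_ (Decay.const_mul _ ?_)))
    · exact (pw_decay ξ hε0 (totalDegree_pderiv_le j (d := a) (hdeg1 j)) hm0).mono
        (by linarith)
    · exact (pw_decay ξ hε0 (totalDegree_mul_le (totalDegree_shiftX_le ξ j) (hdeg1 j))
        (by linarith : 0 ≤ m + 1)).mono (by push_cast; linarith)
    · exact (pw_decay ξ hε0 (totalDegree_pderiv_le j (d := a + 2) (by omega))
        (by linarith : 0 ≤ m + 1)).mono (by push_cast; linarith)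
    · exact (pw_decay ξ hε0 (totalDegree_mul_le (totalDegree_shiftX_le ξ j) hY)
        (by linarith : 0 ≤ m + 1 + 1)).mono (by push_cast; linarith)
  · have hD := weight_pos hε0 ξ x
    rw [laplacian_pw ξ hε0 (hT.euler_formPow a) (hT.laplacian_formPow a) m x]
    have e1 : pw ξ ε (formPow ξ B a) m x
        = (ε ^ 2 + ‖x - ξ‖ ^ 2) ^ 2 * pw ξ ε (formPow ξ B a) (m + 2) x := by
      rw [pw, pw, weight_split ξ hε0 m, weight_split ξ hε0 (m + 1),
        show m + 1 + 1 = m + 2 by ring]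
      ring
    have e2 : pw ξ ε (C ((a : ℝ) * ((a : ℝ) - 1) * ‖ξ‖ ^ 2) * formPow ξ B (a - 2)) m x
        = (a : ℝ) * ((a : ℝ) - 1) * ‖ξ‖ ^ 2 * pw ξ ε (formPow ξ B (a - 2)) m x := by
      simp [pw]; ring
    rw [e1, e2]
    -- Here m = n/2 - i enters: the coefficient of the m + 1 term becomes -4m(i + a + 1), nonzero
    -- for m > 0, which permits solving for that term.
    have hc : 4 * m * (m + 1) - 4 * m * ((a : ℝ) + 2) - 2 * m * n
        = -(4 * m * ((i : ℝ) + a + 1)) := by rw [hm]; ring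
    rw [hc]
    field_simp
    ring
  -- The function φ_0 is radial about ξ, so its product with the form has a vanishing moment.
  · have e : ∀ x, phiZero ξ ε x * pw ξ ε (formPow ξ B a) m x
        = ε ^ (((n : ℝ) + 2) / 2) * (2 * ε ^ 2 *
            pw ξ ε (formPow ξ B a) ((n : ℝ) / 2 + m + 1 + 1) x
          - pw ξ ε (formPow ξ B a) ((n : ℝ) / 2 + m + 1) x) := by
      intro x
      have hD := weight_pos hε0 ξ x
      rw [phiZero_eq ξ hε0]
      simp only [pw, map_one, one_mul]
      rw [show -((n : ℝ) / 2 + m + 1 + 1) = -((n : ℝ) / 2 + 2) + -m by ring,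
        show -((n : ℝ) / 2 + m + 1) = -((n : ℝ) / 2 + 1) + -m by ring,
        Real.rpow_add hD, Real.rpow_add hD]
      ring
    simp only [e]
    rw [integral_const_mul, integral_sub, integral_const_mul,
      hT.integral_formPow hε0 a (m := (n : ℝ) / 2 + m + 1) (by linarith),
      hT.integral_formPow hε0 a (m := (n : ℝ) / 2 + m) (by linarith)]
    · simp
    · exact (pw_integrable ξ hε0 hdeg (by linarith) (by push_cast; linarith)).const_mul _
    · exact pw_integrable ξ hε0 hdeg (by linarith) (by push_cast; linarith)
  · have e : ∀ x, phi ξ ε k x * pw ξ ε (formPow ξ B a) m x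
        = ε ^ (((n : ℝ) + 2) / 2) * (2 * ε) *
            pw ξ ε (shiftX ξ k * formPow ξ B a) ((n : ℝ) / 2 + m + 1 + 1) x := by
      intro x
      have hD := weight_pos hε0 ξ x
      rw [phi_eq ξ hε0]
      simp only [pw, map_mul]
      rw [show -((n : ℝ) / 2 + m + 1 + 1) = -((n : ℝ) / 2 + 2) + -m by ring,
        Real.rpow_add hD]
      ring
    simp only [e]
    rw [integral_const_mul, hT.integral_shiftX_formPow hε0 a (m := (n : ℝ) / 2 + m)
      (by linarith) k, mul_zero]

/-- The linearized equation with right-hand side `r`, which depends on `(ξ, ε)` and on a transverse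
matrix of size `κ |ξ|²`, has solutions with uniform bounds near `(0, 1)`. -/
def UniformlySolvable (κ : ℝ)
    (r : Eucl n → ℝ → (Fin n → Fin n → ℝ) → Eucl n → ℝ) : Prop :=
  ∃ K : ℝ, 0 ≤ K ∧ ∀ (ξ : Eucl n) (ε : ℝ) (B : Fin n → Fin n → ℝ), ‖ξ‖ ≤ 1 → 1 / 2 ≤ ε →
    ε ≤ 2 → IsTransverse ξ B → (∀ p q, |B p q| ≤ κ * ‖ξ‖ ^ 2) →
    ∃ ζ, IsCorrector ξ ε K (r ξ ε B) ζ

lemma UniformlySolvable.add (hn : 19 ≤ n) {κ : ℝ}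
    {r r' : Eucl n → ℝ → (Fin n → Fin n → ℝ) → Eucl n → ℝ} (h : UniformlySolvable κ r)
    (h' : UniformlySolvable κ r') :
    UniformlySolvable κ (fun ξ ε B x => r ξ ε B x + r' ξ ε B x) := by
  obtain ⟨K, hK, h⟩ := h
  obtain ⟨K', hK', h'⟩ := h'
  refine ⟨K + K', by positivity, fun ξ ε B h1 h2 h3 h4 h5 => ?_⟩
  obtain ⟨ζ, hζ⟩ := h ξ ε B h1 h2 h3 h4 h5
  obtain ⟨ζ', hζ'⟩ := h' ξ ε B h1 h2 h3 h4 h5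
  exact ⟨_, hζ.add hn (by linarith) hζ'⟩

lemma UniformlySolvable.mul {κ : ℝ}
    {r : Eucl n → ℝ → (Fin n → Fin n → ℝ) → Eucl n → ℝ} (h : UniformlySolvable κ r)
    (c : Eucl n → ℝ → ℝ) {A : ℝ}
    (hc : ∀ ξ ε, ‖ξ‖ ≤ 1 → 1 / 2 ≤ ε → ε ≤ 2 → |c ξ ε| ≤ A) :
    UniformlySolvable κ (fun ξ ε B x => c ξ ε * r ξ ε B x) := by
  obtain ⟨K, hK, h⟩ := h
  refine ⟨|A| * K, by positivity, fun ξ ε B h1 h2 h3 h4 h5 => ?_⟩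
  obtain ⟨ζ, hζ⟩ := h ξ ε B h1 h2 h3 h4 h5
  refine ⟨_, (hζ.const_mul (c ξ ε)).mono (by linarith) ?_⟩
  have := (hc ξ ε h1 h2 h3).trans (le_abs_self A)
  gcongr

lemma uniformlySolvable_image (hn : 19 ≤ n) {κ : ℝ} (hκ : 0 ≤ κ) {a i : ℕ} {m : ℝ}
    (hai : a + 2 * i ≤ 6) (hm : m = (n : ℝ) / 2 - i) :
    UniformlySolvable κ (fun (ξ : Eucl n) ε B x =>
      -(4 * m * ((i : ℝ) + a + 1)) * pw ξ ε (formPow ξ B a) (m + 1) x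
      + ε ^ 2 * ((n : ℝ) * (n + 2) - 4 * m * (m + 1)) * pw ξ ε (formPow ξ B a) (m + 2) x
      + (a : ℝ) * ((a : ℝ) - 1) * ‖ξ‖ ^ 2 * pw ξ ε (formPow ξ B (a - 2)) m x) :=
  ⟨64 * ((n : ℝ) ^ 2 * κ), by positivity, fun ξ ε B h1 h2 _ h4 h5 =>
    ⟨_, h4.isCorrector_pw hn h1 h2 h5 hκ hai hm⟩⟩

lemma uniformlySolvable_zero (hn : 19 ≤ n) {κ : ℝ} (hκ : 0 ≤ κ) :
    UniformlySolvable (n := n) κ (fun _ _ _ _ => 0) := by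
  have := (uniformlySolvable_image hn hκ (a := 0) (i := 0) (by norm_num) rfl).mul
    (fun _ _ => 0) (A := 0) (by simp)
  simpa using this

/-- The linearized equation with right-hand side `B(y, y) ⟨ξ, y⟩^a (ε² + |y|²)^{i - 1 - n/2}`,
`y = x - ξ`, is explicitly solvable. -/
lemma uniformlySolvable_pw (hn : 19 ≤ n) {κ : ℝ} (hκ : 0 ≤ κ) (a i : ℕ) (hai : a + 2 * i ≤ 6)
    {M : ℝ} (hM : M = (n : ℝ) / 2 - i + 1) :
    UniformlySolvable κ (fun (ξ : Eucl n) ε B => pw ξ ε (formPow ξ B a) M) := by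
  have hn' : (19 : ℝ) ≤ n := by exact_mod_cast hn
  -- The image of the basis function (a, i) contains the desired term, a term with the same a and i
  -- - 1, and a term with a - 2 and i + 1. The last two are solvable by induction, and a + 2i never
  -- increases.
  induction a using Nat.strong_induction_on generalizing i M with
  | _ a iha =>
  induction i generalizing M with
  | zero =>
    -- For i = 0 the coefficient n(n + 2) - 4m(m + 1) vanishes at m = n/2, so no term with smaller i
    -- occurs and the inner induction starts.
    have h1 := uniformlySolvable_image hn hκ (a := a) (i := 0) hai rfl
    have h3 : UniformlySolvable κ (fun (ξ : Eucl n) ε B x => (-((a : ℝ) * ((a : ℝ) - 1) * ‖ξ‖ ^ 2))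
        * pw ξ ε (formPow ξ B (a - 2)) ((n : ℝ) / 2 - (0 : ℕ)) x) := by
      rcases lt_or_ge a 2 with ha | ha
      · have : (a : ℝ) * ((a : ℝ) - 1) = 0 := by interval_cases a <;> norm_num
        simpa [this] using uniformlySolvable_zero hn hκ
      · refine (iha (a - 2) (by omega) 1 (by omega) (by push_cast; ring)).mul _
          (A := |(a : ℝ) * ((a : ℝ) - 1)|) fun ξ ε h1 _ _ => ?_
        rw [abs_neg, abs_mul, abs_of_nonneg (by positivity : 0 ≤ ‖ξ‖ ^ 2)]
        exact mul_le_of_le_one_right (abs_nonneg _) (pow_le_one₀ (norm_nonneg _) h1)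
    have h4 := (h1.add hn h3).mul (fun _ _ => (-(4 * ((n : ℝ) / 2) * ((a : ℝ) + 1)))⁻¹)
      (A := |(-(4 * ((n : ℝ) / 2) * ((a : ℝ) + 1)))⁻¹|) (fun _ _ _ _ _ => le_rfl)
    convert h4 using 1
    ext ξ ε B x
    have h0 : (4 * ((n : ℝ) / 2) * ((a : ℝ) + 1)) ≠ 0 := by positivity
    rw [hM]
    push_cast
    rw [show (n : ℝ) * (n + 2) - 4 * ((n : ℝ) / 2 - 0) * ((n : ℝ) / 2 - 0 + 1) = 0 by ring]
    simp only [sub_zero, zero_add]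
    field_simp
    ring
  | succ i ihi =>
    have hai' : (a : ℝ) + 2 * (i + 1) ≤ 6 := by exact_mod_cast hai
    have ha0 : (0 : ℝ) ≤ a := by positivity
    have hm0 : 0 < (n : ℝ) / 2 - (i + 1 : ℕ) := by push_cast; linarith
    obtain ⟨m, hm⟩ : ∃ m, m = (n : ℝ) / 2 - (i + 1 : ℕ) := ⟨_, rfl⟩
    rw [← hm] at hm0
    have h1 := uniformlySolvable_image hn hκ (a := a) (i := i + 1) hai hm
    have h2 := (ihi (M := m + 2) (by omega) (by rw [hm]; push_cast; ring)).mul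
      (fun _ ε => -(ε ^ 2 * ((n : ℝ) * (n + 2) - 4 * m * (m + 1))))
      (A := 4 * |(n : ℝ) * (n + 2) - 4 * m * (m + 1)|) (fun ξ ε _ h h' => by
        rw [abs_neg, abs_mul, abs_of_nonneg (by positivity : 0 ≤ ε ^ 2)]
        gcongr
        nlinarith)
    have h3 : UniformlySolvable κ (fun (ξ : Eucl n) ε B x => (-((a : ℝ) * ((a : ℝ) - 1) * ‖ξ‖ ^ 2))
        * pw ξ ε (formPow ξ B (a - 2)) m x) := by
      rcases lt_or_ge a 2 with ha | ha
      · have : (a : ℝ) * ((a : ℝ) - 1) = 0 := by interval_cases a <;> norm_num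
        simpa [this] using uniformlySolvable_zero hn hκ
      · refine (iha (a - 2) (by omega) (i + 2) (by omega) (by rw [hm]; push_cast; ring)).mul _
          (A := |(a : ℝ) * ((a : ℝ) - 1)|) fun ξ ε h1 _ _ => ?_
        rw [abs_neg, abs_mul, abs_of_nonneg (by positivity : 0 ≤ ‖ξ‖ ^ 2)]
        exact mul_le_of_le_one_right (abs_nonneg _) (pow_le_one₀ (norm_nonneg _) h1)
    have h4 := (((h1.add hn h2).add hn h3)).mul
      (fun _ _ => (-(4 * m * (((i + 1 : ℕ) : ℝ) + a + 1)))⁻¹)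
      (A := |(-(4 * m * (((i + 1 : ℕ) : ℝ) + a + 1)))⁻¹|) (fun _ _ _ _ _ => le_rfl)
    convert h4 using 1
    ext ξ ε B x
    have h0 : (4 * m * (((i + 1 : ℕ) : ℝ) + a + 1)) ≠ 0 := by positivity
    rw [show M = m + 1 by rw [hM, hm]]
    field_simp
    ring

end corrector

/-! ### Weak formulation and the energy of the correction. -/

section energy
variable {n : ℕ} {ξ : Eucl n} {ε K : ℝ} {r ζ : Eucl n → ℝ}

lemma IsCorrector.memEnergyPerp (hn : 19 ≤ n) (h : IsCorrector ξ ε K r ζ) :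
    MemEnergyPerp ξ ε ζ (fun x => WithLp.toLp 2 fun i => pd i ζ x) := by
  have hn' : (19 : ℝ) ≤ n := by exact_mod_cast hn
  have hZ : Continuous (fun x : Eucl n => (WithLp.toLp 2 fun i => pd i ζ x : Eucl n)) :=
    (PiLp.continuous_toLp 2 _).comp (continuous_pi fun i => (pd_contDiff i h.contDiff).continuous)
  refine ⟨⟨?_, fun s hs => ?_, isWeakGradient_of_contDiff h.contDiff, ?_⟩, h.integral_phiZero,
    h.integral_phi⟩
  -- Decay of order n - 8 lies in L^(2n/(n-2)) when 2(n - 8) > n - 2, that is n > 14; the gradient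
  -- condition 2(n - 7) > n is the same.
  · refine h.decay.memLp (div_pos (by linarith) (by linarith)) ?_
    rw [← mul_div_assoc, lt_div_iff₀ (by linarith)]
    nlinarith
  · have : IsFiniteMeasure ((volume : Measure (Eucl n)).restrict s) :=
      ⟨by rw [Measure.restrict_apply_univ]; exact hs.measure_lt_top⟩
    obtain ⟨A, hA⟩ := hs.exists_bound_of_continuousOn h.contDiff.continuous.continuousOn
    refine MemLp.of_bound h.contDiff.continuous.aestronglyMeasurable A ?_
    exact (ae_restrict_iff' hs.measurableSet).2 (Eventually.of_forall hA)
  · have hcomp : ∀ i, MemLp (pd i ζ) 2 := by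
      intro i
      have := (h.decay_pd i).memLp (q := 2) (by norm_num) (by nlinarith)
      simpa using this
    have hb : ∀ x : Eucl n, ‖(WithLp.toLp 2 fun i => pd i ζ x : Eucl n)‖
        ≤ ‖∑ i, ‖pd i ζ x‖‖ := by
      intro x
      rw [Real.norm_of_nonneg (Finset.sum_nonneg fun i _ => norm_nonneg _)]
      rw [EuclideanSpace.norm_eq]
      refine Real.sqrt_le_iff.2 ⟨Finset.sum_nonneg fun i _ => norm_nonneg _, ?_⟩
      exact Finset.sum_sq_le_sq_sum_of_nonneg fun i _ => norm_nonneg _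
    exact (memLp_finsetSum Finset.univ fun i _ => (hcomp i).norm).mono
      hZ.aestronglyMeasurable (Eventually.of_forall hb)

lemma bubble_rpow (hn : 19 ≤ n) (ξ : Eucl n) {ε : ℝ} (hε : 0 < ε) (x : Eucl n) :
    bubble ξ ε x ^ (4 / ((n : ℝ) - 2)) = ε ^ 2 / (ε ^ 2 + ‖x - ξ‖ ^ 2) ^ 2 := by
  have hn' : (19 : ℝ) ≤ n := by exact_mod_cast hn
  have h := weight_pos hε ξ x
  have h2 : (n : ℝ) - 2 ≠ 0 := by linarith
  rw [bubble, ← Real.rpow_mul (by positivity), show ((n : ℝ) - 2) / 2 * (4 / ((n : ℝ) - 2)) = 2 by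
    field_simp; norm_num, Real.rpow_ofNat, div_pow]

/-- The weak form of the linearized equation for a corrector. -/
lemma IsCorrector.weak_form (hn : 19 ≤ n) (hε : 0 < ε) (h : IsCorrector ξ ε K r ζ)
    {ψ : Eucl n → ℝ} {Ψ : Eucl n → Eucl n} (hψ : MemEnergy ψ Ψ) :
    ∫ x, (inner ℝ (WithLp.toLp 2 fun i => pd i ζ x : Eucl n) (Ψ x)
      - (n : ℝ) * ((n : ℝ) + 2) * bubble ξ ε x ^ (4 / ((n : ℝ) - 2)) * ζ x * ψ x)
      = - ∫ x, r x * ψ x := by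
  have hn' : (19 : ℝ) ≤ n := by exact_mod_cast hn
  have hpq : (2 * (n : ℝ) / ((n : ℝ) - 2)).HolderConjugate (2 * (n : ℝ) / ((n : ℝ) + 2)) := by
    refine Real.holderConjugate_iff.2 ⟨?_, ?_⟩
    · rw [lt_div_iff₀ (by linarith)]; linarith
    · field_simp; ring
  have := hpq.ennrealOfReal
  -- Decay of order n - 6 puts g in the dual space L^(2n/(n+2)), again because n > 14.
  have hprod : ∀ g : Eucl n → ℝ, Decay ((n : ℝ) - 6) g → Integrable (fun x => ψ x * g x) := by
    intro g hg
    refine hψ.memLp.integrable_mul (hg.memLp (q := 2 * (n : ℝ) / ((n : ℝ) + 2))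
      (by positivity) ?_)
    rw [← mul_div_assoc, lt_div_iff₀ (by positivity)]
    nlinarith
  have hcomp : ∀ i, MemLp (pd i ζ) 2 := by
    intro i
    have := (h.decay_pd i).memLp (q := 2) (by norm_num) (by nlinarith)
    simpa using this
  have hΨ : ∀ i, MemLp (fun x => Ψ x i) 2 := fun i =>
    (EuclideanSpace.proj (𝕜 := ℝ) i).comp_memLp' hψ.memLp_grad
  have hΨi : ∀ i, Integrable (fun x => Ψ x i * pd i ζ x) := fun i =>
    (hΨ i).integrable_mul (hcomp i)
  have key : ∀ i, ∫ x, ψ x * pd i (pd i ζ) x = - ∫ x, Ψ x i * pd i ζ x := by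
    intro i
    refine hψ.weakGradient.integral_mul_pd (pd_contDiff i h.contDiff) i (hprod _ (h.decay_pd_pd i))
      (hΨi i) ?_
    simpa [mul_div_assoc] using hprod _ ((h.decay_pd i).div_one_add_norm.mono (by linarith))
  have hw : Decay ((n : ℝ) - 6) (fun x => (n : ℝ) * ((n : ℝ) + 2) *
      (ε ^ 2 / (ε ^ 2 + ‖x - ξ‖ ^ 2) ^ 2 * ζ x)) := by
    have h1 := ((weight_decay ξ hε (m := 2) (by norm_num)).mul h.decay).const_mul
      ((n : ℝ) * ((n : ℝ) + 2) * ε ^ 2)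
    refine (h1.mono (s := (n : ℝ) - 6) (by linarith)).congr fun x => ?_
    have hD := weight_pos hε ξ x
    rw [Real.rpow_neg hD.le, Real.rpow_ofNat]
    field_simp
  have hI := hprod _ hw
  have e1 : ∀ x, inner ℝ (WithLp.toLp 2 fun i => pd i ζ x : Eucl n) (Ψ x)
      = ∑ i, Ψ x i * pd i ζ x := by
    intro x; simp [PiLp.inner_apply]
  simp only [e1, bubble_rpow hn ξ hε]
  have e2 : ∀ x, (n : ℝ) * ((n : ℝ) + 2) * (ε ^ 2 / (ε ^ 2 + ‖x - ξ‖ ^ 2) ^ 2) * ζ x * ψ x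
      = ψ x * ((n : ℝ) * ((n : ℝ) + 2) * (ε ^ 2 / (ε ^ 2 + ‖x - ξ‖ ^ 2) ^ 2 * ζ x)) := by
    intro x; ring
  simp only [e2]
  rw [integral_sub (integrable_finsetSum _ fun i _ => hΨi i) hI,
    integral_finsetSum _ fun i _ => hΨi i]
  have e3 : ∀ x, r x * ψ x = ∑ i, ψ x * pd i (pd i ζ) x
      + ψ x * ((n : ℝ) * ((n : ℝ) + 2) * (ε ^ 2 / (ε ^ 2 + ‖x - ξ‖ ^ 2) ^ 2 * ζ x)) := by
    intro x
    rw [← h.equation x, ← Finset.mul_sum]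
    ring
  simp only [e3]
  rw [integral_add (integrable_finsetSum _ fun i _ => hprod _ (h.decay_pd_pd i)) hI,
    integral_finsetSum _ fun i _ => hprod _ (h.decay_pd_pd i), Finset.sum_congr rfl fun i _ => key i,
    Finset.sum_neg_distrib]
  ring

/-- The energy of the correction is computed by an explicit corrector. -/
lemma integral_source_mul_correction (hn : 19 ≤ n) {τ : ℝ}
    {W : Fin n → Fin n → Fin n → Fin n → ℝ} (hε : 0 < ε)
    (h : IsCorrector ξ ε K (source τ W ξ ε) ζ) :
    ∫ x, source τ W ξ ε x * correction τ W ξ ε x = ∫ x, source τ W ξ ε x * ζ x := by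
  have hex : ∃ z, IsCorrection τ W ξ ε z :=
    ⟨ζ, _, h.memEnergyPerp hn, fun ψ Ψ hψ => h.weak_form hn hε hψ.memEnergy⟩
  obtain ⟨Z, hZ, hz⟩ := hex.choose_spec
  have hc : correction τ W ξ ε = hex.choose := by rw [correction, dif_pos hex]
  rw [hc]
  -- The equation for z is tested with ζ and the one for ζ with z. The bilinear form is symmetric,
  -- so the two right-hand sides agree.
  have h1 := hz _ _ (h.memEnergyPerp hn)
  have h2 := h.weak_form hn hε hZ.memEnergy
  have h3 : (fun x => inner ℝ (WithLp.toLp 2 fun i => pd i ζ x : Eucl n) (Z x)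
      - (n : ℝ) * ((n : ℝ) + 2) * bubble ξ ε x ^ (4 / ((n : ℝ) - 2)) * ζ x * hex.choose x)
      = fun x => inner ℝ (Z x) (WithLp.toLp 2 fun i => pd i ζ x : Eucl n)
      - (n : ℝ) * ((n : ℝ) + 2) * bubble ξ ε x ^ (4 / ((n : ℝ) - 2)) * hex.choose x * ζ x := by
    ext x
    rw [real_inner_comm]
    ring
  rw [h3, h1] at h2
  linarith

end energy

/-! ### Contractions of the Weyl tensor with ξ. -/

section weyl
variable {n : ℕ} {W : Fin n → Fin n → Fin n → Fin n → ℝ}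

lemma IsWeylTensor.sum_left (hW : IsWeylTensor W) (k q : Fin n) (u : Fin n → ℝ) :
    ∑ i, ∑ p, W i p k q * u i * u p = 0 := by
  have h : ∑ i, ∑ p, W i p k q * u i * u p = - ∑ i, ∑ p, W i p k q * u i * u p := by
    conv_lhs => rw [Finset.sum_comm]
    simp only [← Finset.sum_neg_distrib]
    refine Finset.sum_congr rfl fun i _ => Finset.sum_congr rfl fun p _ => ?_
    rw [hW.antisymm_left p i]
    ring
  linarith

/-- The antisymmetric pair already contains x - ξ, so the part x - ξ of x = (x - ξ) + ξ contributes
nothing. -/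
lemma IsWeylTensor.sum_left_sub (hW : IsWeylTensor W) (k q : Fin n) (x ξ : Fin n → ℝ) :
    ∑ i, ∑ p, W i p k q * (x i - ξ i) * x p = ∑ i, ∑ p, W i p k q * (x i - ξ i) * ξ p := by
  have h := hW.sum_left k q (fun i => x i - ξ i)
  rw [← sub_eq_zero, ← Finset.sum_sub_distrib, ← h]
  refine Finset.sum_congr rfl fun i _ => ?_
  rw [← Finset.sum_sub_distrib]
  exact Finset.sum_congr rfl fun p _ => by ring

lemma IsWeylTensor.swap (hW : IsWeylTensor W) (i p k q : Fin n) : W i p k q = W p i q k := by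
  rw [hW.antisymm_left i p, hW.antisymm_right p i k q, neg_neg]

lemma IsWeylTensor.sum_right_sub (hW : IsWeylTensor W) (i p : Fin n) (x ξ : Fin n → ℝ) :
    ∑ k, ∑ q, W i p k q * (x k - ξ k) * x q = ∑ k, ∑ q, W i p k q * (x k - ξ k) * ξ q := by
  simpa only [← hW.pair_symm _ _ i p] using hW.sum_left_sub i p x ξ

lemma IsWeylTensor.trace (hW : IsWeylTensor W) (x : Eucl n) : ∑ i, tensorH W i i x = 0 := by
  simp only [tensorH]
  rw [Finset.sum_comm]
  refine Finset.sum_eq_zero fun p _ => ?_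
  rw [Finset.sum_comm]
  refine Finset.sum_eq_zero fun q _ => ?_
  rw [← Finset.sum_mul, ← Finset.sum_mul, hW.trace_free]
  ring

/-- The matrix `∑_{i,k} W_{ipkq} ξ_i ξ_k`. -/
def contraction (W : Fin n → Fin n → Fin n → Fin n → ℝ) (ξ : Eucl n) (p q : Fin n) : ℝ :=
  ∑ i, ∑ k, W i p k q * ξ i * ξ k

/-- Symmetry comes from the pair symmetry, vanishing trace from that of W, and annihilation of ξ
from antisymmetry. -/
lemma IsWeylTensor.isTransverse (hW : IsWeylTensor W) (ξ : Eucl n) :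
    IsTransverse ξ (contraction W ξ) where
  symm p q := by
    rw [contraction, contraction, Finset.sum_comm]
    refine Finset.sum_congr rfl fun k _ => Finset.sum_congr rfl fun i _ => ?_
    rw [hW.pair_symm i p k q]
    ring
  trace := by
    simp only [contraction]
    rw [Finset.sum_comm]
    refine Finset.sum_eq_zero fun i _ => ?_
    rw [Finset.sum_comm]
    refine Finset.sum_eq_zero fun k _ => ?_
    rw [← Finset.sum_mul, ← Finset.sum_mul]
    simp only [hW.swap i _ k, hW.trace_free]
    ring
  apply_self p := by
    simp only [contraction, Finset.sum_mul]
    rw [Finset.sum_comm]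
    refine Finset.sum_eq_zero fun i _ => ?_
    have h := hW.sum_left i p ξ.ofLp
    rw [← mul_zero (ξ i), ← h, Finset.mul_sum, Finset.sum_comm]
    refine Finset.sum_congr rfl fun k _ => ?_
    rw [Finset.mul_sum]
    refine Finset.sum_congr rfl fun q _ => ?_
    rw [hW.pair_symm i p]
    ring

lemma abs_contraction_le (W : Fin n → Fin n → Fin n → Fin n → ℝ) (ξ : Eucl n) (p q : Fin n) :
    |contraction W ξ p q| ≤ (∑ i, ∑ p, ∑ k, ∑ q, |W i p k q|) * ‖ξ‖ ^ 2 := by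
  have h1 : |contraction W ξ p q| ≤ ∑ i, ∑ k, |W i p k q| * ‖ξ‖ ^ 2 := by
    refine (Finset.abs_sum_le_sum_abs _ _).trans (Finset.sum_le_sum fun i _ =>
      (Finset.abs_sum_le_sum_abs _ _).trans (Finset.sum_le_sum fun k _ => ?_))
    rw [mul_assoc, abs_mul, abs_mul, sq]
    have := abs_coord_le ξ i
    have := abs_coord_le ξ k
    gcongr
  refine h1.trans ?_
  simp only [← Finset.sum_mul]
  refine mul_le_mul_of_nonneg_right (Finset.sum_le_sum fun i _ => ?_) (by positivity)
  refine (Finset.single_le_sum (f := fun p => ∑ k, ∑ q, |W i p k q|)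
    (fun p _ => by positivity) (Finset.mem_univ p)).trans' ?_
  refine Finset.sum_le_sum fun k _ => ?_
  exact Finset.single_le_sum (f := fun q => |W i p k q|) (fun q _ => by positivity)
    (Finset.mem_univ q)

/-- The left side is W(y,x,y,x). In each antisymmetric pair x may be replaced by ξ, which gives
W(y,ξ,y,ξ) and makes the source quadratic in ξ. -/
lemma IsWeylTensor.sum_tensorH (hW : IsWeylTensor W) (ξ x : Eucl n) :
    ∑ i, ∑ k, tensorH W i k x * (x i - ξ i) * (x k - ξ k)
      = ev x (quadForm ξ (contraction W ξ)) := by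
  rw [ev_quadForm]
  have e1 : ∑ i, ∑ k, tensorH W i k x * (x i - ξ i) * (x k - ξ k)
      = ∑ k, ∑ q, (∑ i, ∑ p, W i p k q * (x i - ξ i) * x p) * ((x k - ξ k) * x q) := by
    rw [Finset.sum_comm]
    refine Finset.sum_congr rfl fun k _ => ?_
    simp only [tensorH, Finset.sum_mul]
    conv_rhs => rw [Finset.sum_comm]
    refine Finset.sum_congr rfl fun i _ => ?_
    rw [Finset.sum_comm]
    exact Finset.sum_congr rfl fun q _ => Finset.sum_congr rfl fun p _ => by ring
  have e2 : ∑ k, ∑ q, (∑ i, ∑ p, W i p k q * (x i - ξ i) * ξ p) * ((x k - ξ k) * x q)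
      = ∑ i, ∑ p, (∑ k, ∑ q, W i p k q * (x k - ξ k) * x q) * ((x i - ξ i) * ξ p) := by
    simp only [Finset.sum_mul]
    conv_lhs => enter [2, k]; rw [Finset.sum_comm]
    rw [Finset.sum_comm]
    refine Finset.sum_congr rfl fun i _ => ?_
    conv_lhs => enter [2, k]; rw [Finset.sum_comm]
    rw [Finset.sum_comm]
    exact Finset.sum_congr rfl fun p _ => Finset.sum_congr rfl fun k _ =>
      Finset.sum_congr rfl fun q _ => by ring
  rw [e1]
  simp only [hW.sum_left_sub _ _ x.ofLp ξ.ofLp]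
  rw [e2]
  simp only [hW.sum_right_sub _ _ x.ofLp ξ.ofLp, contraction, Finset.sum_mul]
  refine Finset.sum_congr rfl fun i _ => ?_
  rw [Finset.sum_comm]
  refine Finset.sum_congr rfl fun k _ => ?_
  refine Finset.sum_congr rfl fun p _ => Finset.sum_congr rfl fun q _ => ?_
  rw [hW.swap i p k q]
  ring

end weyl

/-! ### The source term and the fourth-order bound on the correction energy. -/

section source
variable {n : ℕ}

lemma bubble_eq (ξ : Eucl n) {ε : ℝ} (hε : 0 < ε) :
    bubble ξ ε = fun x => ε ^ (((n : ℝ) - 2) / 2) * pw ξ ε 1 (((n : ℝ) - 2) / 2) x := by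
  ext x
  rw [bubble, bubble_ratio_rpow ξ hε]
  simp [pw]

lemma pd_bubble (ξ : Eucl n) {ε : ℝ} (hε : 0 < ε) (i : Fin n) :
    pd i (bubble ξ ε) = fun x => (-(((n : ℝ) - 2) * ε ^ (((n : ℝ) - 2) / 2)))
      * pw ξ ε (shiftX ξ i) ((n : ℝ) / 2) x := by
  rw [bubble_eq ξ hε, pd_fun_const_mul i _ (pw_contDiff ξ hε _ _), pd_pw i ξ hε]
  ext x
  rw [show ((n : ℝ) - 2) / 2 + 1 = (n : ℝ) / 2 by ring]
  simp [pw]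
  ring

lemma pd_pd_bubble (ξ : Eucl n) {ε : ℝ} (hε : 0 < ε) (i k : Fin n) (x : Eucl n) :
    pd i (pd k (bubble ξ ε)) x = (((n : ℝ) - 2) * ε ^ (((n : ℝ) - 2) / 2))
      * (n * ((x i - ξ i) * (x k - ξ k)) * (ε ^ 2 + ‖x - ξ‖ ^ 2) ^ (-((n : ℝ) / 2 + 1))
        - if k = i then (ε ^ 2 + ‖x - ξ‖ ^ 2) ^ (-((n : ℝ) / 2)) else 0) := by
  rw [pd_bubble ξ hε, pd_fun_const_mul i _ (pw_contDiff ξ hε _ _), pd_pw i ξ hε]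
  simp only [pw, pderiv_shiftX, map_mul, ev_shiftX]
  split_ifs
  · simp only [map_one, one_mul]; ring
  · simp only [map_zero, zero_mul, zero_sub, sub_zero]; ring

/-- The source term of the linearized equation as a function of the contracted Weyl tensor. -/
def sourceForm (τ : ℝ) (ξ : Eucl n) (ε : ℝ) (B : Fin n → Fin n → ℝ) (x : Eucl n) : ℝ :=
  (n : ℝ) * ((n : ℝ) - 2) * ε ^ (((n : ℝ) - 2) / 2) *
    (profile τ (‖x‖ ^ 2) * pw ξ ε (formPow ξ B 0) ((n : ℝ) / 2 + 1) x)

/-- The Hessian of the bubble is a multiple of y ⊗ y plus a multiple of the identity; the latter is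
lost because H is trace-free. -/
lemma IsWeylTensor.source_eq {W : Fin n → Fin n → Fin n → Fin n → ℝ} (hW : IsWeylTensor W)
    (τ : ℝ) (ξ : Eucl n) {ε : ℝ} (hε : 0 < ε) :
    source τ W ξ ε = sourceForm τ ξ ε (contraction W ξ) := by
  ext x
  set w0 := (ε ^ 2 + ‖x - ξ‖ ^ 2) ^ (-((n : ℝ) / 2)) with hw0
  set w1 := (ε ^ 2 + ‖x - ξ‖ ^ 2) ^ (-((n : ℝ) / 2 + 1)) with hw1
  set c := ε ^ (((n : ℝ) - 2) / 2) with hc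
  have e : source τ W ξ ε x = (n : ℝ) * (((n : ℝ) - 2) * c) * profile τ (‖x‖ ^ 2) * w1 *
      (∑ i, ∑ k, tensorH W i k x * (x i - ξ i) * (x k - ξ k))
      - (((n : ℝ) - 2) * c) * profile τ (‖x‖ ^ 2) * w0 * ∑ i, tensorH W i i x := by
    simp only [source, tensorHBar, pd_pd_bubble ξ hε, Finset.mul_sum, ← Finset.sum_sub_distrib]
    refine Finset.sum_congr rfl fun i _ => ?_
    have : ((n : ℝ) - 2) * c * profile τ (‖x‖ ^ 2) * w0 * tensorH W i i x
        = ∑ k, if k = i then ((n : ℝ) - 2) * c * profile τ (‖x‖ ^ 2) * w0 * tensorH W i k x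
          else 0 := by simp
    rw [this, ← Finset.sum_sub_distrib]
    refine Finset.sum_congr rfl fun k _ => ?_
    split_ifs <;> ring
  rw [e, hW.trace, hW.sum_tensorH, sourceForm, pw, formPow, ← hw1, ← hc, pow_zero, mul_one]
  ring

/-- This rewrites f(|x|²) as a polynomial in the weight and ⟨ξ,y⟩, with coefficients bounded near
(0,1). -/
lemma norm_sq_eq_weight (ξ x : Eucl n) (ε : ℝ) :
    ‖x‖ ^ 2 = (ε ^ 2 + ‖x - ξ‖ ^ 2) + 2 * ev x (dirForm ξ) + (‖ξ‖ ^ 2 - ε ^ 2) := by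
  have h := norm_add_sq_real ξ (x - ξ)
  rw [add_sub_cancel] at h
  rw [h, ev_dirForm]
  ring

lemma pw_formPow_shift (ξ : Eucl n) {ε : ℝ} (hε : 0 < ε) (B : Fin n → Fin n → ℝ) (a b : ℕ)
    (x : Eucl n) : pw ξ ε (formPow ξ B a) ((n : ℝ) / 2 - b + 1) x
      = (ε ^ 2 + ‖x - ξ‖ ^ 2) ^ b * ev x (dirForm ξ) ^ a *
        pw ξ ε (formPow ξ B 0) ((n : ℝ) / 2 + 1) x := by
  have hD := weight_pos hε ξ x
  simp only [pw, formPow, map_mul, map_pow, pow_zero, mul_one]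
  rw [show -((n : ℝ) / 2 - b + 1) = b + -((n : ℝ) / 2 + 1) by ring, Real.rpow_add hD,
    Real.rpow_natCast]
  ring

/-- The cubic f is expanded at c = |ξ|² - ε² with increment D + 2⟨ξ,y⟩. The resulting monomials D^b
⟨ξ,y⟩^a have a + b ≤ 3, hence a + 2b ≤ 6. -/
lemma uniformlySolvable_sourceForm (hn : 19 ≤ n) {κ : ℝ} (hκ : 0 ≤ κ) (τ : ℝ) :
    UniformlySolvable κ (sourceForm (n := n) τ) := by
  have hn' : (19 : ℝ) ≤ n := by exact_mod_cast hn
  have hc : ∀ (ξ : Eucl n) (ε : ℝ), ‖ξ‖ ≤ 1 → 1 / 2 ≤ ε → ε ≤ 2 →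
      |‖ξ‖ ^ 2 - ε ^ 2| ≤ 4 := by
    intro ξ ε h1 h2 h3
    rw [abs_le]
    constructor <;> nlinarith [norm_nonneg ξ]
  have b0 : ∀ (ξ : Eucl n) (ε : ℝ), ‖ξ‖ ≤ 1 → 1 / 2 ≤ ε → ε ≤ 2 →
      |profile τ (‖ξ‖ ^ 2 - ε ^ 2)| ≤ |τ| + 40 := by
    intro ξ ε h1 h2 h3
    have h := hc ξ ε h1 h2 h3
    generalize ‖ξ‖ ^ 2 - ε ^ 2 = c at h
    rw [profile]
    have e : τ + 5 * c - c ^ 2 + 1 / 20 * c ^ 3 = τ + (5 * c - c ^ 2 + 1 / 20 * c ^ 3) := by ring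
    rw [e]
    refine (abs_add_le _ _).trans (add_le_add le_rfl ?_)
    calc |5 * c - c ^ 2 + 1 / 20 * c ^ 3| ≤ |5 * c - c ^ 2| + |1 / 20 * c ^ 3| := abs_add_le _ _
      _ ≤ |5 * c| + |c ^ 2| + |1 / 20 * c ^ 3| := by gcongr; exact abs_sub _ _
      _ = 5 * |c| + |c| ^ 2 + 1 / 20 * |c| ^ 3 := by
        rw [abs_mul, abs_mul, abs_pow, abs_pow]; norm_num
      _ ≤ 5 * 4 + 4 ^ 2 + 1 / 20 * 4 ^ 3 := by gcongr
      _ ≤ 40 := by norm_num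
  have b1 : ∀ (ξ : Eucl n) (ε : ℝ), ‖ξ‖ ≤ 1 → 1 / 2 ≤ ε → ε ≤ 2 →
      |5 - 2 * (‖ξ‖ ^ 2 - ε ^ 2) + 3 / 20 * (‖ξ‖ ^ 2 - ε ^ 2) ^ 2| ≤ 20 := by
    intro ξ ε h1 h2 h3
    have h := abs_le.1 (hc ξ ε h1 h2 h3)
    rw [abs_le]
    constructor <;> nlinarith
  have b2 : ∀ (ξ : Eucl n) (ε : ℝ), ‖ξ‖ ≤ 1 → 1 / 2 ≤ ε → ε ≤ 2 →
      |-1 + 3 / 20 * (‖ξ‖ ^ 2 - ε ^ 2)| ≤ 2 := by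
    intro ξ ε h1 h2 h3
    have h := abs_le.1 (hc ξ ε h1 h2 h3)
    rw [abs_le]
    constructor <;> linarith
  have b3 : ∀ (c : ℝ) (ξ : Eucl n) (ε : ℝ), ‖ξ‖ ≤ 1 → 1 / 2 ≤ ε → ε ≤ 2 → |c| ≤ |c| :=
    fun c _ _ _ _ _ => le_rfl
  have P := fun a b h => uniformlySolvable_pw (n := n) hn hκ a b h rfl
  -- The four terms of the Taylor expansion, with coefficients f(c), f'(c), f''(c)/2 and f'''(c)/6 =
  -- 1/20.
  have s0 := (P 0 0 (by norm_num)).mul _ b0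
  have s1 := ((P 0 1 (by norm_num)).add hn ((P 1 0 (by norm_num)).mul _ (b3 2))).mul _ b1
  have s2 := ((P 0 2 (by norm_num)).add hn (((P 1 1 (by norm_num)).add hn
    (P 2 0 (by norm_num))).mul _ (b3 4))).mul _ b2
  have s3 := (((P 0 3 (by norm_num)).add hn ((P 1 2 (by norm_num)).mul _ (b3 6))).add hn
    (((P 2 1 (by norm_num)).mul _ (b3 12)).add hn ((P 3 0 (by norm_num)).mul _ (b3 8)))).mul _
    (b3 (1 / 20))
  obtain ⟨K, hK, h⟩ := (((s0.add hn s1).add hn (s2.add hn s3)).mul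
    (fun _ ε => (n : ℝ) * ((n : ℝ) - 2) * ε ^ (((n : ℝ) - 2) / 2))
    (A := (n : ℝ) * ((n : ℝ) - 2) * 2 ^ (((n : ℝ) - 2) / 2)) (fun ξ ε _ h2 h3 => by
      have : (0 : ℝ) ≤ (n : ℝ) - 2 := by linarith
      have h0 : 0 ≤ ε := by linarith
      rw [abs_of_nonneg (by positivity)]
      gcongr))
  refine ⟨K, hK, fun ξ ε B h1 h2 h3 h4 h5 => ?_⟩
  obtain ⟨ζ, hζ⟩ := h ξ ε B h1 h2 h3 h4 h5
  refine ⟨ζ, ?_⟩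
  convert hζ using 1
  ext x
  have hε : 0 < ε := by linarith
  simp only [pw_formPow_shift ξ hε]
  rw [sourceForm, norm_sq_eq_weight ξ x ε]
  simp only [profile]
  ring

lemma abs_sourceForm_le (hn : 19 ≤ n) {κ : ℝ} (hκ : 0 ≤ κ) (τ : ℝ) :
    ∃ K : ℝ, 0 ≤ K ∧ ∀ (ξ : Eucl n) (ε : ℝ) (B : Fin n → Fin n → ℝ), ‖ξ‖ ≤ 1 → 1 / 2 ≤ ε →
      ε ≤ 2 → (∀ p q, |B p q| ≤ κ * ‖ξ‖ ^ 2) → ∀ x,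
      |sourceForm τ ξ ε B x| ≤ K * ‖ξ‖ ^ 2 * (ε ^ 2 + ‖x - ξ‖ ^ 2) ^ (3 - (n : ℝ) / 2) := by
  have hn' : (19 : ℝ) ≤ n := by exact_mod_cast hn
  have hn2 : (0 : ℝ) ≤ (n : ℝ) - 2 := by linarith
  refine ⟨(n : ℝ) * ((n : ℝ) - 2) * 2 ^ (((n : ℝ) - 2) / 2) *
    ((64 * |τ| + 1250) * (64 * ((n : ℝ) ^ 2 * κ))), by positivity,
    fun ξ ε B h1 h2 h3 h4 x => ?_⟩
  have hε : 0 < ε := by linarith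
  have hb := pw_formPow_bound (B := B) (a := 0) (M := (n : ℝ) / 2 + 1) (b := -((n : ℝ) / 2)) h1 h2
    h4 hκ (by push_cast; linarith) (by push_cast; linarith) x
  have hD := weight_pos hε ξ x
  set D := ε ^ 2 + ‖x - ξ‖ ^ 2 with hDdef
  have hD4 : (1 / 4 : ℝ) ≤ D := by rw [hDdef]; nlinarith [sq_nonneg ‖x - ξ‖]
  have hs : ‖x‖ ^ 2 ≤ 10 * D := by
    have h5 : ‖x‖ ≤ ‖x - ξ‖ + ‖ξ‖ := by simpa using norm_add_le (x - ξ) ξ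
    have h6 : ‖x‖ ≤ ‖x - ξ‖ + 1 := by linarith
    have h7 : ‖x‖ ^ 2 ≤ (‖x - ξ‖ + 1) ^ 2 := by gcongr
    nlinarith [sq_nonneg (‖x - ξ‖ - 1)]
  -- As the weight is at least 1/4, its lower powers are absorbed into the cube; 1250 = 5·10·16 +
  -- 100·4 + 50.
  have hf : |profile τ (‖x‖ ^ 2)| ≤ (64 * |τ| + 1250) * D ^ 3 := by
    have hs0 : 0 ≤ ‖x‖ ^ 2 := by positivity
    generalize ‖x‖ ^ 2 = s at hs hs0
    have hD1 : 1 ≤ 64 * D ^ 3 := by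
      calc (1 : ℝ) = 64 * (1 / 4) ^ 3 := by norm_num
        _ ≤ _ := by gcongr
    have hD2 : D ≤ 16 * D ^ 3 := by nlinarith [mul_nonneg hD.le (sub_nonneg.2 hD4)]
    have hD3 : D ^ 2 ≤ 4 * D ^ 3 := by nlinarith [mul_nonneg (sq_nonneg D) (sub_nonneg.2 hD4)]
    calc |profile τ s| ≤ |τ| + 5 * s + s ^ 2 + 1 / 20 * s ^ 3 := by
          rw [profile, abs_le]
          have := abs_le.1 (le_refl |τ|)
          have hs2 : 0 ≤ s ^ 2 := by positivity
          have hs3 : 0 ≤ s ^ 3 := by positivity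
          constructor <;> linarith
      _ ≤ |τ| * 1 + 5 * (10 * D) + (10 * D) ^ 2 + 1 / 20 * (10 * D) ^ 3 := by
          rw [mul_one]; gcongr
      _ ≤ |τ| * (64 * D ^ 3) + 5 * (10 * (16 * D ^ 3)) + 100 * (4 * D ^ 3) + 50 * D ^ 3 := by
          have : |τ| * 1 ≤ |τ| * (64 * D ^ 3) := by gcongr
          nlinarith
      _ = _ := by ring
  rw [sourceForm, abs_mul,
    abs_of_nonneg (by positivity : 0 ≤ (n : ℝ) * ((n : ℝ) - 2) * ε ^ (((n : ℝ) - 2) / 2)), abs_mul]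
  calc (n : ℝ) * ((n : ℝ) - 2) * ε ^ (((n : ℝ) - 2) / 2) * (|profile τ (‖x‖ ^ 2)| *
        |pw ξ ε (formPow ξ B 0) ((n : ℝ) / 2 + 1) x|)
      ≤ (n : ℝ) * ((n : ℝ) - 2) * 2 ^ (((n : ℝ) - 2) / 2) * (((64 * |τ| + 1250) * D ^ 3) *
        (64 * ((n : ℝ) ^ 2 * κ) * ‖ξ‖ ^ 2 * D ^ (-((n : ℝ) / 2)))) := by gcongr
    _ = _ := by
        rw [show (3 : ℝ) - (n : ℝ) / 2 = 3 + -((n : ℝ) / 2) by ring, Real.rpow_add hD,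
          Real.rpow_ofNat]
        ring

/-- The contribution of the correction to the auxiliary function is of fourth order in `ξ`. -/
lemma IsWeylTensor.abs_correction_energy_le (hn : 19 ≤ n)
    {W : Fin n → Fin n → Fin n → Fin n → ℝ} (hW : IsWeylTensor W) (τ : ℝ) :
    ∃ K : ℝ, 0 ≤ K ∧ ∀ (ξ : Eucl n) (ε : ℝ), ‖ξ‖ ≤ 1 → 1 / 2 ≤ ε → ε ≤ 2 →
      |∫ x, source τ W ξ ε x * correction τ W ξ ε x| ≤ K * ‖ξ‖ ^ 4 := by
  have hn' : (19 : ℝ) ≤ n := by exact_mod_cast hn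
  have hκ : 0 ≤ ∑ i, ∑ p, ∑ k, ∑ q, |W i p k q| := by positivity
  obtain ⟨K, hK, h⟩ := uniformlySolvable_sourceForm hn hκ τ
  obtain ⟨K', hK', h'⟩ := abs_sourceForm_le hn hκ τ
  refine ⟨K' * K * ∫ x : Eucl n, ((1 / 2 : ℝ) ^ 2 + ‖x - 0‖ ^ 2) ^ (-((n : ℝ) - 7)), ?_,
    fun ξ ε h1 h2 h3 => ?_⟩
  · have : 0 ≤ ∫ x : Eucl n, ((1 / 2 : ℝ) ^ 2 + ‖x - 0‖ ^ 2) ^ (-((n : ℝ) - 7)) :=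
      integral_nonneg fun x => by positivity
    positivity
  · have hε : 0 < ε := by linarith
    have hB := abs_contraction_le W ξ
    obtain ⟨ζ, hζ⟩ := h ξ ε _ h1 h2 h3 (hW.isTransverse ξ) hB
    rw [← hW.source_eq τ ξ hε] at hζ
    rw [integral_source_mul_correction hn hε hζ]
    have hI : Integrable (fun x : Eucl n => ((1 / 2 : ℝ) ^ 2 + ‖x - 0‖ ^ 2) ^ (-((n : ℝ) - 7))) :=
      (weight_decay 0 (by norm_num) (by linarith)).integrable (by linarith)
    have hI' : Integrable (fun x : Eucl n => ((1 / 2 : ℝ) ^ 2 + ‖x - ξ‖ ^ 2) ^ (-((n : ℝ) - 7))) :=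
      (weight_decay ξ (by norm_num) (by linarith)).integrable (by linarith)
    -- The bounds for source and corrector multiply to the power -(n - 7) of the weight, which is
    -- integrable since 2(n - 7) > n.
    have hpt : ∀ x, ‖source τ W ξ ε x * ζ x‖ ≤ K' * K * ‖ξ‖ ^ 4 *
        ((1 / 2 : ℝ) ^ 2 + ‖x - ξ‖ ^ 2) ^ (-((n : ℝ) - 7)) := by
      intro x
      have hD := weight_pos hε ξ x
      have hs := h' ξ ε _ h1 h2 h3 hB x
      rw [← hW.source_eq τ ξ hε] at hs
      rw [norm_mul]
      calc ‖source τ W ξ ε x‖ * ‖ζ x‖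
          ≤ (K' * ‖ξ‖ ^ 2 * (ε ^ 2 + ‖x - ξ‖ ^ 2) ^ (3 - (n : ℝ) / 2)) *
            (K * ‖ξ‖ ^ 2 * (ε ^ 2 + ‖x - ξ‖ ^ 2) ^ (4 - (n : ℝ) / 2)) := by
            gcongr
            · exact hs
            · exact hζ.bound x
        _ = K' * K * ‖ξ‖ ^ 4 * (ε ^ 2 + ‖x - ξ‖ ^ 2) ^ (-((n : ℝ) - 7)) := by
            rw [show -((n : ℝ) - 7) = (3 - (n : ℝ) / 2) + (4 - (n : ℝ) / 2) by ring,
              Real.rpow_add hD]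
            ring
        _ ≤ _ := by
            refine mul_le_mul_of_nonneg_left ?_ (by positivity)
            refine Real.rpow_le_rpow_of_nonpos (by positivity) ?_ (by linarith)
            gcongr
    have := norm_integral_le_of_norm_le (hI'.const_mul (K' * K * ‖ξ‖ ^ 4))
      (Eventually.of_forall hpt)
    rw [integral_const_mul] at this
    -- Translation invariance makes the constant independent of ξ.
    have e : ∫ x : Eucl n, ((1 / 2 : ℝ) ^ 2 + ‖x - ξ‖ ^ 2) ^ (-((n : ℝ) - 7))
        = ∫ x : Eucl n, ((1 / 2 : ℝ) ^ 2 + ‖x - 0‖ ^ 2) ^ (-((n : ℝ) - 7)) := by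
      simp only [sub_zero]
      exact integral_sub_right_eq_self
        (fun x : Eucl n => ((1 / 2 : ℝ) ^ 2 + ‖x‖ ^ 2) ^ (-((n : ℝ) - 7))) ξ
    rw [e] at this
    calc _ ≤ _ := this
      _ = _ := by ring

end source

/-! ### Laplacian and directional derivative on polynomials. -/

section polynomials
variable {n : ℕ}

/-- The polynomial `|x|²`. -/
def rsq (n : ℕ) : Poly n := ∑ i, X i ^ 2

/-- The Laplacian on polynomials. -/
def lap (P : Poly n) : Poly n := ∑ i, pderiv i (pderiv i P)

/-- The directional derivative `∂_ξ` on polynomials. -/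
def dirD (ξ : Eucl n) (P : Poly n) : Poly n := ∑ i, C (ξ i) * pderiv i P

/-- The linear polynomial `⟨ξ, x⟩`. -/
def lin (ξ : Eucl n) : Poly n := ∑ i, C (ξ i) * X i

lemma pderiv_comm (i j : Fin n) (P : Poly n) :
    pderiv i (pderiv j P) = pderiv j (pderiv i P) := by
  have h : ⁅(pderiv i : Derivation ℝ (Poly n) (Poly n)), (pderiv j : Derivation ℝ (Poly n) (Poly n))⁆ = 0 := by
    refine MvPolynomial.derivation_ext fun k => ?_
    rw [Derivation.commutator_apply]
    simp [MvPolynomial.pderiv_X, Pi.single_apply, apply_ite]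
  have := DFunLike.congr_fun h P
  rw [Derivation.commutator_apply] at this
  simpa [sub_eq_zero] using this

@[simp] lemma shiftX_zero (i : Fin n) : shiftX (0 : Eucl n) i = X i := by simp [shiftX]

@[simp] lemma pderiv_rsq (i : Fin n) : pderiv i (rsq n) = 2 * X i := by
  simp [rsq, MvPolynomial.pderiv_X, Pi.single_apply]

@[simp] lemma pderiv_lin (i : Fin n) (ξ : Eucl n) : pderiv i (lin ξ) = C (ξ i) := by
  simp [lin, MvPolynomial.pderiv_X, Pi.single_apply]

@[simp] lemma ev_rsq (x : Eucl n) : ev x (rsq n) = ‖x‖ ^ 2 := by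
  simp [rsq, EuclideanSpace.norm_sq_eq]

@[simp] lemma ev_lin (ξ x : Eucl n) : ev x (lin ξ) = inner ℝ ξ x := by
  simp [lin, PiLp.inner_apply, mul_comm]

lemma rsq_isHomogeneous : (rsq n).IsHomogeneous 2 :=
  MvPolynomial.IsHomogeneous.sum _ _ _ fun i _ => by
    simpa using (MvPolynomial.isHomogeneous_X ℝ i).pow 2

lemma lin_isHomogeneous (ξ : Eucl n) : (lin ξ).IsHomogeneous 1 :=
  MvPolynomial.IsHomogeneous.sum _ _ _ fun i _ => by
    simpa using (MvPolynomial.isHomogeneous_X ℝ i).C_mul (ξ i)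

lemma isHomogeneous_pderiv {P : Poly n} {d : ℕ} (h : P.IsHomogeneous (d + 1)) (i : Fin n) :
    (pderiv i P).IsHomogeneous d := by
  simpa using h.pderiv (i := i)

lemma isHomogeneous_dirD {P : Poly n} {d : ℕ} (h : P.IsHomogeneous (d + 1)) (ξ : Eucl n) :
    (dirD ξ P).IsHomogeneous d :=
  MvPolynomial.IsHomogeneous.sum _ _ _ fun i _ => (isHomogeneous_pderiv h i).C_mul _

lemma lap_sum {ι : Type*} (s : Finset ι) (P : ι → Poly n) :
    lap (∑ i ∈ s, P i) = ∑ i ∈ s, lap (P i) := by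
  simp only [lap, map_sum]
  exact Finset.sum_comm

lemma lap_C_mul (c : ℝ) (P : Poly n) : lap (C c * P) = C c * lap P := by
  simp [lap, Finset.mul_sum]

lemma lap_mul (P Q : Poly n) :
    lap (P * Q) = P * lap Q + lap P * Q + 2 * ∑ i, pderiv i P * pderiv i Q := by
  simp only [lap, Finset.mul_sum, Finset.sum_mul, ← Finset.sum_add_distrib]
  refine Finset.sum_congr rfl fun i _ => ?_
  simp only [MvPolynomial.pderiv_mul, map_add]
  ring

lemma dirD_mul (ξ : Eucl n) (P Q : Poly n) : dirD ξ (P * Q) = P * dirD ξ Q + dirD ξ P * Q := by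
  simp only [dirD, Finset.mul_sum, Finset.sum_mul, ← Finset.sum_add_distrib]
  refine Finset.sum_congr rfl fun i _ => ?_
  simp only [MvPolynomial.pderiv_mul]
  ring

lemma dirD_sum (ξ : Eucl n) {ι : Type*} (s : Finset ι) (P : ι → Poly n) :
    dirD ξ (∑ i ∈ s, P i) = ∑ i ∈ s, dirD ξ (P i) := by
  simp only [dirD, map_sum, Finset.mul_sum]
  exact Finset.sum_comm

lemma dirD_lin (ξ : Eucl n) : dirD ξ (lin ξ) = C (‖ξ‖ ^ 2) := by
  rw [EuclideanSpace.norm_sq_eq]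
  simp [dirD, sq]

lemma lap_dirD (ξ : Eucl n) (P : Poly n) : lap (dirD ξ P) = dirD ξ (lap P) := by
  simp only [lap, dirD, map_sum, MvPolynomial.pderiv_C_mul, Finset.mul_sum]
  rw [Finset.sum_comm]
  refine Finset.sum_congr rfl fun i _ => Finset.sum_congr rfl fun j _ => ?_
  rw [pderiv_comm j i P, pderiv_comm j i]

lemma lap_lin_mul (ξ : Eucl n) (P : Poly n) : lap (lin ξ * P) = lin ξ * lap P + 2 * dirD ξ P := by
  have : lap (lin ξ) = 0 := by simp [lap]
  rw [lap_mul, this]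
  simp [dirD]

lemma lap_lin_sq_mul (ξ : Eucl n) (P : Poly n) : lap (lin ξ * (lin ξ * P))
    = lin ξ * (lin ξ * lap P) + 4 * (lin ξ * dirD ξ P) + 2 * (C (‖ξ‖ ^ 2) * P) := by
  rw [lap_lin_mul, lap_lin_mul, dirD_mul, dirD_lin]
  ring

end polynomials

/-! ### Moments, spherical averages and radial recursions. -/

section moments
variable {n : ℕ}

/-- The moment `∫ P(x) (ε² + |x|²)^{-m}`. -/
def mom (ε m : ℝ) (P : Poly n) : ℝ := ∫ x, pw (0 : Eucl n) ε P m x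

lemma mom_add {ε m : ℝ} (hε : 0 < ε) {P Q : Poly n} {d : ℕ} (hP : P.totalDegree ≤ d)
    (hQ : Q.totalDegree ≤ d) (hm : (d : ℝ) + n < 2 * m) :
    mom ε m (P + Q) = mom ε m P + mom ε m Q := by
  have hm0 : 0 ≤ m := by
    have : (0 : ℝ) ≤ d + n := by positivity
    linarith
  rw [mom, mom, mom, ← integral_add (pw_integrable 0 hε hP hm0 hm) (pw_integrable 0 hε hQ hm0 hm)]
  congr 1
  ext x
  simp [pw, add_mul]

lemma mom_C_mul (ε m c : ℝ) (P : Poly n) : mom ε m (C c * P) = c * mom ε m P := by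
  rw [mom, mom, ← integral_const_mul]
  congr 1
  ext x
  simp [pw, mul_assoc]

lemma mom_sum {ε m : ℝ} (hε : 0 < ε) {ι : Type*} (s : Finset ι) {P : ι → Poly n} {d : ℕ}
    (hd : ∀ i ∈ s, (P i).totalDegree ≤ d) (hm : (d : ℝ) + n < 2 * m) :
    mom ε m (∑ i ∈ s, P i) = ∑ i ∈ s, mom ε m (P i) :=
  integral_pw_sum s 0 hε hd hm

lemma mom_div {ε m : ℝ} (hε : 0 < ε) {G : Fin n → Poly n} {d : ℕ}
    (hd : ∀ i, (G i).totalDegree ≤ d + 1) (hm : (d : ℝ) + n < 2 * m) :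
    mom ε m (∑ i, pderiv i (G i)) = 2 * m * mom ε (m + 1) (∑ i, X i * G i) := by
  have := integral_pw_div (0 : Eucl n) hε hd hm
  simp only [shiftX_zero] at this
  exact this

lemma totalDegree_rsq_pow_mul_le (k : ℕ) {P : Poly n} {d : ℕ} (hd : P.totalDegree ≤ d) :
    (rsq n ^ k * P).totalDegree ≤ 2 * k + d := by
  refine totalDegree_mul_le ?_ hd
  rw [mul_comm]
  exact totalDegree_pow_le rsq_isHomogeneous.totalDegree_le k

/-- For P of degree e = d + 1 the field |x|²∇P - eP x is tangent to spheres, so radial weights are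
not differentiated and its divergence |x|²ΔP - e(e + n - 2)P has zero moment. This replaces
integration over spheres. -/
lemma mom_lap {ε m : ℝ} (hε : 0 < ε) {P : Poly n} {d k : ℕ} (hP : P.IsHomogeneous (d + 1))
    (hm : 2 * (k : ℝ) + (d + 1) + n < 2 * m) :
    mom ε m (rsq n ^ (k + 1) * lap P)
      = ((d : ℝ) + 1) * (d + n - 1) * mom ε m (rsq n ^ k * P) := by
  have hE : ∑ i, X i * pderiv i P = C ((d : ℝ) + 1) * P := by
    rw [hP.sum_X_mul_pderiv]; simp
  have hX : ∑ i : Fin n, (X i * X i : Poly n) = rsq n := by simp [rsq, sq]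
  have hPd : ∀ i, (pderiv i P).totalDegree ≤ d := fun i => (isHomogeneous_pderiv hP i).totalDegree_le
  set Z : Fin n → Poly n := fun i => rsq n * pderiv i P - C ((d : ℝ) + 1) * (X i * P) with hZ
  have hZd : ∀ i, (Z i).totalDegree ≤ d + 2 := by
    intro i
    refine (MvPolynomial.totalDegree_sub _ _).trans (max_le ?_ (totalDegree_C_mul_le _ ?_))
    · rw [add_comm]
      exact totalDegree_mul_le rsq_isHomogeneous.totalDegree_le (hPd i)
    · rw [show d + 2 = 1 + (d + 1) by ring]
      exact totalDegree_mul_le (by simp) hP.totalDegree_le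
  have key := mom_div hε (G := fun i => rsq n ^ k * Z i) (d := 2 * k + (d + 1)) (m := m)
    (fun i => totalDegree_rsq_pow_mul_le k (hZd i)) (by push_cast; linarith)
  have e1 : ∑ i, X i * (rsq n ^ k * Z i) = 0 := by
    have : ∀ i, X i * (rsq n ^ k * Z i) = rsq n ^ k * (rsq n * (X i * pderiv i P)
        - C ((d : ℝ) + 1) * ((X i * X i) * P)) := by
      intro i; rw [hZ]; ring
    simp only [this, ← Finset.mul_sum, Finset.sum_sub_distrib, ← Finset.sum_mul, hE, hX]
    ring
  have e2 : ∑ i, pderiv i (rsq n ^ k * Z i) = rsq n ^ (k + 1) * lap P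
      + C (-(((d : ℝ) + 1) * (d + n - 1))) * (rsq n ^ k * P) := by
    have h1 : ∑ i, X i * Z i = 0 := by
      have : ∀ i, X i * Z i = rsq n * (X i * pderiv i P)
        - C ((d : ℝ) + 1) * ((X i * X i) * P) := by
        intro i; rw [hZ]; ring
      simp only [this, ← Finset.mul_sum, Finset.sum_sub_distrib, ← Finset.sum_mul, hE, hX]
      ring
    have h2 : ∀ i, pderiv i (rsq n ^ k * Z i) = rsq n ^ k * pderiv i (Z i)
        + ((k : Poly n) * rsq n ^ (k - 1) * 2) * (X i * Z i) := by
      intro i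
      rw [MvPolynomial.pderiv_mul, MvPolynomial.pderiv_pow, pderiv_rsq]
      ring
    have h3 : ∀ i, pderiv i (Z i) = rsq n * pderiv i (pderiv i P) + 2 * (X i * pderiv i P)
        - C ((d : ℝ) + 1) * (P + X i * pderiv i P) := by
      intro i
      simp only [hZ, map_sub, MvPolynomial.pderiv_mul, pderiv_rsq, MvPolynomial.pderiv_C,
        MvPolynomial.pderiv_X_self]
      ring
    simp only [h2, h3, Finset.sum_add_distrib, Finset.sum_sub_distrib, ← Finset.mul_sum, h1, hE,
      Finset.sum_const, Finset.card_univ, Fintype.card_fin]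
    rw [lap]
    simp only [map_neg, map_mul, map_add, map_sub, map_one, map_natCast, nsmul_eq_mul]
    ring
  have hz : mom ε (m + 1) (0 : Poly n) = 0 := by simp [mom, pw]
  have hld : (lap P).totalDegree ≤ d - 1 := by
    refine MvPolynomial.totalDegree_finsetSum_le fun i _ => ?_
    exact totalDegree_pderiv_le i ((hPd i).trans (by omega))
  rw [e1, e2, hz, mul_zero] at key
  -- A linear P is treated apart: ΔP = 0, and the truncated bound d - 1 would not give the degree
  -- needed for integrability.
  rcases Nat.eq_zero_or_pos d with rfl | hd
  · have hl : lap P = 0 := by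
      refine Finset.sum_eq_zero fun i _ => ?_
      have := MvPolynomial.totalDegree_eq_zero_iff_eq_C.1 (Nat.le_zero.1 (hPd i))
      rw [this, MvPolynomial.pderiv_C]
    rw [hl, mul_zero, zero_add, mom_C_mul] at key
    rw [hl, mul_zero]
    have hz' : mom ε m (0 : Poly n) = 0 := by simp [mom, pw]
    rw [hz']
    linarith
  rw [mom_add hε (d := 2 * k + (d + 1)) ((totalDegree_rsq_pow_mul_le _ hld).trans (by omega))
    (totalDegree_C_mul_le _ (totalDegree_rsq_pow_mul_le _ hP.totalDegree_le))
    (by push_cast; linarith), mom_C_mul] at key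
  linarith

/-- The homogeneous polynomial `P` of degree `2j` has mean value `c` on the unit sphere, as seen
by the moments. -/
def HasAverage (P : Poly n) (j : ℕ) (c : ℝ) : Prop :=
  P.IsHomogeneous (2 * j) ∧ ∀ (ε m : ℝ) (k : ℕ), 0 < ε → 2 * ((k : ℝ) + j) + n < 2 * m →
    mom ε m (rsq n ^ k * P) = c * mom ε m (rsq n ^ (k + j))

lemma hasAverage_C (c : ℝ) : HasAverage (C c : Poly n) 0 c := by
  refine ⟨MvPolynomial.isHomogeneous_C _ _, fun ε m k _ _ => ?_⟩
  rw [mul_comm, mom_C_mul, add_zero]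

lemma HasAverage.C_mul {P : Poly n} {j : ℕ} {c : ℝ} (h : HasAverage P j c) (a : ℝ) :
    HasAverage (C a * P) j (a * c) := by
  refine ⟨h.1.C_mul a, fun ε m k hε hm => ?_⟩
  rw [mul_left_comm, mom_C_mul, h.2 ε m k hε hm]
  ring

lemma HasAverage.add {P Q : Poly n} {j : ℕ} {c d : ℝ} (h : HasAverage P j c)
    (h' : HasAverage Q j d) : HasAverage (P + Q) j (c + d) := by
  refine ⟨h.1.add h'.1, fun ε m k hε hm => ?_⟩
  rw [mul_add, mom_add hε (totalDegree_rsq_pow_mul_le k h.1.totalDegree_le)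
    (totalDegree_rsq_pow_mul_le k h'.1.totalDegree_le) (by push_cast; linarith),
    h.2 ε m k hε hm, h'.2 ε m k hε hm]
  ring

/-- The divisor is e(e + n - 2) with e = 2(j + 1), from `mom_lap`. Iteration reduces every average
to that of a constant. -/
lemma HasAverage.of_lap (hn : 0 < n) {P : Poly n} {j : ℕ} {c : ℝ}
    (hP : P.IsHomogeneous (2 * (j + 1))) (h : HasAverage (lap P) j c) :
    HasAverage P (j + 1) (c / (2 * (j + 1) * (2 * j + n))) := by
  refine ⟨hP, fun ε m k hε hm => ?_⟩
  have hn' : (0 : ℝ) < n := by exact_mod_cast hn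
  push_cast at hm
  have h1 := mom_lap hε (d := 2 * j + 1) (k := k) (m := m) hP (by push_cast; linarith)
  rw [h.2 ε m (k + 1) hε (by push_cast; linarith)] at h1
  push_cast at h1
  have h2 : (2 * ((j : ℝ) + 1) * (2 * j + n)) ≠ 0 := by positivity
  rw [div_mul_eq_mul_div, eq_div_iff h2, show k + (j + 1) = k + 1 + j by ring, h1]
  ring

/-- The radial moments. -/
lemma mom_rsq_succ {ε m : ℝ} (hε : 0 < ε) {k : ℕ} (hm : 2 * (k : ℝ) + n < 2 * m) :
    ((n : ℝ) + 2 * k) * mom ε m (rsq n ^ k) = 2 * m * mom ε (m + 1) (rsq n ^ (k + 1)) := by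
  have hd : ∀ i : Fin n, (rsq n ^ k * X i).totalDegree ≤ 2 * k + 1 := fun i =>
    totalDegree_rsq_pow_mul_le k (by simp)
  have key := mom_div hε (G := fun i => rsq n ^ k * X i) (d := 2 * k) (m := m) hd
    (by push_cast; linarith)
  have hX : ∑ i : Fin n, (X i * X i : Poly n) = rsq n := by simp [rsq, sq]
  have e1 : ∑ i, X i * (rsq n ^ k * X i) = rsq n ^ (k + 1) := by
    simp only [mul_left_comm _ (rsq n ^ k), ← Finset.mul_sum, hX, pow_succ]
  have e2 : ∑ i, pderiv i (rsq n ^ k * X i) = C ((n : ℝ) + 2 * k) * rsq n ^ k := by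
    have : ∀ i, pderiv i (rsq n ^ k * X i) = rsq n ^ k
        + ((k : Poly n) * rsq n ^ (k - 1) * 2) * (X i * X i) := by
      intro i
      rw [MvPolynomial.pderiv_mul, MvPolynomial.pderiv_pow, pderiv_rsq,
        MvPolynomial.pderiv_X_self]
      ring
    simp only [this, Finset.sum_add_distrib, ← Finset.mul_sum, hX, Finset.sum_const,
      Finset.card_univ, Fintype.card_fin, nsmul_eq_mul, map_add, map_mul, map_natCast]
    rw [show (C 2 : Poly n) = 2 from map_ofNat C 2]
    rcases k with _ | k
    · simp
    · simp [pow_succ]; ring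
  rw [e1, e2, mom_C_mul] at key
  exact key

lemma mom_split {ε m : ℝ} (hε : 0 < ε) {k : ℕ} (hm : 2 * (k : ℝ) + n < 2 * m) :
    mom ε m (rsq n ^ k) = ε ^ 2 * mom ε (m + 1) (rsq n ^ k)
      + mom ε (m + 1) (rsq n ^ (k + 1)) := by
  have e : mom ε m (rsq n ^ k) = mom ε (m + 1) (C (ε ^ 2) * rsq n ^ k + rsq n ^ (k + 1)) := by
    rw [mom, mom]
    congr 1
    ext x
    rw [pw, pw, weight_split 0 hε m x]
    simp
    ring
  rw [e, mom_add hε (d := 2 * (k + 1)), mom_C_mul]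
  · refine totalDegree_C_mul_le _ ?_
    simpa using (totalDegree_rsq_pow_mul_le k (P := (1 : Poly n)) (d := 0) (by simp)).trans
      (by omega)
  · simpa using totalDegree_rsq_pow_mul_le (k + 1) (P := (1 : Poly n)) (d := 0) (by simp)
  · push_cast; linarith

/-- Integration by parts relates m - 1 to m, and so does splitting off one factor of the weight;
eliminating the moment with exponent m - 1 leaves a recursion in k at fixed m. -/
lemma mom_rsq_step {m : ℝ} {k : ℕ} (hm : 2 * (k : ℝ) + n + 2 < 2 * m) :
    (2 * m - 2 - n - 2 * k) * mom 1 m (rsq n ^ (k + 1))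
      = ((n : ℝ) + 2 * k) * mom 1 m (rsq n ^ k) := by
  have h1 := mom_rsq_succ (n := n) one_pos (m := m - 1) (k := k) (by linarith)
  have h2 := mom_split (n := n) one_pos (m := m - 1) (k := k) (by linarith)
  rw [sub_add_cancel] at h1 h2
  rw [h2] at h1
  linarith

lemma mom_scale {ε m : ℝ} (hε : 0 < ε) (k : ℕ) :
    mom ε m (rsq n ^ k) = ε ^ ((n : ℝ) + 2 * k - 2 * m) * mom 1 m (rsq n ^ k) := by
  have h := Measure.integral_comp_smul (volume : Measure (Eucl n))
    (pw (0 : Eucl n) ε (rsq n ^ k) m) ε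
  have e : ∀ x : Eucl n, pw (0 : Eucl n) ε (rsq n ^ k) m (ε • x)
      = ε ^ (2 * (k : ℝ) - 2 * m) * pw (0 : Eucl n) 1 (rsq n ^ k) m x := by
    intro x
    have h1 : (0 : ℝ) < 1 + ‖x‖ ^ 2 := by positivity
    simp only [pw, map_pow, ev_rsq, sub_zero, norm_smul, Real.norm_of_nonneg hε.le]
    rw [show ε ^ 2 + (ε * ‖x‖) ^ 2 = ε ^ 2 * (1 + ‖x‖ ^ 2) by ring,
      Real.mul_rpow (by positivity) h1.le, show (2 : ℝ) * k - 2 * m = (2 : ℝ) * k + 2 * -m by ring,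
      Real.rpow_add hε, Real.rpow_mul hε.le, Real.rpow_mul hε.le, Real.rpow_ofNat,
      Real.rpow_natCast]
    ring_nf
  simp only [e, integral_const_mul, finrank_euclideanSpace, Fintype.card_fin, smul_eq_mul] at h
  rw [abs_of_pos (by positivity)] at h
  rw [mom, mom, show (n : ℝ) + 2 * k - 2 * m = n + (2 * k - 2 * m) by ring, Real.rpow_add hε,
    Real.rpow_natCast, mul_assoc, h]
  field_simp

/-- Moments of a radial polynomial times a polynomial with known average. -/
lemma HasAverage.mom_sum {P : Poly n} {j : ℕ} {a : ℝ} (h : HasAverage P j a) {ε m : ℝ}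
    (hε : 0 < ε) (c : ℕ → ℝ) (N : ℕ) (hm : 2 * ((N : ℝ) + j) + n < 2 * m) :
    mom ε m ((∑ k ∈ Finset.range (N + 1), C (c k) * rsq n ^ k) * P)
      = a * ∑ k ∈ Finset.range (N + 1), c k * mom ε m (rsq n ^ (k + j)) := by
  rw [Finset.sum_mul, YamabeBlowup.mom_sum hε _ (d := 2 * N + 2 * j), Finset.mul_sum]
  · refine Finset.sum_congr rfl fun k hk => ?_
    have hk' : (k : ℝ) ≤ N := by
      exact_mod_cast Nat.lt_succ_iff.1 (Finset.mem_range.1 hk)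
    rw [mul_assoc, mom_C_mul, h.2 ε m k hε (by linarith)]
    ring
  · intro k hk
    rw [mul_assoc]
    refine totalDegree_C_mul_le _ ((totalDegree_rsq_pow_mul_le k h.1.totalDegree_le).trans ?_)
    have := Finset.mem_range.1 hk
    omega
  · push_cast; linarith

end moments

/-! ### The polynomials |∂H|², |H|², |Hξ|² and their Laplacians. -/

section tensors
variable {n : ℕ} (W : Fin n → Fin n → Fin n → Fin n → ℝ)

/-- The symmetrized Weyl tensor `W_{ijkl} + W_{ilkj}`. -/
def symW (i j k l : Fin n) : ℝ := W i j k l + W i l k j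

/-- The polynomial `H_{ik}`. -/
def polyH (i k : Fin n) : Poly n := ∑ p, ∑ q, C (W i p k q) * (X p * X q)

/-- The linear polynomial `∂_l H_{ik}`. -/
def gradH (i k l : Fin n) : Poly n := ∑ q, C (symW W i l k q) * X q

/-- The polynomial `|∂H|²`. -/
def gradSq : Poly n := ∑ i, ∑ k, ∑ l, gradH W i k l * gradH W i k l

/-- The polynomial `|H|²`. -/
def normSq : Poly n := ∑ i, ∑ k, polyH W i k * polyH W i k

/-- The polynomial `∑_l (∑_i H_{il} ξ_i)²`. -/
def applySq (ξ : Eucl n) : Poly n :=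
  ∑ l, (∑ i, C (ξ i) * polyH W i l) * ∑ i, C (ξ i) * polyH W i l

/-- The squared norm of the symmetrized Weyl tensor. -/
def weylSq : ℝ := ∑ i, ∑ j, ∑ k, ∑ l, symW W i j k l ^ 2

@[simp] lemma ev_polyH (i k : Fin n) (x : Eucl n) : ev x (polyH W i k) = tensorH W i k x := by
  simp [polyH, tensorH, mul_assoc]

@[simp] lemma ev_gradH (i k l : Fin n) (x : Eucl n) :
    ev x (gradH W i k l) = ∑ q, symW W i l k q * x q := by
  simp [gradH]

lemma polyH_isHomogeneous (i k : Fin n) : (polyH W i k).IsHomogeneous 2 :=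
  MvPolynomial.IsHomogeneous.sum _ _ _ fun p _ => MvPolynomial.IsHomogeneous.sum _ _ _ fun q _ =>
    ((MvPolynomial.isHomogeneous_X ℝ p).mul (MvPolynomial.isHomogeneous_X ℝ q)).C_mul _

lemma gradH_isHomogeneous (i k l : Fin n) : (gradH W i k l).IsHomogeneous 1 :=
  MvPolynomial.IsHomogeneous.sum _ _ _ fun q _ => (MvPolynomial.isHomogeneous_X ℝ q).C_mul _

lemma gradSq_isHomogeneous : (gradSq W).IsHomogeneous 2 :=
  MvPolynomial.IsHomogeneous.sum _ _ _ fun i _ => MvPolynomial.IsHomogeneous.sum _ _ _ fun k _ =>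
    MvPolynomial.IsHomogeneous.sum _ _ _ fun l _ =>
      (gradH_isHomogeneous W i k l).mul (gradH_isHomogeneous W i k l)

lemma normSq_isHomogeneous : (normSq W).IsHomogeneous 4 :=
  MvPolynomial.IsHomogeneous.sum _ _ _ fun i _ => MvPolynomial.IsHomogeneous.sum _ _ _ fun k _ =>
    (polyH_isHomogeneous W i k).mul (polyH_isHomogeneous W i k)

lemma applySq_isHomogeneous (ξ : Eucl n) : (applySq W ξ).IsHomogeneous 4 := by
  refine MvPolynomial.IsHomogeneous.sum _ _ _ fun l _ => ?_
  have : (∑ i, C (ξ i) * polyH W i l).IsHomogeneous 2 :=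
    MvPolynomial.IsHomogeneous.sum _ _ _ fun i _ => (polyH_isHomogeneous W i l).C_mul _
  exact this.mul this

@[simp] lemma pderiv_polyH (i k l : Fin n) : pderiv l (polyH W i k) = gradH W i k l := by
  simp only [polyH, map_sum, MvPolynomial.pderiv_mul, MvPolynomial.pderiv_X, Pi.single_apply, gradH, symW, map_add, add_mul, mul_add,
    Finset.sum_add_distrib]
  rw [add_comm]
  simp [mul_comm]

@[simp] lemma pderiv_gradH (i k l m : Fin n) :
    pderiv m (gradH W i k l) = C (symW W i l k m) := by
  simp [gradH, MvPolynomial.pderiv_X, Pi.single_apply]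

variable {W}

lemma lap_mul_self_of_lap_eq_zero {P : Poly n} (h : lap P = 0) :
    lap (P * P) = 2 * ∑ i, pderiv i P * pderiv i P := by
  rw [lap_mul, h]; ring

lemma lap_gradH (i k l : Fin n) : lap (gradH W i k l) = 0 := by simp [lap]

lemma IsWeylTensor.lap_polyH (hW : IsWeylTensor W) (i k : Fin n) : lap (polyH W i k) = 0 := by
  simp only [lap, pderiv_polyH, pderiv_gradH, ← map_sum, symW, Finset.sum_add_distrib,
    hW.swap i _ k, hW.trace_free]
  simp

lemma IsWeylTensor.lap_normSq (hW : IsWeylTensor W) : lap (normSq W) = 2 * gradSq W := by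
  simp only [normSq, gradSq, lap_sum, lap_mul_self_of_lap_eq_zero (hW.lap_polyH _ _),
    pderiv_polyH, Finset.mul_sum]

lemma lap_gradSq : lap (gradSq W) = C (2 * weylSq W) := by
  simp only [gradSq, weylSq, lap_sum, lap_mul_self_of_lap_eq_zero (lap_gradH _ _ _),
    pderiv_gradH, Finset.mul_sum, map_sum, map_mul, map_pow]
  rw [show (C 2 : Poly n) = 2 from map_ofNat C 2]
  refine Finset.sum_congr rfl fun i _ => ?_
  rw [Finset.sum_comm]
  exact Finset.sum_congr rfl fun l _ => Finset.sum_congr rfl fun k _ =>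
    Finset.sum_congr rfl fun m _ => by ring

lemma dirD_dirD_gradSq (ξ : Eucl n) : dirD ξ (dirD ξ (gradSq W)) = C (2 * ev ξ (gradSq W)) := by
  have h1 : ∀ i k l, dirD ξ (gradH W i k l) = C (ev ξ (gradH W i k l)) := by
    intro i k l
    simp [dirD, gradH, MvPolynomial.pderiv_X, Pi.single_apply, mul_comm]
  have h2 : ∀ i k l, dirD ξ (dirD ξ (gradH W i k l * gradH W i k l))
      = C (2 * (ev ξ (gradH W i k l) * ev ξ (gradH W i k l))) := by
    intro i k l
    have e : dirD ξ (gradH W i k l * gradH W i k l)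
        = C (2 * ev ξ (gradH W i k l)) * gradH W i k l := by
      rw [dirD_mul, h1, map_mul, map_ofNat C 2]
      ring
    have z : dirD ξ (C (2 * ev ξ (gradH W i k l))) = 0 := by simp [dirD]
    rw [e, dirD_mul, h1, z, zero_mul, add_zero, ← map_mul, mul_assoc]
  simp only [gradSq, dirD_sum, h2, map_sum, map_mul, Finset.mul_sum]

/-- The cyclic shift moves the index contracted with ξ to the last place, where it is the variable
of the linear form `gradH`. -/
lemma IsWeylTensor.symW_swap (hW : IsWeylTensor W) (i m l r : Fin n) :
    symW W i m l r = symW W m l r i := by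
  rw [symW, symW, hW.swap i m l r, hW.pair_symm i r l m, hW.swap l m i r, add_comm]

/-- The entries of Hξ and their derivatives are harmonic, so each Laplacian only yields squares of
derivatives. After `symW_swap` these are the entries of ∂H evaluated at ξ, so |Hξ|² brings in no new
quadratic form in ξ. -/
lemma IsWeylTensor.lap_lap_applySq (hW : IsWeylTensor W) (ξ : Eucl n) :
    lap (lap (applySq W ξ)) = C (4 * ev ξ (gradSq W)) := by
  have z : ∀ l, lap (∑ i, C (ξ i) * polyH W i l) = 0 := by
    intro l; simp [lap_sum, lap_C_mul, hW.lap_polyH]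
  have h1 : lap (applySq W ξ) = C 2 * ∑ l, ∑ m,
      (∑ i, C (ξ i) * gradH W i l m) * ∑ i, C (ξ i) * gradH W i l m := by
    rw [applySq, lap_sum, Finset.mul_sum, map_ofNat C 2]
    refine Finset.sum_congr rfl fun l _ => ?_
    rw [lap_mul_self_of_lap_eq_zero (z l)]
    simp only [map_sum, MvPolynomial.pderiv_C_mul, pderiv_polyH]
  have z' : ∀ l m, lap (∑ i, C (ξ i) * gradH W i l m) = 0 := by
    intro l m; simp [lap_sum, lap_C_mul, lap_gradH]
  have e : ∀ l m r, pderiv r (∑ i, C (ξ i) * gradH W i l m)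
      = C (ev ξ (gradH W m r l)) := by
    intro l m r
    rw [ev_gradH]
    simp only [map_sum, MvPolynomial.pderiv_C_mul, pderiv_gradH, map_mul]
    exact Finset.sum_congr rfl fun i _ => by rw [hW.symW_swap i m l r, mul_comm]
  rw [h1, lap_C_mul, lap_sum]
  simp only [lap_sum, lap_mul_self_of_lap_eq_zero (z' _ _), e, ← map_mul, ← map_sum]
  rw [← map_ofNat C 2]
  simp only [← map_mul, ← map_sum, ← Finset.mul_sum, gradSq]
  congr 1
  rw [Finset.sum_comm]
  simp only [map_sum, map_mul]
  rw [← mul_assoc]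
  norm_num
  refine Finset.sum_congr rfl fun m _ => ?_
  rw [Finset.sum_comm]

end tensors

/-! ### Spherical averages. -/

section averages
variable {n : ℕ} {W : Fin n → Fin n → Fin n → Fin n → ℝ}

/-- One Laplacian already gives a constant. The longer products below repeat the argument, each
Laplacian being a sum of polynomials of known average. -/
lemma hasAverage_gradSq (hn : 0 < n) : HasAverage (gradSq W) 1 (weylSq W / n) := by
  have h := HasAverage.of_lap hn (j := 0) (P := gradSq W) (gradSq_isHomogeneous W)
    (by rw [lap_gradSq]; exact hasAverage_C _)
  convert h using 1
  push_cast
  field_simp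
  ring

lemma lin_sq_mul_isHomogeneous (ξ : Eucl n) {P : Poly n} {d : ℕ} (h : P.IsHomogeneous d) :
    (lin ξ * (lin ξ * P)).IsHomogeneous (d + 2) := by
  have := (lin_isHomogeneous ξ).mul ((lin_isHomogeneous ξ).mul h)
  rwa [show 1 + (1 + d) = d + 2 by ring] at this

lemma two_eq_C : (2 : Poly n) = C 2 := (map_ofNat C 2).symm
lemma four_eq_C : (4 : Poly n) = C 4 := (map_ofNat C 4).symm

lemma hasAverage_lin_sq (hn : 0 < n) (ξ : Eucl n) :
    HasAverage (lin ξ * lin ξ) 1 (‖ξ‖ ^ 2 / n) := by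
  have hl : lap (lin ξ * lin ξ) = C (2 * ‖ξ‖ ^ 2) := by
    have : lap (lin ξ) = 0 := by simp [lap]
    rw [lap_lin_mul, this, dirD_lin, two_eq_C, ← map_mul]
    simp
  have h := HasAverage.of_lap hn (j := 0) (P := lin ξ * lin ξ)
    ((lin_isHomogeneous ξ).mul (lin_isHomogeneous ξ)) (by rw [hl]; exact hasAverage_C _)
  convert h using 1
  push_cast
  field_simp
  ring

lemma hasAverage_lin_dirD_gradSq (hn : 0 < n) (ξ : Eucl n) :
    HasAverage (lin ξ * dirD ξ (gradSq W)) 1 (2 * ev ξ (gradSq W) / n) := by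
  have hl : lap (lin ξ * dirD ξ (gradSq W)) = C (4 * ev ξ (gradSq W)) := by
    have z : dirD ξ (C (2 * weylSq W)) = 0 := by simp [dirD]
    rw [lap_lin_mul, lap_dirD, lap_gradSq, dirD_dirD_gradSq, z, mul_zero, zero_add, two_eq_C,
      ← map_mul]
    congr 1; ring
  have h := HasAverage.of_lap hn (j := 0)
    ((lin_isHomogeneous ξ).mul (isHomogeneous_dirD (gradSq_isHomogeneous W) ξ))
    (by rw [hl]; exact hasAverage_C _)
  convert h using 1
  push_cast
  field_simp
  ring

/-- The average of `|∂H|² ⟨ξ, x⟩²`. -/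
lemma hasAverage_lin_sq_gradSq (hn : 0 < n) (ξ : Eucl n) :
    HasAverage (lin ξ * (lin ξ * gradSq W)) 2
      ((weylSq W * ‖ξ‖ ^ 2 + 2 * ev ξ (gradSq W)) / (n * (n + 2))) := by
  have hl : lap (lin ξ * (lin ξ * gradSq W)) = C (2 * weylSq W) * (lin ξ * lin ξ)
      + C 4 * (lin ξ * dirD ξ (gradSq W)) + C (2 * ‖ξ‖ ^ 2) * gradSq W := by
    rw [lap_lin_sq_mul, lap_gradSq, map_mul C 2 (‖ξ‖ ^ 2), ← two_eq_C, ← four_eq_C]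
    ring
  have h := HasAverage.of_lap hn (j := 1)
    (lin_sq_mul_isHomogeneous ξ (gradSq_isHomogeneous W))
    (by rw [hl]; exact (((hasAverage_lin_sq hn ξ).C_mul _).add
          ((hasAverage_lin_dirD_gradSq hn ξ).C_mul _)).add ((hasAverage_gradSq hn).C_mul _))
  convert h using 1
  have : (n : ℝ) ≠ 0 := by positivity
  push_cast
  field_simp
  ring

/-- The average of `|H|²`. -/
lemma IsWeylTensor.hasAverage_normSq (hW : IsWeylTensor W) (hn : 0 < n) :
    HasAverage (normSq W) 2 (weylSq W / (2 * n * (n + 2))) := by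
  have h := HasAverage.of_lap hn (j := 1) (normSq_isHomogeneous W)
    (by rw [hW.lap_normSq, two_eq_C]; exact (hasAverage_gradSq hn).C_mul 2)
  convert h using 1
  have : (n : ℝ) ≠ 0 := by positivity
  push_cast
  field_simp
  ring

lemma IsWeylTensor.hasAverage_lin_dirD_normSq (hW : IsWeylTensor W) (hn : 0 < n) (ξ : Eucl n) :
    HasAverage (lin ξ * dirD ξ (normSq W)) 2 (2 * ev ξ (gradSq W) / (n * (n + 2))) := by
  have d2 : ∀ P : Poly n, dirD ξ (2 * P) = 2 * dirD ξ P := by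
    intro P
    rw [dirD_mul, two_eq_C]
    simp [dirD]
  have l2 : ∀ P : Poly n, lap (2 * P) = 2 * lap P := fun P => by rw [two_eq_C, lap_C_mul]
  have hd2 : HasAverage (dirD ξ (dirD ξ (normSq W))) 1 (2 * ev ξ (gradSq W) / n) := by
    have hl : lap (dirD ξ (dirD ξ (normSq W))) = C (4 * ev ξ (gradSq W)) := by
      rw [lap_dirD, lap_dirD, hW.lap_normSq, d2, d2, dirD_dirD_gradSq, two_eq_C, ← map_mul]
      congr 1; ring
    have h := HasAverage.of_lap hn (j := 0)
      (isHomogeneous_dirD (isHomogeneous_dirD (normSq_isHomogeneous W) ξ) ξ)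
      (by rw [hl]; exact hasAverage_C _)
    convert h using 1
    push_cast
    field_simp
    ring
  have hl : lap (lin ξ * dirD ξ (normSq W)) = C 2 * (lin ξ * dirD ξ (gradSq W))
      + C 2 * dirD ξ (dirD ξ (normSq W)) := by
    rw [lap_lin_mul, lap_dirD, hW.lap_normSq, d2, ← two_eq_C]
    ring
  have h := HasAverage.of_lap hn (j := 1)
    ((lin_isHomogeneous ξ).mul (isHomogeneous_dirD (normSq_isHomogeneous W) ξ))
    (by rw [hl]; exact ((hasAverage_lin_dirD_gradSq hn ξ).C_mul 2).add (hd2.C_mul 2))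
  convert h using 1
  have : (n : ℝ) ≠ 0 := by positivity
  push_cast
  field_simp
  ring

/-- The average of `|H|² ⟨ξ, x⟩²`. -/
lemma IsWeylTensor.hasAverage_lin_sq_normSq (hW : IsWeylTensor W) (hn : 0 < n) (ξ : Eucl n) :
    HasAverage (lin ξ * (lin ξ * normSq W)) 3
      ((weylSq W * ‖ξ‖ ^ 2 / 2 + 2 * ev ξ (gradSq W)) / (n * (n + 2) * (n + 4))) := by
  have hl : lap (lin ξ * (lin ξ * normSq W)) = C 2 * (lin ξ * (lin ξ * gradSq W))
      + C 4 * (lin ξ * dirD ξ (normSq W)) + C (2 * ‖ξ‖ ^ 2) * normSq W := by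
    rw [lap_lin_sq_mul, hW.lap_normSq, map_mul C 2 (‖ξ‖ ^ 2), ← two_eq_C, ← four_eq_C]
    ring
  have h := HasAverage.of_lap hn (j := 2)
    (lin_sq_mul_isHomogeneous ξ (normSq_isHomogeneous W))
    (by rw [hl]; exact (((hasAverage_lin_sq_gradSq hn ξ).C_mul _).add
          ((hW.hasAverage_lin_dirD_normSq hn ξ).C_mul _)).add ((hW.hasAverage_normSq hn).C_mul _))
  convert h using 1
  have : (n : ℝ) ≠ 0 := by positivity
  push_cast
  field_simp
  ring

/-- The average of `∑_l (∑_i H_{il} ξ_i)²`. -/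
lemma IsWeylTensor.hasAverage_applySq (hW : IsWeylTensor W) (hn : 0 < n) (ξ : Eucl n) :
    HasAverage (applySq W ξ) 2 (ev ξ (gradSq W) / (2 * n * (n + 2))) := by
  have hd : (lap (applySq W ξ)).IsHomogeneous 2 :=
    MvPolynomial.IsHomogeneous.sum _ _ _ fun i _ =>
      isHomogeneous_pderiv (isHomogeneous_pderiv (applySq_isHomogeneous W ξ) i) i
  have h1 := HasAverage.of_lap hn (j := 0) hd
    (by rw [hW.lap_lap_applySq]; exact hasAverage_C _)
  have h := HasAverage.of_lap hn (j := 1) (applySq_isHomogeneous W ξ) h1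
  convert h using 1
  have : (n : ℝ) ≠ 0 := by positivity
  push_cast
  field_simp
  ring

end averages

/-! ### The integrands of F as polynomials times weights. -/

section energyDensity
variable {n : ℕ} {W : Fin n → Fin n → Fin n → Fin n → ℝ}

/-- The coefficients of `f²`. -/
def coeffF (τ : ℝ) : ℕ → ℝ
  | 0 => τ ^ 2
  | 1 => 10 * τ
  | 2 => 25 - 2 * τ
  | 3 => τ / 10 - 10
  | 4 => 3 / 2
  | 5 => -1 / 10
  | 6 => 1 / 400
  | _ => 0

/-- The coefficients of `8 f f' + 4 s f'²`. -/
def coeffG (τ : ℝ) : ℕ → ℝ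
  | 0 => 40 * τ
  | 1 => 300 - 16 * τ
  | 2 => 6 / 5 * τ - 200
  | 3 => 46
  | 4 => -22 / 5
  | 5 => 3 / 20
  | _ => 0

/-- The radial polynomial with coefficients `c`. -/
def radial (n : ℕ) (c : ℕ → ℝ) (N : ℕ) : Poly n := ∑ k ∈ Finset.range (N + 1), C (c k) * rsq n ^ k

/-- The polynomial `∑ (∂_l H̄_{ik})²`. -/
def densityPoly (τ : ℝ) (W : Fin n → Fin n → Fin n → Fin n → ℝ) : Poly n :=
  radial n (coeffF τ) 6 * gradSq W + radial n (coeffG τ) 5 * normSq W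

lemma ev_radial_coeffF (τ : ℝ) (x : Eucl n) :
    ev x (radial n (coeffF τ) 6) = profile τ (‖x‖ ^ 2) ^ 2 := by
  simp only [radial, Finset.sum_range_succ, Finset.sum_range_zero, coeffF, profile]
  simp only [map_add, map_zero, map_mul, map_pow, ev_rsq, MvPolynomial.eval_C]
  ring

lemma ev_radial_coeffG (τ : ℝ) (x : Eucl n) :
    ev x (radial n (coeffG τ) 5) = 8 * profile τ (‖x‖ ^ 2) *
      (5 - 2 * ‖x‖ ^ 2 + 3 / 20 * (‖x‖ ^ 2) ^ 2)
      + 4 * ‖x‖ ^ 2 * (5 - 2 * ‖x‖ ^ 2 + 3 / 20 * (‖x‖ ^ 2) ^ 2) ^ 2 := by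
  simp only [radial, Finset.sum_range_succ, Finset.sum_range_zero, coeffG, profile]
  simp only [map_add, map_zero, map_mul, map_pow, ev_rsq, MvPolynomial.eval_C]
  ring

lemma pd_tensorHBar (τ : ℝ) (i k l : Fin n) (x : Eucl n) :
    pd l (tensorHBar τ W i k) x = profile τ (‖x‖ ^ 2) * ev x (gradH W i k l)
      + 2 * (5 - 2 * ‖x‖ ^ 2 + 3 / 20 * (‖x‖ ^ 2) ^ 2) * x l * tensorH W i k x := by
  have e : tensorHBar τ W i k = fun y : Eucl n => ev y
      ((C τ + C 5 * rsq n - rsq n ^ 2 + C (1 / 20) * rsq n ^ 3) * polyH W i k) := by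
    ext y
    simp [tensorHBar, profile]
  rw [e, pd_ev]
  simp only [MvPolynomial.pderiv_mul, map_add, map_sub, MvPolynomial.pderiv_pow, pderiv_rsq,
    MvPolynomial.pderiv_C, pderiv_polyH]
  simp only [map_add, map_sub, map_mul, map_pow, ev_rsq, MvPolynomial.eval_C, ev_polyH,
    MvPolynomial.eval_X, profile, map_natCast, map_ofNat, map_zero]
  push_cast
  ring

/-- Since ∂_l H̄ = f ∂_l H + 2f' x_l H, the cross terms are evaluated by Euler's identity ∑ x_l ∂_l
H = 2H. This gives the factor 8ff' + 4sf'² in front of |H|². -/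
lemma ev_densityPoly (τ : ℝ) (x : Eucl n) :
    ∑ i, ∑ k, ∑ l, (pd l (tensorHBar τ W i k) x) ^ 2 = ev x (densityPoly τ W) := by
  have hE : ∀ i k, ∑ l, x l * ev x (gradH W i k l) = 2 * tensorH W i k x := by
    intro i k
    have := congrArg (ev x) (polyH_isHomogeneous W i k).sum_X_mul_pderiv
    simpa using this
  have hx : ∑ l, x l ^ 2 = ‖x‖ ^ 2 := by simp [EuclideanSpace.norm_sq_eq]
  have h1 : ∀ i k, ∑ l, (pd l (tensorHBar τ W i k) x) ^ 2
      = profile τ (‖x‖ ^ 2) ^ 2 * ∑ l, ev x (gradH W i k l) * ev x (gradH W i k l)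
      + (8 * profile τ (‖x‖ ^ 2) * (5 - 2 * ‖x‖ ^ 2 + 3 / 20 * (‖x‖ ^ 2) ^ 2)
      + 4 * ‖x‖ ^ 2 * (5 - 2 * ‖x‖ ^ 2 + 3 / 20 * (‖x‖ ^ 2) ^ 2) ^ 2)
        * (tensorH W i k x * tensorH W i k x) := by
    intro i k
    generalize hg : 5 - 2 * ‖x‖ ^ 2 + 3 / 20 * (‖x‖ ^ 2) ^ 2 = g
    have h2 : ∀ l, (pd l (tensorHBar τ W i k) x) ^ 2
        = profile τ (‖x‖ ^ 2) ^ 2 * (ev x (gradH W i k l) * ev x (gradH W i k l))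
        + 4 * profile τ (‖x‖ ^ 2) * g * tensorH W i k x * (x l * ev x (gradH W i k l))
        + 4 * g ^ 2 * tensorH W i k x ^ 2 * x l ^ 2 := by
      intro l
      rw [pd_tensorHBar, hg]
      ring
    simp only [h2, Finset.sum_add_distrib, ← Finset.mul_sum, hE, hx]
    ring
  simp only [h1]
  rw [densityPoly, map_add, map_mul, map_mul, ev_radial_coeffF, ev_radial_coeffG, gradSq, normSq]
  simp only [map_sum, map_mul, ev_polyH, Finset.sum_add_distrib, ← Finset.mul_sum]

lemma IsWeylTensor.sum_tensorH_self (hW : IsWeylTensor W) (l : Fin n) (x : Eucl n) :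
    ∑ i, tensorH W i l x * x i = 0 := by
  simp only [tensorH, Finset.sum_mul]
  have : ∀ i : Fin n, ∑ p, ∑ q, W i p l q * x p * x q * x i
      = ∑ q, (∑ p, W i p l q * x i * x p) * x q := by
    intro i
    rw [Finset.sum_comm]
    simp only [Finset.sum_mul]
    exact Finset.sum_congr rfl fun q _ => Finset.sum_congr rfl fun p _ => by ring
  simp only [this]
  rw [Finset.sum_comm]
  refine Finset.sum_eq_zero fun q _ => ?_
  rw [← Finset.sum_mul, hW.sum_left, zero_mul]

/-- The gradient of the bubble is a multiple of x - ξ, and H(x)x = 0 leaves -H(x)ξ. Two factors ξ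
therefore appear without any expansion. -/
lemma IsWeylTensor.gradient_term (hW : IsWeylTensor W) (τ : ℝ) (ξ : Eucl n) {ε : ℝ} (hε : 0 < ε)
    (x : Eucl n) :
    1 / 2 * ∑ i, ∑ k, ∑ l, tensorHBar τ W i l x * tensorHBar τ W k l x *
      pd i (bubble ξ ε) x * pd k (bubble ξ ε) x
      = 1 / 2 * ((n : ℝ) - 2) ^ 2 * ε ^ ((n : ℝ) - 2) *
        pw ξ ε (radial n (coeffF τ) 6 * applySq W ξ) n x := by
  have hD := weight_pos hε ξ x
  have hT : ∀ l, ∑ i, tensorH W i l x * (x i - ξ i) = - ∑ i, ξ i * tensorH W i l x := by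
    intro l
    simp only [mul_sub, Finset.sum_sub_distrib, hW.sum_tensorH_self, zero_sub]
    congr 1
    exact Finset.sum_congr rfl fun i _ => mul_comm _ _
  set c := -(((n : ℝ) - 2) * ε ^ (((n : ℝ) - 2) / 2)) with hc
  set w := (ε ^ 2 + ‖x - ξ‖ ^ 2) ^ (-((n : ℝ) / 2)) with hw
  have e1 : ∑ i, ∑ k, ∑ l, tensorHBar τ W i l x * tensorHBar τ W k l x *
      pd i (bubble ξ ε) x * pd k (bubble ξ ε) x
      = profile τ (‖x‖ ^ 2) ^ 2 * (c ^ 2 * w ^ 2) *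
        ∑ l, (∑ i, tensorH W i l x * (x i - ξ i)) * ∑ k, tensorH W k l x * (x k - ξ k) := by
    simp only [Finset.sum_mul_sum]
    simp only [Finset.mul_sum]
    conv_rhs => rw [Finset.sum_comm]
    refine Finset.sum_congr rfl fun i _ => ?_
    conv_rhs => rw [Finset.sum_comm]
    refine Finset.sum_congr rfl fun k _ => Finset.sum_congr rfl fun l _ => ?_
    rw [pd_bubble ξ hε, pd_bubble ξ hε]
    simp only [pw, ev_shiftX, tensorHBar, ← hc, ← hw]
    ring
  have hc2 : c ^ 2 = ((n : ℝ) - 2) ^ 2 * ε ^ ((n : ℝ) - 2) := by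
    rw [hc, neg_sq, mul_pow, ← Real.rpow_natCast (ε ^ (((n : ℝ) - 2) / 2)) 2, ← Real.rpow_mul hε.le]
    push_cast
    congr 2
    ring
  have hw2 : w ^ 2 = (ε ^ 2 + ‖x - ξ‖ ^ 2) ^ (-(n : ℝ)) := by
    rw [hw, ← Real.rpow_natCast, ← Real.rpow_mul hD.le]
    push_cast
    congr 1
    ring
  rw [e1, pw, map_mul, ev_radial_coeffF, applySq, hc2, hw2]
  simp only [hT, map_sum, map_mul, ev_polyH, MvPolynomial.eval_C]
  simp only [neg_mul_neg]
  ring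

lemma auxF_eq (hW : IsWeylTensor W) (τ : ℝ) (ξ : Eucl n) {ε : ℝ} (hε : 0 < ε) :
    auxF τ W ξ ε = 1 / 2 * ((n : ℝ) - 2) ^ 2 * ε ^ ((n : ℝ) - 2) *
        (∫ x, pw ξ ε (radial n (coeffF τ) 6 * applySq W ξ) n x)
      - ((n : ℝ) - 2) / (16 * ((n : ℝ) - 1)) * ε ^ ((n : ℝ) - 2) *
        (∫ x, pw ξ ε (densityPoly τ W) ((n : ℝ) - 2) x)
      + ∫ x, source τ W ξ ε x * correction τ W ξ ε x := by
  have e : ∀ x, bubble ξ ε x ^ 2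
      = ε ^ ((n : ℝ) - 2) * (ε ^ 2 + ‖x - ξ‖ ^ 2) ^ (-((n : ℝ) - 2)) := by
    intro x
    have hD := weight_pos hε ξ x
    rw [bubble, ← Real.rpow_natCast, ← Real.rpow_mul (by positivity), ← bubble_ratio_rpow ξ hε]
    push_cast
    congr 1
    ring
  rw [auxF]
  simp only [hW.gradient_term τ ξ hε, ev_densityPoly, e]
  rw [integral_const_mul]
  congr 2
  rw [← integral_const_mul]
  congr 1
  ext x
  rw [pw]
  ring

end energyDensity

/-! ### Expansion of translated weights. -/

section expansion
variable {n : ℕ}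

/-- Second order expansion of `(1 + t)^{-p}`. -/
lemma inv_one_add_pow_expansion (p : ℕ) : ∃ K : ℝ, 0 ≤ K ∧ ∀ t : ℝ, |t| ≤ 1 / 2 →
    |((1 + t) ^ p)⁻¹ - (1 - p * t + p * (p + 1) / 2 * t ^ 2)| ≤ K * |t| ^ 3 := by
  induction p with
  | zero => exact ⟨0, le_rfl, fun t _ => by simp⟩
  | succ p ih =>
    obtain ⟨K, hK, h⟩ := ih
    -- Dividing the expansion for p by 1 + t leaves the cubic term (p + 1)(p + 2)/2 t³; the factor 2
    -- bounds 1/(1 + t).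
    refine ⟨2 * (K + ((p : ℝ) + 1) * (p + 2) / 2), by positivity, fun t ht => ?_⟩
    have h1 : 1 / 2 ≤ 1 + t := by linarith [(abs_le.1 ht).1]
    have h0 : 0 < 1 + t := by linarith
    have e : ((1 + t) ^ (p + 1))⁻¹
        - (1 - ((p + 1 : ℕ) : ℝ) * t + ((p + 1 : ℕ) : ℝ) * (((p + 1 : ℕ) : ℝ) + 1) / 2 * t ^ 2)
        = ((((1 + t) ^ p)⁻¹ - (1 - p * t + p * (p + 1) / 2 * t ^ 2))
          - ((p : ℝ) + 1) * (p + 2) / 2 * t ^ 3) / (1 + t) := by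
      push_cast
      field_simp
      ring
    rw [e, abs_div, abs_of_pos h0, div_le_iff₀ h0]
    calc _ ≤ |((1 + t) ^ p)⁻¹ - (1 - p * t + p * (p + 1) / 2 * t ^ 2)|
          + |((p : ℝ) + 1) * (p + 2) / 2 * t ^ 3| := abs_sub _ _
      _ ≤ K * |t| ^ 3 + ((p : ℝ) + 1) * (p + 2) / 2 * |t| ^ 3 := by
          rw [abs_mul, abs_pow, abs_of_nonneg (by positivity : 0 ≤ ((p : ℝ) + 1) * (p + 2) / 2)]
          gcongr
          exact h t ht
      _ = 2 * (K + ((p : ℝ) + 1) * (p + 2) / 2) * |t| ^ 3 * (1 / 2) := by ring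
      _ ≤ _ := by gcongr

/-- The second quantity is the relative increment t of the weight under translation by ξ. The bound
8|ξ| explains the restriction |ξ| ≤ 1/16 below, which ensures |t| ≤ 1/2. -/
lemma weight_increment (ξ x : Eucl n) {ε : ℝ} (hξ : ‖ξ‖ ≤ 1) (hε : 1 / 2 ≤ ε) :
    |inner ℝ ξ x| ≤ 2 * ‖ξ‖ * (ε ^ 2 + ‖x‖ ^ 2) ∧
    |(-(2 * inner ℝ ξ x) + ‖ξ‖ ^ 2) / (ε ^ 2 + ‖x‖ ^ 2)| ≤ 8 * ‖ξ‖ := by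
  have hu : (1 / 4 : ℝ) + ‖x‖ ^ 2 ≤ ε ^ 2 + ‖x‖ ^ 2 := by nlinarith
  have hu0 : 0 < ε ^ 2 + ‖x‖ ^ 2 := by nlinarith [sq_nonneg ‖x‖]
  have hi := abs_real_inner_le_norm ξ x
  have hx : ‖x‖ ≤ 1 / 4 + ‖x‖ ^ 2 := by nlinarith [sq_nonneg (‖x‖ - 1 / 2)]
  have hξ0 := norm_nonneg ξ
  have h1 : |inner ℝ ξ x| ≤ ‖ξ‖ * (ε ^ 2 + ‖x‖ ^ 2) :=
    hi.trans (mul_le_mul_of_nonneg_left (hx.trans hu) hξ0)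
  refine ⟨by nlinarith [mul_nonneg hξ0 hu0.le], ?_⟩
  rw [abs_div, abs_of_pos hu0, div_le_iff₀ hu0]
  calc |-(2 * inner ℝ ξ x) + ‖ξ‖ ^ 2| ≤ |-(2 * inner ℝ ξ x)| + |‖ξ‖ ^ 2| := abs_add_le _ _
    _ = 2 * |inner ℝ ξ x| + ‖ξ‖ ^ 2 := by
      rw [abs_neg, abs_mul, abs_of_nonneg (sq_nonneg ‖ξ‖)]; norm_num
    _ ≤ 2 * (‖ξ‖ * (ε ^ 2 + ‖x‖ ^ 2)) + ‖ξ‖ * (4 * (ε ^ 2 + ‖x‖ ^ 2)) := by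
      gcongr
      rw [sq]
      gcongr
      nlinarith [sq_nonneg ‖x‖]
    _ ≤ _ := by nlinarith [mul_nonneg hξ0 hu0.le]

lemma weight_eq_mul (ξ x : Eucl n) {ε : ℝ} (hε : 0 < ε) :
    ε ^ 2 + ‖x - ξ‖ ^ 2 = (ε ^ 2 + ‖x‖ ^ 2) *
      (1 + (-(2 * inner ℝ ξ x) + ‖ξ‖ ^ 2) / (ε ^ 2 + ‖x‖ ^ 2)) := by
  have hu0 : 0 < ε ^ 2 + ‖x‖ ^ 2 := by positivity
  rw [norm_sub_sq_real, real_inner_comm]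
  field_simp
  ring

/-- Upper bound for a translated weight to second order in the translation. -/
lemma exists_weight_le (p : ℕ) : ∃ K : ℝ, 0 ≤ K ∧ ∀ (ξ : Eucl n) (ε : ℝ), ‖ξ‖ ≤ 1 / 16 →
    1 / 2 ≤ ε → ∀ x : Eucl n, (ε ^ 2 + ‖x - ξ‖ ^ 2) ^ (-(p : ℝ)) ≤
      (ε ^ 2 + ‖x‖ ^ 2) ^ (-(p : ℝ)) * (1 + 2 * p * (inner ℝ ξ x / (ε ^ 2 + ‖x‖ ^ 2))
        - p * ‖ξ‖ ^ 2 / (ε ^ 2 + ‖x‖ ^ 2)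
        + 2 * p * (p + 1) * (inner ℝ ξ x / (ε ^ 2 + ‖x‖ ^ 2)) ^ 2 + K * ‖ξ‖ ^ 3) := by
  obtain ⟨K, hK, h⟩ := inv_one_add_pow_expansion p
  -- With t = -2l + s, 512 = 8³ comes from |t|³, and 48 = 32 + 16 bounds the parts -4ls and s² of
  -- t², which are of third order or higher.
  refine ⟨K * 512 + (p : ℝ) * (p + 1) / 2 * 48, by positivity, fun ξ ε hξ hε x => ?_⟩
  have hε0 : 0 < ε := by linarith
  have hu0 : 0 < ε ^ 2 + ‖x‖ ^ 2 := by positivity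
  have hu4 : (1 / 4 : ℝ) ≤ ε ^ 2 + ‖x‖ ^ 2 := by nlinarith [sq_nonneg ‖x‖]
  obtain ⟨hi, ht⟩ := weight_increment ξ x (by linarith) hε
  rw [weight_eq_mul ξ x hε0]
  set u := ε ^ 2 + ‖x‖ ^ 2 with hu
  set t := (-(2 * inner ℝ ξ x) + ‖ξ‖ ^ 2) / u with htd
  have ht2 : |t| ≤ 1 / 2 := by linarith
  have h1 : 0 < 1 + t := by linarith [(abs_le.1 ht2).1]
  rw [Real.mul_rpow hu0.le h1.le]
  refine mul_le_mul_of_nonneg_left ?_ (by positivity)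
  rw [Real.rpow_neg h1.le, Real.rpow_natCast]
  have hexp := (abs_le.1 (h t ht2)).2
  have ht3 : |t| ^ 3 ≤ (8 * ‖ξ‖) ^ 3 := by gcongr
  set l := inner ℝ ξ x / u with hl
  have hl2 : |l| ≤ 2 * ‖ξ‖ := by
    rw [hl, abs_div, abs_of_pos hu0, div_le_iff₀ hu0]
    linarith
  set s := ‖ξ‖ ^ 2 / u with hs
  have hs0 : 0 ≤ s := by positivity
  have hs4 : s ≤ 4 * ‖ξ‖ ^ 2 := by
    rw [hs, div_le_iff₀ hu0]
    nlinarith [sq_nonneg ‖ξ‖]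
  have hts : t = -(2 * l) + s := by rw [htd, hl, hs]; ring
  have hcross : -(4 * l * s) + s ^ 2 ≤ 48 * ‖ξ‖ ^ 3 := by
    have h2 : -(l * s) ≤ 2 * ‖ξ‖ * (4 * ‖ξ‖ ^ 2) := by
      calc -(l * s) ≤ |l| * s := by
            rw [← neg_mul]; exact mul_le_mul_of_nonneg_right (neg_le_abs l) hs0
        _ ≤ _ := by gcongr
    have h3 : s ^ 2 ≤ (4 * ‖ξ‖ ^ 2) * (4 * ‖ξ‖ ^ 2) := by rw [sq]; gcongr
    have h4 : ‖ξ‖ ^ 4 ≤ ‖ξ‖ ^ 3 := pow_le_pow_of_le_one (norm_nonneg _) (by linarith) (by norm_num)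
    nlinarith
  have h5 : (p : ℝ) * (p + 1) / 2 * (-(4 * l * s) + s ^ 2)
      ≤ (p : ℝ) * (p + 1) / 2 * (48 * ‖ξ‖ ^ 3) := by gcongr
  have h6 : K * |t| ^ 3 ≤ K * (8 * ‖ξ‖) ^ 3 := by gcongr
  have h7 : (p : ℝ) * ‖ξ‖ ^ 2 / u = p * s := by rw [hs]; ring
  rw [h7]
  rw [hts] at hexp h6 ⊢
  nlinarith

/-- First order suffices, as this is applied to an integrand already quadratic in ξ. It follows from
(1 + t)^m ≤ e^(mt) and e^(-mt) ≥ 1 - mt. -/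
lemma weight_ge (m : ℕ) (ξ x : Eucl n) {ε : ℝ} (hξ : ‖ξ‖ ≤ 1 / 16) (hε : 1 / 2 ≤ ε) :
    (ε ^ 2 + ‖x‖ ^ 2) ^ (-(m : ℝ)) * (1 - 8 * m * ‖ξ‖) ≤ (ε ^ 2 + ‖x - ξ‖ ^ 2) ^ (-(m : ℝ)) := by
  have hε0 : 0 < ε := by linarith
  have hu0 : 0 < ε ^ 2 + ‖x‖ ^ 2 := by positivity
  obtain ⟨-, ht⟩ := weight_increment ξ x (by linarith) hε
  rw [weight_eq_mul ξ x hε0]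
  set u := ε ^ 2 + ‖x‖ ^ 2 with hu
  set t := (-(2 * inner ℝ ξ x) + ‖ξ‖ ^ 2) / u with htd
  have ht2 : |t| ≤ 1 / 2 := by linarith
  have h1 : 0 < 1 + t := by linarith [(abs_le.1 ht2).1]
  rw [Real.mul_rpow hu0.le h1.le]
  refine mul_le_mul_of_nonneg_left ?_ (by positivity)
  have h2 : Real.exp (-(m * t)) ≤ (1 + t) ^ (-(m : ℝ)) := by
    rw [Real.rpow_neg h1.le, Real.rpow_natCast, Real.exp_neg]
    refine inv_anti₀ (by positivity) ?_
    calc (1 + t) ^ m ≤ Real.exp t ^ m := by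
          gcongr; rw [add_comm]; exact Real.add_one_le_exp t
      _ = _ := (Real.exp_nat_mul t m).symm
  refine le_trans ?_ h2
  have h3 := Real.add_one_le_exp (-(m * t))
  have h4 : (m : ℝ) * t ≤ m * (8 * ‖ξ‖) := by gcongr; exact (le_abs_self t).trans ht
  linarith

/-- By parity; this removes the term linear in ξ from the expansion. -/
lemma mom_lin_mul_eq_zero (ε m : ℝ) (ξ : Eucl n) {P : Poly n} (hP : ∀ x, ev (-x) P = ev x P) :
    mom ε m (lin ξ * P) = 0 := by
  have h := integral_neg_eq_self (pw (0 : Eucl n) ε (lin ξ * P) m) volume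
  have e : ∀ x, pw (0 : Eucl n) ε (lin ξ * P) m (-x) = - pw (0 : Eucl n) ε (lin ξ * P) m x := by
    intro x
    simp only [pw, map_mul, ev_lin, hP, inner_neg_right, sub_zero, norm_neg]
    ring
  simp only [e, integral_neg] at h
  rw [mom]
  linarith

/-- Second order upper bound for the moments of a translated weight. -/
lemma exists_integral_pw_le {p d : ℕ} (hd : d + n < 2 * p) {P : Poly n} (hP : P.totalDegree ≤ d)
    (hP0 : ∀ x, 0 ≤ ev x P) (hPe : ∀ x, ev (-x) P = ev x P) :
    ∃ K : ℝ, 0 ≤ K ∧ ∀ (ξ : Eucl n) (ε : ℝ), ‖ξ‖ ≤ 1 / 16 → 1 / 2 ≤ ε →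
      ∫ x, pw ξ ε P p x ≤ mom ε p P - p * ‖ξ‖ ^ 2 * mom ε (p + 1) P
        + 2 * p * (p + 1) * mom ε (p + 2) (lin ξ * (lin ξ * P)) + K * ‖ξ‖ ^ 3 := by
  obtain ⟨K, hK, h⟩ := exists_weight_le (n := n) p
  have hd' : (d : ℝ) + n < 2 * p := by exact_mod_cast hd
  have hp0 : (0 : ℝ) ≤ p := by positivity
  have hlin : ∀ ξ : Eucl n, (lin ξ).totalDegree ≤ 1 := fun ξ => (lin_isHomogeneous ξ).totalDegree_le
  -- The weight at ε = 1/2 dominates those with ε ≥ 1/2, so the remainder is uniform in ε.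
  refine ⟨K * mom (1 / 2) p P, ?_, fun ξ ε hξ hε => ?_⟩
  · refine mul_nonneg hK (integral_nonneg fun x => ?_)
    have := hP0 x
    have := weight_pos (show (0 : ℝ) < 1 / 2 by norm_num) 0 x
    rw [pw]
    positivity
  have hε0 : 0 < ε := by linarith
  have i0 : Integrable (pw (0 : Eucl n) ε P p) := pw_integrable 0 hε0 hP hp0 hd'
  have i0' : Integrable (pw (0 : Eucl n) (1 / 2) P p) :=
    pw_integrable 0 (by norm_num) hP hp0 hd'
  have i1 : Integrable (pw (0 : Eucl n) ε (lin ξ * P) ((p : ℝ) + 1)) :=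
    pw_integrable 0 hε0 (totalDegree_mul_le (hlin ξ) hP) (by linarith) (by push_cast; linarith)
  have i2 : Integrable (pw (0 : Eucl n) ε P ((p : ℝ) + 1)) :=
    pw_integrable 0 hε0 hP (by linarith) (by linarith)
  have i3 : Integrable (pw (0 : Eucl n) ε (lin ξ * (lin ξ * P)) ((p : ℝ) + 2)) :=
    pw_integrable 0 hε0 (totalDegree_mul_le (hlin ξ) (totalDegree_mul_le (hlin ξ) hP))
      (by linarith) (by push_cast; linarith)
  have hpt : ∀ x, pw ξ ε P p x ≤ (pw 0 ε P p x + 2 * p * pw 0 ε (lin ξ * P) ((p : ℝ) + 1) x)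
      + (2 * p * (p + 1) * pw 0 ε (lin ξ * (lin ξ * P)) ((p : ℝ) + 2) x
        - p * ‖ξ‖ ^ 2 * pw 0 ε P ((p : ℝ) + 1) x)
      + K * ‖ξ‖ ^ 3 * pw 0 (1 / 2) P p x := by
    intro x
    have hu0 : 0 < ε ^ 2 + ‖x‖ ^ 2 := by positivity
    have h1 := mul_le_mul_of_nonneg_left (h ξ ε hξ hε x) (hP0 x)
    have hw : (ε ^ 2 + ‖x‖ ^ 2) ^ (-(p : ℝ)) ≤ ((1 / 2 : ℝ) ^ 2 + ‖x‖ ^ 2) ^ (-(p : ℝ)) :=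
      Real.rpow_le_rpow_of_nonpos (by positivity) (by gcongr) (by linarith)
    have h2 : K * ‖ξ‖ ^ 3 * (ev x P * (ε ^ 2 + ‖x‖ ^ 2) ^ (-(p : ℝ)))
        ≤ K * ‖ξ‖ ^ 3 * (ev x P * ((1 / 2 : ℝ) ^ 2 + ‖x‖ ^ 2) ^ (-(p : ℝ))) := by
      have := hP0 x
      gcongr
    have e1 : (ε ^ 2 + ‖x‖ ^ 2) ^ (-((p : ℝ) + 1))
        = (ε ^ 2 + ‖x‖ ^ 2) ^ (-(p : ℝ)) / (ε ^ 2 + ‖x‖ ^ 2) := by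
      rw [neg_add, Real.rpow_add hu0, Real.rpow_neg_one, div_eq_mul_inv]
    have e2 : (ε ^ 2 + ‖x‖ ^ 2) ^ (-((p : ℝ) + 2))
        = (ε ^ 2 + ‖x‖ ^ 2) ^ (-(p : ℝ)) / (ε ^ 2 + ‖x‖ ^ 2) ^ 2 := by
      rw [neg_add, Real.rpow_add hu0, Real.rpow_neg hu0.le 2, Real.rpow_ofNat, div_eq_mul_inv]
    simp only [pw, map_mul, ev_lin, sub_zero, e1, e2]
    generalize ε ^ 2 + ‖x‖ ^ 2 = u at *
    calc _ ≤ _ := h1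
      _ = ev x P * u ^ (-(p : ℝ)) + 2 * p * (inner ℝ ξ x * ev x P *
            (u ^ (-(p : ℝ)) / u))
          + (2 * p * (p + 1) * (inner ℝ ξ x * (inner ℝ ξ x * ev x P) *
            (u ^ (-(p : ℝ)) / u ^ 2))
            - p * ‖ξ‖ ^ 2 * (ev x P * (u ^ (-(p : ℝ)) / u)))
          + K * ‖ξ‖ ^ 3 * (ev x P * u ^ (-(p : ℝ))) := by ring
      _ ≤ _ := by linarith
  have j1 := i0.add (i1.const_mul (2 * p))
  have j2 := (i3.const_mul (2 * p * (p + 1))).sub (i2.const_mul (p * ‖ξ‖ ^ 2))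
  have j3 := i0'.const_mul (K * ‖ξ‖ ^ 3)
  have hint := integral_mono (pw_integrable ξ hε0 hP hp0 hd') ((j1.add j2).add j3) hpt
  refine hint.trans (le_of_eq ?_)
  have a1 := integral_add (j1.add j2) j3
  have a2 := integral_add j1 j2
  have a3 := integral_add i0 (i1.const_mul (2 * p))
  have a4 := integral_sub (i3.const_mul (2 * p * (p + 1))) (i2.const_mul (p * ‖ξ‖ ^ 2))
  simp only [Pi.add_apply, Pi.sub_apply, integral_const_mul] at a1 a2 a3 a4 ⊢
  rw [a1, a2, a3, a4]
  have z := mom_lin_mul_eq_zero ε ((p : ℝ) + 1) ξ hPe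
  simp only [mom] at z ⊢
  rw [z]
  ring

/-- Lower bound for the moments of a translated weight. -/
lemma integral_pw_ge {m d : ℕ} (hd : d + n < 2 * m) {P : Poly n} (hP : P.totalDegree ≤ d)
    (hP0 : ∀ x, 0 ≤ ev x P) {ξ : Eucl n} {ε : ℝ} (hξ : ‖ξ‖ ≤ 1 / 16) (hε : 1 / 2 ≤ ε) :
    (1 - 8 * m * ‖ξ‖) * mom ε m P ≤ ∫ x, pw ξ ε P m x := by
  have hε0 : 0 < ε := by linarith
  have hd' : (d : ℝ) + n < 2 * m := by exact_mod_cast hd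
  have hm0 : (0 : ℝ) ≤ m := by positivity
  rw [mom, ← integral_const_mul]
  refine integral_mono ((pw_integrable 0 hε0 hP hm0 hd').const_mul _)
    (pw_integrable ξ hε0 hP hm0 hd') fun x => ?_
  have := mul_le_mul_of_nonneg_left (weight_ge m ξ x hξ hε) (hP0 x)
  simp only [pw, sub_zero]
  linarith

end expansion

/-! ### Second-order lower bound for F. -/

section energyExpansion
variable {n : ℕ} {W : Fin n → Fin n → Fin n → Fin n → ℝ}

/-- The weighted sum `∑ c_k ∫ |x|^{2(k+j)} (ε² + |x|²)^{-m}`. -/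
def radMom (n : ℕ) (c : ℕ → ℝ) (N : ℕ) (ε m : ℝ) (j : ℕ) : ℝ :=
  ∑ k ∈ Finset.range (N + 1), c k * mom ε m (rsq n ^ (k + j))

lemma totalDegree_radial_le (c : ℕ → ℝ) (N : ℕ) : (radial n c N).totalDegree ≤ 2 * N := by
  refine MvPolynomial.totalDegree_finsetSum_le fun k hk => totalDegree_C_mul_le _ ?_
  have h := totalDegree_pow_le (rsq_isHomogeneous (n := n)).totalDegree_le k
  have := Finset.mem_range.1 hk
  omega

lemma HasAverage.mom_radial {P : Poly n} {j : ℕ} {a : ℝ} (h : HasAverage P j a) {ε m : ℝ}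
    (hε : 0 < ε) (c : ℕ → ℝ) (N : ℕ) (hm : 2 * ((N : ℝ) + j) + n < 2 * m) :
    mom ε m (radial n c N * P) = a * radMom n c N ε m j :=
  h.mom_sum hε c N hm

lemma totalDegree_densityPoly_le (τ : ℝ) : (densityPoly τ W).totalDegree ≤ 14 :=
  (MvPolynomial.totalDegree_add _ _).trans (max_le
    (totalDegree_mul_le (totalDegree_radial_le _ _) (gradSq_isHomogeneous W).totalDegree_le)
    (totalDegree_mul_le (totalDegree_radial_le _ _) (normSq_isHomogeneous W).totalDegree_le))

lemma totalDegree_radial_mul_applySq_le (τ : ℝ) (ξ : Eucl n) :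
    (radial n (coeffF τ) 6 * applySq W ξ).totalDegree ≤ 16 :=
  totalDegree_mul_le (totalDegree_radial_le _ _) (applySq_isHomogeneous W ξ).totalDegree_le

lemma ev_densityPoly_nonneg (τ : ℝ) (x : Eucl n) : 0 ≤ ev x (densityPoly τ W) := by
  rw [← ev_densityPoly]
  positivity

lemma ev_radial_mul_applySq_nonneg (τ : ℝ) (ξ x : Eucl n) :
    0 ≤ ev x (radial n (coeffF τ) 6 * applySq W ξ) := by
  rw [map_mul, ev_radial_coeffF, applySq, map_sum]
  refine mul_nonneg (sq_nonneg _) (Finset.sum_nonneg fun l _ => ?_)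
  rw [map_mul]
  exact mul_self_nonneg _

lemma ev_gradSq_nonneg (x : Eucl n) : 0 ≤ ev x (gradSq W) := by
  simp only [gradSq, map_sum, map_mul]
  exact Finset.sum_nonneg fun i _ => Finset.sum_nonneg fun k _ => Finset.sum_nonneg fun l _ =>
    mul_self_nonneg _

lemma ev_densityPoly_neg (τ : ℝ) (x : Eucl n) :
    ev (-x) (densityPoly τ W) = ev x (densityPoly τ W) := by
  rw [densityPoly, map_add, map_mul, map_mul, ev_radial_coeffF, ev_radial_coeffG]
  rw [map_add, map_mul, map_mul, ev_radial_coeffF, ev_radial_coeffG, norm_neg]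
  simp [gradSq, normSq, tensorH]

lemma IsWeylTensor.mom_densityPoly (hW : IsWeylTensor W) (hn : 0 < n) (τ : ℝ) {ε m : ℝ}
    (hε : 0 < ε) (hm : 14 + (n : ℝ) < 2 * m) :
    mom ε m (densityPoly τ W) = weylSq W / n * radMom n (coeffF τ) 6 ε m 1
      + weylSq W / (2 * n * (n + 2)) * radMom n (coeffG τ) 5 ε m 2 := by
  rw [densityPoly, mom_add hε (d := 14)
    (totalDegree_mul_le (totalDegree_radial_le _ _) (gradSq_isHomogeneous W).totalDegree_le)
    (totalDegree_mul_le (totalDegree_radial_le _ _) (normSq_isHomogeneous W).totalDegree_le)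
    (by exact_mod_cast hm), (hasAverage_gradSq hn).mom_radial hε _ _ (by push_cast; linarith),
    (hW.hasAverage_normSq hn).mom_radial hε _ _ (by push_cast; linarith)]

lemma IsWeylTensor.mom_lin_sq_densityPoly (hW : IsWeylTensor W) (hn : 0 < n) (τ : ℝ) (ξ : Eucl n)
    {ε m : ℝ} (hε : 0 < ε) (hm : 16 + (n : ℝ) < 2 * m) :
    mom ε m (lin ξ * (lin ξ * densityPoly τ W))
      = (weylSq W * ‖ξ‖ ^ 2 + 2 * ev ξ (gradSq W)) / (n * (n + 2))
          * radMom n (coeffF τ) 6 ε m 2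
        + (weylSq W * ‖ξ‖ ^ 2 / 2 + 2 * ev ξ (gradSq W)) / (n * (n + 2) * (n + 4))
          * radMom n (coeffG τ) 5 ε m 3 := by
  have e : lin ξ * (lin ξ * densityPoly τ W)
      = radial n (coeffF τ) 6 * (lin ξ * (lin ξ * gradSq W))
        + radial n (coeffG τ) 5 * (lin ξ * (lin ξ * normSq W)) := by
    rw [densityPoly]; ring
  rw [e, mom_add hε (d := 16)
    (totalDegree_mul_le (totalDegree_radial_le _ _)
      (lin_sq_mul_isHomogeneous ξ (gradSq_isHomogeneous W)).totalDegree_le)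
    (totalDegree_mul_le (totalDegree_radial_le _ _)
      (lin_sq_mul_isHomogeneous ξ (normSq_isHomogeneous W)).totalDegree_le)
    (by exact_mod_cast hm),
    (hasAverage_lin_sq_gradSq hn ξ).mom_radial hε _ _ (by push_cast; linarith),
    (hW.hasAverage_lin_sq_normSq hn ξ).mom_radial hε _ _ (by push_cast; linarith)]

/-- The leading term of the energy. -/
def energyZero (τ : ℝ) (W : Fin n → Fin n → Fin n → Fin n → ℝ) (ε : ℝ) : ℝ :=
  -(((n : ℝ) - 2) / (16 * ((n : ℝ) - 1)) * ε ^ ((n : ℝ) - 2) *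
    mom ε ((n : ℝ) - 2) (densityPoly τ W))

/-- The coefficient of `‖ξ‖²` in the second order expansion of the energy. -/
def normCoeff (n : ℕ) (τ ε : ℝ) : ℝ :=
  ((n : ℝ) - 2) / (16 * ((n : ℝ) - 1)) * ε ^ ((n : ℝ) - 2) *
    (((n : ℝ) - 2) * (radMom n (coeffF τ) 6 ε ((n : ℝ) - 1) 1 / n
        + radMom n (coeffG τ) 5 ε ((n : ℝ) - 1) 2 / (2 * n * (n + 2)))
      - 2 * ((n : ℝ) - 2) * ((n : ℝ) - 1) * (radMom n (coeffF τ) 6 ε n 2 / (n * (n + 2))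
        + radMom n (coeffG τ) 5 ε n 3 / (2 * n * (n + 2) * (n + 4))))

/-- The contribution of the first integral to the coefficient of `|∂H(ξ)|²`. -/
def gradCoeffPos (n : ℕ) (τ ε : ℝ) : ℝ :=
  1 / 2 * ((n : ℝ) - 2) ^ 2 * ε ^ ((n : ℝ) - 2) *
    (radMom n (coeffF τ) 6 ε n 2 / (2 * n * (n + 2)))

/-- The contribution of the second integral to the coefficient of `|∂H(ξ)|²`. -/
def gradCoeffNeg (n : ℕ) (τ ε : ℝ) : ℝ :=
  ((n : ℝ) - 2) / (16 * ((n : ℝ) - 1)) * ε ^ ((n : ℝ) - 2) *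
    (4 * ((n : ℝ) - 2) * ((n : ℝ) - 1) * (radMom n (coeffF τ) 6 ε n 2 / (n * (n + 2))
        + radMom n (coeffG τ) 5 ε n 3 / (n * (n + 2) * (n + 4))))

/-- At ξ = 0 the first integrand vanishes, and the fourth-order bound kills the correction energy.
-/
lemma IsWeylTensor.auxF_zero (hn : 19 ≤ n) (hW : IsWeylTensor W) (τ : ℝ) :
    auxF τ W 0 1 = energyZero τ W 1 := by
  obtain ⟨K, -, h⟩ := hW.abs_correction_energy_le hn τ
  have h0 := h 0 1 (by simp) (by norm_num) (by norm_num)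
  have z := abs_nonpos_iff.1 (h0.trans (by simp))
  have e : applySq W 0 = 0 := by simp [applySq]
  rw [auxF_eq hW τ 0 one_pos, z, e, energyZero, mom]
  simp [pw]

/-- Second order lower bound for the energy. -/
lemma IsWeylTensor.exists_le_auxF (hn : 19 ≤ n) (hW : IsWeylTensor W) (τ : ℝ) :
    ∃ K : ℝ, ∀ (ξ : Eucl n) (ε : ℝ), ‖ξ‖ ≤ 1 / 16 → 1 / 2 ≤ ε → ε ≤ 2 →
      energyZero τ W ε + ‖ξ‖ ^ 2 * (weylSq W * normCoeff n τ ε - K * ‖ξ‖)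
        + ev ξ (gradSq W) * (gradCoeffPos n τ ε * (1 - 8 * n * ‖ξ‖) - gradCoeffNeg n τ ε)
      ≤ auxF τ W ξ ε := by
  have hn0 : 0 < n := by omega
  have hn' : (19 : ℝ) ≤ n := by exact_mod_cast hn
  have hp : ((n - 2 : ℕ) : ℝ) = (n : ℝ) - 2 := by push_cast [Nat.cast_sub (show 2 ≤ n by omega)]; rfl
  obtain ⟨K₁, hK₁, h₁⟩ := hW.abs_correction_energy_le hn τ
  -- The density has degree at most 14, and 14 + n < 2(n - 2) is exactly n ≥ 19.
  obtain ⟨K₂, hK₂, h₂⟩ := exists_integral_pw_le (n := n) (p := n - 2) (d := 14) (by omega)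
    (totalDegree_densityPoly_le (W := W) τ) (ev_densityPoly_nonneg τ) (ev_densityPoly_neg τ)
  refine ⟨((n : ℝ) - 2) / (16 * ((n : ℝ) - 1)) * 2 ^ ((n : ℝ) - 2) * K₂ + K₁,
    fun ξ ε hξ hε hε2 => ?_⟩
  have hε0 : 0 < ε := by linarith
  have hξ0 := norm_nonneg ξ
  have a₁ := (abs_le.1 (h₁ ξ ε (by linarith) hε hε2)).1
  have a₂ := h₂ ξ ε hξ hε
  have a₃ := integral_pw_ge (m := n) (d := 16) (by omega)
    (totalDegree_radial_mul_applySq_le (W := W) τ ξ) (ev_radial_mul_applySq_nonneg τ ξ) hξ hε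
  rw [hp, show (n : ℝ) - 2 + 1 = n - 1 by ring, show (n : ℝ) - 2 + 2 = n by ring,
    hW.mom_lin_sq_densityPoly hn0 τ ξ hε0 (by linarith),
    hW.mom_densityPoly hn0 τ hε0 (m := (n : ℝ) - 1) (by linarith)] at a₂
  rw [(hW.hasAverage_applySq hn0 ξ).mom_radial hε0 _ _ (by push_cast; linarith)] at a₃
  rw [auxF_eq hW τ ξ hε0]
  have hc : 0 ≤ ((n : ℝ) - 2) / (16 * ((n : ℝ) - 1)) :=
    div_nonneg (by linarith) (by linarith)
  have hE : ε ^ ((n : ℝ) - 2) ≤ 2 ^ ((n : ℝ) - 2) :=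
    Real.rpow_le_rpow hε0.le hε2 (by linarith)
  have hE0 : 0 ≤ ε ^ ((n : ℝ) - 2) := by positivity
  have b₁ : K₁ * ‖ξ‖ ^ 4 ≤ K₁ * ‖ξ‖ ^ 3 :=
    mul_le_mul_of_nonneg_left
      (pow_le_pow_of_le_one hξ0 (by linarith) (by norm_num)) hK₁
  have b₂ := mul_le_mul_of_nonneg_left a₂ (mul_nonneg hc hE0)
  have b₃ := mul_le_mul_of_nonneg_left a₃
    (by positivity : 0 ≤ 1 / 2 * ((n : ℝ) - 2) ^ 2 * ε ^ ((n : ℝ) - 2))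
  have b₄ : ((n : ℝ) - 2) / (16 * ((n : ℝ) - 1)) * ε ^ ((n : ℝ) - 2) * (K₂ * ‖ξ‖ ^ 3)
      ≤ ((n : ℝ) - 2) / (16 * ((n : ℝ) - 1)) * 2 ^ ((n : ℝ) - 2) * (K₂ * ‖ξ‖ ^ 3) := by
    gcongr
  rw [energyZero, normCoeff, gradCoeffPos, gradCoeffNeg]
  generalize radMom n (coeffF τ) 6 ε n 2 = A at *
  generalize radMom n (coeffG τ) 5 ε n 3 = B at *
  generalize radMom n (coeffF τ) 6 ε ((n : ℝ) - 1) 1 = A' at *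
  generalize radMom n (coeffG τ) 5 ε ((n : ℝ) - 1) 2 = B' at *
  generalize ∫ x, source τ W ξ ε x * correction τ W ξ ε x = Z at *
  generalize ((n : ℝ) - 2) / (16 * ((n : ℝ) - 1)) = c at *
  generalize ε ^ ((n : ℝ) - 2) = E at *
  generalize (2 : ℝ) ^ ((n : ℝ) - 2) = E₂ at *
  generalize (∫ x, pw ξ ε (radial n (coeffF τ) 6 * applySq W ξ) n x) = U at *
  generalize (∫ x, pw ξ ε (densityPoly τ W) ((n : ℝ) - 2) x) = V at *
  generalize mom ε ((n : ℝ) - 2) (densityPoly τ W) = M at *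
  generalize ev ξ (gradSq W) = a at *
  have hn1 : (n : ℝ) ≠ 0 := by positivity
  have hn2 : (n : ℝ) + 2 ≠ 0 := by positivity
  have hn4 : (n : ℝ) + 4 ≠ 0 := by positivity
  have key : -(c * E * M) + ‖ξ‖ ^ 2 * (weylSq W * (c * E *
      ((n - 2) * (A' / n + B' / (2 * n * (n + 2)))
        - 2 * (n - 2) * (n - 1) * (A / (n * (n + 2)) + B / (2 * n * (n + 2) * (n + 4)))))
        - (c * E₂ * K₂ + K₁) * ‖ξ‖)
      + a * (1 / 2 * (n - 2) ^ 2 * E * (A / (2 * n * (n + 2))) * (1 - 8 * n * ‖ξ‖)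
        - c * E * (4 * (n - 2) * (n - 1) * (A / (n * (n + 2)) + B / (n * (n + 2) * (n + 4)))))
      = 1 / 2 * (n - 2) ^ 2 * E * ((1 - 8 * n * ‖ξ‖) * (a / (2 * n * (n + 2)) * A))
        - c * E * (M - (n - 2) * ‖ξ‖ ^ 2 * (weylSq W / n * A' + weylSq W / (2 * n * (n + 2)) * B')
          + 2 * (n - 2) * (n - 1) * ((weylSq W * ‖ξ‖ ^ 2 + 2 * a) / (n * (n + 2)) * A
            + (weylSq W * ‖ξ‖ ^ 2 / 2 + 2 * a) / (n * (n + 2) * (n + 4)) * B))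
        - c * E₂ * (K₂ * ‖ξ‖ ^ 3) - K₁ * ‖ξ‖ ^ 3 := by
    field_simp
    ring
  rw [key]
  rw [mul_add (c * E) _ (K₂ * ‖ξ‖ ^ 3)] at b₂
  linarith

end energyExpansion

/-! ### Continuity in ε of the coefficients. -/

section continuity
variable {n : ℕ}

lemma radMom_eq {ε : ℝ} (hε : 0 < ε) (c : ℕ → ℝ) (N : ℕ) (m : ℝ) (j : ℕ) :
    radMom n c N ε m j = ∑ k ∈ Finset.range (N + 1),
      c k * (ε ^ ((n : ℝ) + 2 * (k + j : ℕ) - 2 * m) * mom 1 m (rsq n ^ (k + j))) :=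
  Finset.sum_congr rfl fun k _ => by rw [mom_scale hε]

lemma continuousAt_radMom (c : ℕ → ℝ) (N : ℕ) (m : ℝ) (j : ℕ) :
    ContinuousAt (fun ε => radMom n c N ε m j) 1 := by
  have h : ContinuousAt (fun ε : ℝ => ∑ k ∈ Finset.range (N + 1),
      c k * (ε ^ ((n : ℝ) + 2 * (k + j : ℕ) - 2 * m) * mom 1 m (rsq n ^ (k + j)))) 1 := by
    refine tendsto_finsetSum _ fun k _ => ?_
    exact ((Real.continuousAt_rpow_const 1 _ (Or.inl one_ne_zero)).mul_const _).const_mul _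
  refine h.congr ?_
  filter_upwards [lt_mem_nhds one_pos] with ε hε
  exact (radMom_eq hε c N m j).symm

lemma continuousAt_coeffs (τ : ℝ) : ContinuousAt (normCoeff n τ) 1 ∧
    ContinuousAt (gradCoeffPos n τ) 1 ∧ ContinuousAt (gradCoeffNeg n τ) 1 := by
  have hE : ContinuousAt (fun ε : ℝ => ε ^ ((n : ℝ) - 2)) 1 :=
    Real.continuousAt_rpow_const 1 _ (Or.inl one_ne_zero)
  have h := fun c N m j => continuousAt_radMom (n := n) c N m j
  refine ⟨?_, ?_, ?_⟩
  · exact (hE.const_mul _).mul (((((h _ _ _ _).div_const _).add ((h _ _ _ _).div_const _)).const_mul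
      _).sub ((((h _ _ _ _).div_const _).add ((h _ _ _ _).div_const _)).const_mul _))
  · exact (hE.const_mul _).mul ((h _ _ _ _).div_const _)
  · exact (hE.const_mul _).mul ((((h _ _ _ _).div_const _).add ((h _ _ _ _).div_const _)).const_mul
      _)

end continuity

/-! ### Positivity and ratios of the radial moments. -/

section radialMoments
variable {n : ℕ}

lemma mom_one_pos {m : ℝ} (hm : (n : ℝ) < 2 * m) : 0 < mom 1 m (rsq n ^ 0) := by
  have hm0 : 0 ≤ m := by
    have : (0 : ℝ) ≤ n := by positivity
    linarith
  have hp : ∀ x, 0 < pw (0 : Eucl n) 1 (rsq n ^ 0) m x := by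
    intro x
    have := weight_pos one_pos 0 x
    simp only [pw, pow_zero, map_one, one_mul]
    positivity
  rw [mom, integral_pos_iff_support_of_nonneg (fun x => (hp x).le)
    (pw_integrable 0 one_pos (d := 0) (by simp) hm0 (by simpa using hm)),
    Function.support_eq_univ (fun x => (hp x).ne')]
  simp [NeZero.pos]

lemma mom_rsq_pos (hn : 0 < n) {m : ℝ} (k : ℕ) (hm : 2 * (k : ℝ) + n < 2 * m) :
    0 < mom 1 m (rsq n ^ k) := by
  have hn' : (0 : ℝ) < n := by exact_mod_cast hn
  induction k with
  | zero => exact mom_one_pos (by simpa using hm)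
  | succ k ih =>
    push_cast at hm
    have h := mom_rsq_step (n := n) (m := m) (k := k) (by linarith)
    have h1 := ih (by linarith)
    refine pos_of_mul_pos_right (a := 2 * m - 2 - n - 2 * k) ?_ (by linarith)
    rw [h]
    positivity

/-- All radial moments are multiples of one positive number. -/
lemma exists_mom_rsq_eq (hn : 0 < n) {m : ℝ} (k L : ℕ) (hm : 2 * ((k : ℝ) + L) + n < 2 * m) :
    ∃ u : ℝ, 0 < u ∧ ∀ j ≤ L, mom 1 m (rsq n ^ (k + j))
      = (∏ i ∈ Finset.range j, ((n : ℝ) + 2 * (k + i)))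
        * (∏ i ∈ Finset.Ico j L, (2 * m - 2 - n - 2 * (k + i))) * u := by
  have hL : (0 : ℝ) ≤ L := by positivity
  have hpos : ∀ i < L, 0 < 2 * m - 2 - n - 2 * ((k : ℝ) + i) := by
    intro i hi
    have : (i : ℝ) + 1 ≤ L := by exact_mod_cast hi
    linarith
  have hP : 0 < ∏ i ∈ Finset.Ico 0 L, (2 * m - 2 - n - 2 * ((k : ℝ) + i)) :=
    Finset.prod_pos fun i hi => hpos i (Finset.mem_Ico.1 hi).2
  -- Dividing the lowest moment by all the denominators of the recursion makes every moment a
  -- polynomial in n and m times u.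
  refine ⟨mom 1 m (rsq n ^ k) / ∏ i ∈ Finset.Ico 0 L, (2 * m - 2 - n - 2 * ((k : ℝ) + i)),
    div_pos (mom_rsq_pos hn k (by linarith)) hP, fun j => ?_⟩
  induction j with
  | zero =>
    intro _
    rw [Finset.prod_range_zero, one_mul, ← mul_div_assoc, mul_div_cancel_left₀ _ hP.ne', add_zero]
  | succ j ih =>
    intro hj
    have h := ih (by omega)
    have hj' : (j : ℝ) + 1 ≤ L := by exact_mod_cast hj
    have hs := mom_rsq_step (n := n) (m := m) (k := k + j) (by push_cast; linarith)
    rw [h, Finset.prod_eq_prod_Ico_succ_bot (by omega)] at hs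
    refine mul_left_cancel₀ (hpos j (by omega)).ne' ?_
    rw [Finset.prod_range_succ]
    push_cast at hs
    rw [← add_assoc k j 1]
    linear_combination hs

end radialMoments

/-! ### The coefficients in terms of I and J. -/

section coefficients
variable {n : ℕ}

/-- At m = n - 2 the scaling exponents combine to the even integers 2(k + j + 1), so the leading
energy is a polynomial in ε². -/
lemma rpow_mul_radMom {ε : ℝ} (hε : 0 < ε) (c : ℕ → ℝ) (N j : ℕ) :
    ε ^ ((n : ℝ) - 2) * radMom n c N ε ((n : ℝ) - 2) j = ∑ k ∈ Finset.range (N + 1),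
      c k * ((ε ^ 2) ^ (k + j + 1) * mom 1 ((n : ℝ) - 2) (rsq n ^ (k + j))) := by
  rw [radMom_eq hε, Finset.mul_sum]
  refine Finset.sum_congr rfl fun k _ => ?_
  have e : ε ^ ((n : ℝ) - 2) * ε ^ ((n : ℝ) + 2 * (k + j : ℕ) - 2 * ((n : ℝ) - 2))
      = (ε ^ 2) ^ (k + j + 1) := by
    rw [← Real.rpow_add hε, ← pow_mul, ← Real.rpow_natCast]
    congr 1
    push_cast
    ring
  rw [← e]
  ring

/-- The leading term of the energy is a negative multiple of `I(ε²)`. -/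
lemma IsWeylTensor.exists_energyZero_eq (hn : 19 ≤ n) {W : Fin n → Fin n → Fin n → Fin n → ℝ}
    (hW : IsWeylTensor W) (hW0 : 0 < weylSq W) (τ : ℝ) :
    ∃ κ : ℝ, 0 < κ ∧ ∀ ε, 0 < ε → energyZero τ W ε = -(κ * polyI n τ (ε ^ 2)) := by
  have hn' : (19 : ℝ) ≤ n := by exact_mod_cast hn
  obtain ⟨v, hv, h⟩ := exists_mom_rsq_eq (n := n) (by omega) (m := (n : ℝ) - 2) 1 6
    (by push_cast; linarith)
  have h1 := h 0 (by norm_num)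
  have h2 := h 1 (by norm_num)
  have h3 := h 2 (by norm_num)
  have h4 := h 3 (by norm_num)
  have h5 := h 4 (by norm_num)
  have h6 := h 5 (by norm_num)
  have h7 := h 6 (by norm_num)
  simp only [Finset.prod_Ico_eq_prod_range, Nat.reduceSub, Nat.reduceAdd, Finset.prod_range_succ,
    Finset.prod_range_zero] at h1 h2 h3 h4 h5 h6 h7
  push_cast at h1 h2 h3 h4 h5 h6 h7
  obtain ⟨x, hx, hnx⟩ : ∃ x : ℝ, 0 ≤ x ∧ (n : ℝ) = x + 19 := ⟨n - 19, by linarith, by ring⟩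
  -- The factor (n + 4)(n + 6)(n - 14)(n - 16)(n - 18) clears the denominators of I.
  refine ⟨((n : ℝ) - 2) / (16 * ((n : ℝ) - 1)) * (weylSq W / n * (((n : ℝ) + 4) * (n + 6) *
    (n - 14) * (n - 16) * (n - 18) * v)), ?_, fun ε hε => ?_⟩
  · have : 0 < (n : ℝ) - 2 := by linarith
    have : 0 < (n : ℝ) - 1 := by linarith
    have : 0 < (n : ℝ) - 14 := by linarith
    have : 0 < (n : ℝ) - 16 := by linarith
    have : 0 < (n : ℝ) - 18 := by linarith
    have : 0 < (n : ℝ) := by linarith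
    positivity
  have e1 := rpow_mul_radMom (n := n) hε (coeffF τ) 6 1
  have e2 := rpow_mul_radMom (n := n) hε (coeffG τ) 5 2
  simp only [Finset.sum_range_succ, Finset.sum_range_zero, coeffF, coeffG, zero_add,
    Nat.reduceAdd, h1, h2, h3, h4, h5, h6, h7] at e1 e2
  rw [energyZero, hW.mom_densityPoly (by omega) τ hε (by linarith)]
  rw [show ∀ c E a A b B : ℝ, -(c * E * (a * A + b * B)) = -(c * (a * (E * A) + b * (E * B))) by
    intros; ring, e1, e2, polyI]
  generalize ε ^ 2 = s
  rw [hnx]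
  have d1 : x + 19 + 2 ≠ 0 := by positivity
  have d2 : x + 19 + 6 ≠ 0 := by positivity
  have d3 : x + 19 + 4 ≠ 0 := by positivity
  have d4 : x + 19 - 14 ≠ 0 := by linarith
  have d5 : x + 19 - 16 ≠ 0 := by linarith
  have d6 : x + 19 - 18 ≠ 0 := by linarith
  have d7 : x + 19 ≠ 0 := by positivity
  have d8 : x + 19 - 1 ≠ 0 := by linarith
  field_simp
  ring

/-- Cleared of denominators, J(1) < 0 reads Aτ + B < 0, and the claim reads Tτ + S < 0, with A, T >
0. The implication follows from TB - AS > 0, which is visible after n = x + 19: all coefficients in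
x are positive. -/
lemma normCoeff_factor_neg {n τ : ℝ} (hn : 19 ≤ n) (hJ : polyJ n τ 1 < 0) :
    (61425 + 58251 * (n - 19) + 107006 / 5 * (n - 19) ^ 2 + 19338 / 5 * (n - 19) ^ 3
        + 1741 / 5 * (n - 19) ^ 4 + 63 / 5 * (n - 19) ^ 5) * τ
      + (465843 + 22950247 / 100 * (n - 19) + 600606 / 5 * (n - 19) ^ 2
        + 176177 / 10 * (n - 19) ^ 3 + 9171 / 5 * (n - 19) ^ 4 + 5103 / 100 * (n - 19) ^ 5) < 0 := by
  obtain ⟨x, hx, rfl⟩ : ∃ x : ℝ, 0 ≤ x ∧ n = x + 19 := ⟨n - 19, by linarith, by ring⟩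
  rw [add_sub_cancel_right]
  have hA : 0 < 1412775 / 2 + 700599 * x + 2752393 / 10 * x ^ 2 + 55178 * x ^ 3 + 59381 / 10 * x ^ 4 + 319
      * x ^ 5 + 63 / 10 * x ^ 6 := by
    positivity
  have hJ' : (1412775 / 2 + 700599 * x + 2752393 / 10 * x ^ 2 + 55178 * x ^ 3 + 59381 / 10 * x ^ 4 + 319
      * x ^ 5 + 63 / 10 * x ^ 6) * τ
      + (129990825 / 16 + 7578501 / 2 * x + 33114085 / 16 * x ^ 2 + 351683 * x ^ 3 + 638267 / 16 *
      x ^ 4 + 4085 / 2 * x ^ 5 + 567 / 16 * x ^ 6) < 0 := by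
    have h : (0 : ℝ) < (x + 23) * (x + 25) * (x + 27) * (x + 7) * (x + 5) * (x + 3) := by positivity
    refine lt_of_eq_of_lt ?_ (mul_neg_of_neg_of_pos hJ h)
    rw [polyJ, show x + 19 - 12 = x + 7 by ring, show x + 19 - 14 = x + 5 by ring,
      show x + 19 - 16 = x + 3 by ring, show x + 19 + 8 = x + 27 by ring,
      show x + 19 + 6 = x + 25 by ring]
    field_simp
    ring
  refine neg_of_mul_neg_left ?_ hA.le
  have hT : 0 < 61425 + 58251 * x + 107006 / 5 * x ^ 2 + 19338 / 5 * x ^ 3 + 1741 / 5 * x ^ 4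
      + 63 / 5 * x ^ 5 := by positivity
  -- This polynomial is TB - AS.
  have hD : 0 < 2719635671025 / 16 + 3480381882729 / 16 * x + 59147013678303 / 400 * x ^ 2 +
      138405207359083 / 2000 * x ^ 3 + 4516530515701 / 200 * x ^ 4 + 5092287302833 / 1000 * x ^
      5 + 160260132439 / 200 * x ^ 6 + 17792306423 / 200 * x ^ 7 + 2758105277 / 400 * x ^ 8 +
      703538569 / 2000 * x ^ 9 + 4096323 / 400 * x ^ 10 + 250047 / 2000 * x ^ 11 := by
    positivity
  linear_combination (exp := 1) (mul_neg_of_pos_of_neg hT hJ') + hD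

/-- The coefficient of `‖ξ‖²` is positive. -/
lemma normCoeff_pos (hn : 19 ≤ n) {τ : ℝ} (hJ : polyJ n τ 1 < 0) : 0 < normCoeff n τ 1 := by
  have hn' : (19 : ℝ) ≤ n := by exact_mod_cast hn
  obtain ⟨u, hu, h⟩ := exists_mom_rsq_eq (n := n) (by omega) (m := (n : ℝ)) 2 6
    (by push_cast; linarith)
  have h2 := h 0 (by norm_num)
  have h3 := h 1 (by norm_num)
  have h4 := h 2 (by norm_num)
  have h5 := h 3 (by norm_num)
  have h6 := h 4 (by norm_num)
  have h7 := h 5 (by norm_num)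
  have h8 := h 6 (by norm_num)
  simp only [Finset.prod_Ico_eq_prod_range, Nat.reduceSub, Nat.reduceAdd, Finset.prod_range_succ,
    Finset.prod_range_zero] at h2 h3 h4 h5 h6 h7 h8
  push_cast at h2 h3 h4 h5 h6 h7 h8
  -- Moments with exponent n - 1 are expressed through those with exponent n, so a single u serves
  -- both.
  have hz : ∀ k : ℕ, k ≤ 7 → mom 1 ((n : ℝ) - 1) (rsq n ^ k)
      = 2 * ((n : ℝ) - 1) * mom 1 n (rsq n ^ (k + 1)) / (n + 2 * k) := by
    intro k hk
    have hk' : (k : ℝ) ≤ 7 := by exact_mod_cast hk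
    have := mom_rsq_succ (n := n) one_pos (m := (n : ℝ) - 1) (k := k) (by linarith)
    rw [sub_add_cancel] at this
    rw [eq_div_iff (by positivity), ← this, mul_comm]
  have z1 := hz 1 (by norm_num)
  have z2 := hz 2 (by norm_num)
  have z3 := hz 3 (by norm_num)
  have z4 := hz 4 (by norm_num)
  have z5 := hz 5 (by norm_num)
  have z6 := hz 6 (by norm_num)
  have z7 := hz 7 (by norm_num)
  simp only [Nat.reduceAdd, h2, h3, h4, h5, h6, h7, h8] at z1 z2 z3 z4 z5 z6 z7
  push_cast at z1 z2 z3 z4 z5 z6 z7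
  have key : normCoeff n τ 1 = ((n : ℝ) - 2) ^ 2 / (8 * n * (n + 2)) * u *
      -((61425 + 58251 * ((n : ℝ) - 19) + 107006 / 5 * (n - 19) ^ 2 + 19338 / 5 * (n - 19) ^ 3
        + 1741 / 5 * (n - 19) ^ 4 + 63 / 5 * (n - 19) ^ 5) * τ
      + (465843 + 22950247 / 100 * (n - 19) + 600606 / 5 * (n - 19) ^ 2
        + 176177 / 10 * (n - 19) ^ 3 + 9171 / 5 * (n - 19) ^ 4 + 5103 / 100 * (n - 19) ^ 5)) := by
    simp only [normCoeff, radMom, Real.one_rpow, Finset.sum_range_succ, Finset.sum_range_zero,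
      coeffF, coeffG, zero_add, Nat.reduceAdd, h2, h3, h4, h5, h6, h7, h8, z1, z2, z3, z4, z5, z6,
      z7]
    have d1 : (n : ℝ) - 1 ≠ 0 := by linarith
    field_simp
    ring
  rw [key]
  have := normCoeff_factor_neg hn' hJ
  have : 0 < (n : ℝ) - 2 := by linarith
  have : 0 < (n : ℝ) := by linarith
  refine mul_pos (by positivity) (by linarith)

/-- The coefficient of `|∂H(ξ)|²` is positive. -/
lemma gradCoeffNeg_lt (hn : 19 ≤ n) {τ : ℝ} (hJ : polyJ n τ 1 < 0) :
    gradCoeffNeg n τ 1 < gradCoeffPos n τ 1 := by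
  have hn' : (19 : ℝ) ≤ n := by exact_mod_cast hn
  obtain ⟨u, hu, h⟩ := exists_mom_rsq_eq (n := n) (by omega) (m := (n : ℝ)) 2 6
    (by push_cast; linarith)
  have h2 := h 0 (by norm_num)
  have h3 := h 1 (by norm_num)
  have h4 := h 2 (by norm_num)
  have h5 := h 3 (by norm_num)
  have h6 := h 4 (by norm_num)
  have h7 := h 5 (by norm_num)
  have h8 := h 6 (by norm_num)
  simp only [Finset.prod_Ico_eq_prod_range, Nat.reduceSub, Nat.reduceAdd, Finset.prod_range_succ,
    Finset.prod_range_zero] at h2 h3 h4 h5 h6 h7 h8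
  push_cast at h2 h3 h4 h5 h6 h7 h8
  have p12 : 0 < (n : ℝ) - 12 := by linarith
  have p14 : 0 < (n : ℝ) - 14 := by linarith
  have p16 : 0 < (n : ℝ) - 16 := by linarith
  have p2 : 0 < (n : ℝ) - 2 := by linarith
  have p0 : 0 < (n : ℝ) := by linarith
  -- The difference is exactly a positive multiple of -J(1).
  have key : gradCoeffPos n τ 1 - gradCoeffNeg n τ 1
      = ((n : ℝ) - 2) ^ 2 / (n * (n + 2)) * u * ((n + 6) * (n + 8) * (n - 12) * (n - 14)
        * (n - 16)) * -polyJ n τ 1 := by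
    simp only [gradCoeffPos, gradCoeffNeg, radMom, Real.one_rpow, Finset.sum_range_succ,
      Finset.sum_range_zero, coeffF, coeffG, zero_add, Nat.reduceAdd, h2, h3, h4, h5, h6, h7, h8,
      polyJ]
    have d1 : (n : ℝ) - 1 ≠ 0 := by linarith
    field_simp
    ring
  have : 0 < ((n : ℝ) - 2) ^ 2 / (n * (n + 2)) * u * ((n + 6) * (n + 8) * (n - 12) * (n - 14)
        * (n - 16)) * -polyJ n τ 1 := mul_pos (by positivity) (by linarith)
  linarith

end coefficients

/-! ### The strict local maximum of I at 1. -/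

section strictMaximum

/-- The strict second derivative test for polynomials. -/
lemma eventually_eval_lt {q : Polynomial ℝ} {a : ℝ} (h1 : q.derivative.eval a = 0)
    (h2 : q.derivative.derivative.eval a < 0) :
    ∀ᶠ s in 𝓝 a, s ≠ a → q.eval s < q.eval a := by
  -- Two divisions give q - q(a) = (X - a)² t with 2t(a) = q''(a) < 0, and t stays negative near a.
  obtain ⟨r, hr⟩ : Polynomial.X - Polynomial.C a ∣ q - Polynomial.C (q.eval a) :=
    Polynomial.dvd_iff_isRoot.2 (by simp)
  have hq : q = (Polynomial.X - Polynomial.C a) * r + Polynomial.C (q.eval a) := by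
    rw [← hr]; ring
  have hr1 : r.eval a = 0 := by
    rw [hq] at h1
    simpa using h1
  obtain ⟨t, ht⟩ : Polynomial.X - Polynomial.C a ∣ r := Polynomial.dvd_iff_isRoot.2 hr1
  have ht2 : t.eval a < 0 := by
    rw [hq, ht] at h2
    simp at h2
    linarith
  filter_upwards [t.continuous.continuousAt.eventually_lt continuousAt_const ht2] with s hs hne
  have e : q.eval s = (s - a) ^ 2 * t.eval s + q.eval a := by
    conv_lhs => rw [hq, ht]
    simp
    ring
  rw [e]
  have := mul_neg_of_pos_of_neg (pow_pos (abs_pos.2 (sub_ne_zero.2 hne)) 2) hs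
  rw [sq_abs] at this
  linarith

lemma exists_eval_eq_polyI (n τ : ℝ) : ∃ q : Polynomial ℝ, ∀ s, q.eval s = polyI n τ s := by
  refine ⟨Polynomial.C ((n - 12) / (n + 6) * ((n - 10) / (n + 4)) * (n - 8) * τ ^ 2)
      * Polynomial.X ^ 2
    + Polynomial.C (10 * ((n - 12) / (n + 6)) * (n - 10) * τ) * Polynomial.X ^ 3
    + Polynomial.C (25 * ((n - 12) / (n + 6)) * (n + 8) - 2 * (n - 12) * τ) * Polynomial.X ^ 4
    + Polynomial.C ((n + 8) / 10 * τ - 10 * (n + 12)) * Polynomial.X ^ 5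
    + Polynomial.C ((n + 8) / (n - 14) * ((3 * n + 52) / 2)) * Polynomial.X ^ 6
    - Polynomial.C ((n + 8) / (n - 14) * ((n + 10) / (n - 16)) * ((n + 24) / 10))
      * Polynomial.X ^ 7
    + Polynomial.C ((n + 8) / (n - 14) * ((n + 10) / (n - 16)) * ((n + 12) / (n - 18))
      * ((n + 32) / 400)) * Polynomial.X ^ 8, fun s => ?_⟩
  simp only [Polynomial.eval_add, Polynomial.eval_sub, Polynomial.eval_mul, Polynomial.eval_C,
    Polynomial.eval_pow, Polynomial.eval_X, polyI]

lemma eventually_polyI_lt {n τ : ℝ} (h1 : deriv (polyI n τ) 1 = 0)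
    (h2 : deriv (deriv (polyI n τ)) 1 < 0) :
    ∀ᶠ s in 𝓝 1, s ≠ 1 → polyI n τ s < polyI n τ 1 := by
  obtain ⟨q, hq⟩ := exists_eval_eq_polyI n τ
  have e : polyI n τ = fun s => q.eval s := funext fun s => (hq s).symm
  have d : ∀ r : Polynomial ℝ, deriv (fun s => r.eval s) = fun s => r.derivative.eval s :=
    fun r => funext fun s => r.deriv
  rw [e, d] at h1
  rw [e, d, d] at h2
  simpa only [hq] using eventually_eval_lt h1 h2

end strictMaximum

/-! ### Conclusion. -/

section strictMinimum

/-- The energy has a strict local minimum at `(0, 1)`. -/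
lemma IsWeylTensor.eventually_auxF_lt {n : ℕ} (hn : 19 ≤ n) (τ : ℝ)
    {W : Fin n → Fin n → Fin n → Fin n → ℝ} (hW : IsWeylTensor W) (hN : 0 < weylSq W)
    (hI1 : deriv (polyI n τ) 1 = 0) (hI2 : deriv (deriv (polyI n τ)) 1 < 0)
    (hJ : polyJ n τ 1 < 0) :
    ∀ᶠ p : Eucl n × ℝ in 𝓝[≠] ((0 : Eucl n), (1 : ℝ)), auxF τ W 0 1 < auxF τ W p.1 p.2 := by
  obtain ⟨κ, hκ, h0⟩ := hW.exists_energyZero_eq hn hN τ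
  obtain ⟨K, hK⟩ := hW.exists_le_auxF hn τ
  obtain ⟨cN, cP, cG⟩ := continuousAt_coeffs (n := n) τ
  have t2 : Tendsto (fun p : Eucl n × ℝ => p.2) (𝓝 (0, 1)) (𝓝 1) :=
    continuous_snd.tendsto ((0 : Eucl n), (1 : ℝ))
  have t1 : Tendsto (fun p : Eucl n × ℝ => ‖p.1‖) (𝓝 (0, 1)) (𝓝 0) := by
    have : Continuous fun p : Eucl n × ℝ => ‖p.1‖ := by fun_prop
    simpa using this.tendsto ((0 : Eucl n), (1 : ℝ))
  have tI : Tendsto (fun p : Eucl n × ℝ => p.2 ^ 2) (𝓝 (0, 1)) (𝓝 1) := by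
    simpa using t2.pow 2
  have tA : Tendsto (fun p : Eucl n × ℝ => weylSq W * normCoeff n τ p.2 - K * ‖p.1‖) (𝓝 (0, 1))
      (𝓝 (weylSq W * normCoeff n τ 1 - K * 0)) :=
    ((cN.tendsto.comp t2).const_mul _).sub (t1.const_mul K)
  have tB : Tendsto (fun p : Eucl n × ℝ => gradCoeffPos n τ p.2 * (1 - 8 * n * ‖p.1‖)
      - gradCoeffNeg n τ p.2) (𝓝 (0, 1))
      (𝓝 (gradCoeffPos n τ 1 * (1 - 8 * n * 0) - gradCoeffNeg n τ 1)) :=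
    ((cP.tendsto.comp t2).mul ((t1.const_mul _).const_sub 1)).sub (cG.tendsto.comp t2)
  have pA : 0 < weylSq W * normCoeff n τ 1 - K * 0 := by
    simpa using mul_pos hN (normCoeff_pos hn hJ)
  have pB : 0 < gradCoeffPos n τ 1 * (1 - 8 * n * 0) - gradCoeffNeg n τ 1 := by
    simpa using gradCoeffNeg_lt hn hJ
  rw [eventually_nhdsWithin_iff]
  filter_upwards [tA.eventually_const_lt pA, tB.eventually_const_lt pB,
    tI.eventually (eventually_polyI_lt hI1 hI2),
    t1.eventually_le_const (show (0 : ℝ) < 1 / 16 by norm_num),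
    t2.eventually_const_le (show (1 / 2 : ℝ) < 1 by norm_num),
    t2.eventually_le_const (show (1 : ℝ) < 2 by norm_num)] with p hA hB hI h16 hε hε2 hne
  obtain ⟨ξ, ε⟩ := p
  dsimp only at hA hB hI h16 hε hε2 ⊢
  have hε0 : 0 < ε := by linarith
  refine lt_of_lt_of_le ?_ (hK ξ ε h16 hε hε2)
  rw [hW.auxF_zero hn τ, h0 1 one_pos, h0 ε hε0, one_pow]
  have hB' := mul_nonneg (ev_gradSq_nonneg (W := W) ξ) hB.le
  have hA' := mul_nonneg (sq_nonneg ‖ξ‖) hA.le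
  -- If ε² = 1 then ε = 1, so ξ ≠ 0 and the |ξ|² term is strictly positive; otherwise strictness
  -- comes from I(ε²) < I(1).
  rcases eq_or_ne (ε ^ 2) 1 with h | h
  · have hξ : ξ ≠ 0 := by
      rintro rfl
      have h1 : ε = 1 := by nlinarith
      exact hne (by rw [h1]; rfl)
    have := mul_pos (pow_pos (norm_pos_iff.2 hξ) 2) hA
    rw [h]
    linarith
  · have := mul_lt_mul_of_pos_left (hI h) hκ
    linarith

end strictMinimum

end
end YamabeBlowup

theorem mainTheorem5 (n : ℕ) (hn : 19 ≤ n) (τ : ℝ)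
    (W : Fin n → Fin n → Fin n → Fin n → ℝ) (hW : YamabeBlowup.IsWeylTensor W)
    (hW0 : 0 < ∑ i, ∑ j, ∑ k, ∑ l, (W i j k l + W i l k j) ^ 2)
    (hI1 : deriv (YamabeBlowup.polyI n τ) 1 = 0)
    (hI2 : deriv (deriv (YamabeBlowup.polyI n τ)) 1 < 0)
    (hJ : YamabeBlowup.polyJ n τ 1 < 0) :
    ∀ᶠ p : YamabeBlowup.Eucl n × ℝ in 𝓝[≠] ((0 : YamabeBlowup.Eucl n), (1 : ℝ)),
      YamabeBlowup.auxF τ W 0 1 < YamabeBlowup.auxF τ W p.1 p.2 :=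
  hW.eventually_auxF_lt hn τ hW0 hI1 hI2 hJ
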